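/- **Setting.** Let $M$ be a smooth $m$-dimensional manifold ($m\ge 1$) with a volume form $\eta$, let $\pi\colon E\to M$ be a fibred manifold (a surjective submersion, e.g. a fibre bundle), all manifolds being finite-dimensional, Hausdorff and second countable. Put $\Lambda=\bigwedge^{m-1}\mathrm T^*M$, $\mathscr E=E\times_M\Lambda$, $\mathcal P=J^1\pi\times_M\Lambda$ and $\mathcal P^*=J^{1*}\pi\times_M\Lambda$, where $J^{1*}\pi=\bigwedge^m_2\mathrm T^*E/\bigwedge^m_1\mathrm T^*E$ and $\bigwedge^m_r\mathrm T^*E$ is the bundle of $m$-forms on $E$ that vanish when $r$ of their arguments are $\pi$-vertical. Let $\rho\colon\mathcal P\to\mathscr E$, $\rho_2\colon\mathscr E\to\Lambda$, $\rho_\circ\colon\mathscr E\to M$, $\tau\colon\mathcal P\to M$, $\overline\tau\colon\mathcal P^*\to M$ be the projections, let $\theta=s^\mu\,\mathrm d^{m-1}x_\mu$ be the tautological $(m-1)$-form of $\Lambda$, and let $\omega$ denote the pull-back of $\eta$ to $\mathcal P$ or $\mathcal P^*$. In coordinates with $\eta=\mathrm d^mx$: * a smooth function $L$ on $\mathcal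 P$ is regular if $\big(\partial^2L/\partial y^a_\mu\partial y^b_\nu\big)$ is nondegenerate everywhere, and $$\Theta_{\mathcal L}=-\frac{\partial L}{\partial y^a_\mu}\mathrm dy^a\wedge\mathrm d^{m-1}x_\mu+\Big(\frac{\partial L}{\partial y^a_\mu}y^a_\mu-L\Big)\mathrm d^mx+\mathrm ds^\mu\wedge\mathrm d^{m-1}x_\mu ;$$ * a Hamiltonian section $\mathbf h$ is a smooth section of $\bigwedge^m_2\mathrm T^*E\times_M\Lambda\to\mathcal P^*$, locally $p=-H(x^\mu,y^a,p_a^\mu,s^\mu)$, and $$\Theta_{\mathcal H}=-p_a^\mu\,\mathrm dy^a\wedge\mathrm d^{m-1}x_\mu+H\,\mathrm d^mx+\mathrm ds^\mu\wedge\mathrm d^{m-1}x_\mu,$$ that is, minus the pull-back by $\mathbf h$ of the Liouville form of $\bigwedge^m_2\mathrm T^*E$ plus the exterior derivative of the pull-back of $\theta$. For $\Theta=\Theta_{\mathcal L}$ or $\Theta_{\mathcal H}$, the Reeb distribution consists of the $v\in\ker\omega$ such that $\iota_z\iota_v\mathrm d\Theta=0$ for all $z\in\ker\omega$; the dissipation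 form is the unique one-form $\sigma_\Theta$ with $\sigma_\Theta\wedge\iota_R\Theta=\iota_R\mathrm d\Theta$ for all Reeb vector fields $R$; and $\overline{\mathrm d}\Theta=\mathrm d\Theta+\sigma_\Theta\wedge\Theta$. A smooth section $\psi$, defined on an open set $U\subseteq M$, is a *solution* if $\psi^*\Theta=0$ and $\psi^*(\iota_X\overline{\mathrm d}\Theta)=0$ for all vector fields $X$. A section of $\tau$ is *holonomic* if its component in $J^1\pi$ is the first jet of its component in $E$. A diffeomorphism $\Phi$ is a *strong Noether symmetry* if $\Phi^*\Theta=\Theta$ and $\Phi^*\omega=\omega$; it is *restricted* if it covers a diffeomorphism $\varphi$ of $M$. A vector field is an *infinitesimal strong Noether symmetry* if the local diffeomorphisms of its flow preserve $\Theta$ and $\omega$; it is *restricted* if it projects onto a vector field on $M$. A diffeomorphism $\Phi$ of $\mathcal P$ is *natural* over $\varphi\in\mathrm{Diff}(M)$ if it is the canonical lift of a diffeomorphism $\Phi_{\mathscr E}$ of $\mathscr E$ with $\rho_2\circ\Phi_{\mathscr E}=\Psi\circ\rho_2$ for a diffeomorphism $\Psi$ of $\Lambda$ and $\rho_\circ\circ\Phi_{\mathscr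 E}=\varphi\circ\rho_\circ$; that is, $\rho\circ\Phi=\Phi_{\mathscr E}\circ\rho$, and $\Phi$ maps a jet $j\colon\mathrm T_xM\to\mathrm T_eE$ to $\mathrm T_e\Phi_E\circ j\circ(\mathrm T_x\varphi)^{-1}$, where $\Phi_E(e')=\rho_1\big(\Phi_{\mathscr E}(e',\beta(\pi(e')))\big)$ is $\Phi_{\mathscr E}$ with the variable $s$ frozen ($\rho_1\colon\mathscr E\to E$ is the projection and $\beta$ an $(m-1)$-form on $M$ through the given point of $\Lambda$, which may be chosen for each point of $\Lambda$). A vector field $Y$ on $\mathcal P$ is *natural* over $Z\in\mathfrak X(M)$ if it is the canonical lift of a vector field $Y_{\mathscr E}$ on $\mathscr E$ that projects by $\rho_2$ onto a vector field on $\Lambda$ and by $\rho_\circ$ onto $Z$; that is, near each point of $\mathcal P$ the local diffeomorphisms of the flow of $Y$ are the canonical lifts of those of the flow of $Y_{\mathscr E}$, over those of the flow of $Z$. **Proposition.** 1. Let $L$ be a regular Lagrangian and $\Phi$ a natural strong Noether symmetry of $(\mathcal P,\Theta_{\mathcal L},\omega)$ over $\varphi$. If $\psi$ is a holonomic section on an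 open set $U\subseteq M$ (for instance $U=M$) which is a solution, then $\Phi\circ\psi\circ\varphi^{-1}$ is a holonomic section on $\varphi(U)$ which is a solution. 2. Let $L$ be a regular Lagrangian and $Y$ a natural infinitesimal strong Noether symmetry of $(\mathcal P,\Theta_{\mathcal L},\omega)$ over $Z$. Then the local diffeomorphisms of its flow map holonomic solutions to holonomic solutions: if $F_t$ and $\varphi_t$ are local flows of $Y$ and $Z$, and $\psi$ is a holonomic solution on an open set $U$ contained in the domain of $\varphi_t$ with $\psi(U)$ in the domain of $F_t$, then $F_t\circ\psi\circ\varphi_t^{-1}$ is a holonomic solution on $\varphi_t(U)$. 3. Let $\mathbf h$ be a Hamiltonian section and $\Phi$ a restricted strong Noether symmetry of $(\mathcal P^*,\Theta_{\mathcal H},\omega)$ over $\varphi\in\mathrm{Diff}(M)$. If a section $\psi\colon U\to\mathcal P^*$ of $\overline\tau$ is a solution, then so is $\Phi\circ\psi\circ\varphi^{-1}$, on $\varphi(U)$. 4. Let $\mathbf h$ be a Hamiltonian section and $Y$ a restricted infinitesimal strong Noether symmetry of $(\mathcal P^*,\Theta_{\mathcal H},\omega)$ that projects onto $Z\in\mathfrak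 X(M)$. Then the local diffeomorphisms of its flow map solutions to solutions, in the sense of item 2 without holonomy. -/

import Mathlib

open scoped Manifold ContDiff Topology
open Set

set_option linter.unusedSectionVars false
noncomputable section

namespace Multicontact

section ChartDerivatives

variable {V N : Type*} [NormedAddCommGroup V] [NormedSpace ℝ V]
  [TopologicalSpace N] [ChartedSpace V N]

/-- The differential at `x` of a chart `c`, as a map `T_x N → V`. -/
def chartD (c : OpenPartialHomeomorph N V) (x : N) : TangentSpace 𝓘(ℝ, V) x →L[ℝ] V :=
  mfderiv 𝓘(ℝ, V) 𝓘(ℝ, V) c x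

/-- The differential at `c x` of the inverse of a chart `c`, as a map `V → T_x N`. -/
def chartDInv (c : OpenPartialHomeomorph N V) (x : N) : V →L[ℝ] TangentSpace 𝓘(ℝ, V) x :=
  mfderiv 𝓘(ℝ, V) 𝓘(ℝ, V) c.symm (c x)

lemma mdiff_chart {c : OpenPartialHomeomorph N V}
    (hc : c ∈ IsManifold.maximalAtlas 𝓘(ℝ, V) ∞ N) {x : N} (hx : x ∈ c.source) :
    MDifferentiableAt 𝓘(ℝ, V) 𝓘(ℝ, V) c x :=
  (contMDiffAt_of_mem_maximalAtlas hc hx).mdifferentiableAt (by simp)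

lemma mdiff_chart_symm {c : OpenPartialHomeomorph N V}
    (hc : c ∈ IsManifold.maximalAtlas 𝓘(ℝ, V) ∞ N) {x : N} (hx : x ∈ c.source) :
    MDifferentiableAt 𝓘(ℝ, V) 𝓘(ℝ, V) c.symm (c x) :=
  (contMDiffAt_symm_of_mem_maximalAtlas hc (c.map_source hx)).mdifferentiableAt (by simp)

lemma chartD_chartDInv {c : OpenPartialHomeomorph N V}
    (hc : c ∈ IsManifold.maximalAtlas 𝓘(ℝ, V) ∞ N) {x : N} (hx : x ∈ c.source) (v : V) :
    chartD c x (chartDInv c x v) = v := by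
  have h1 := mdiff_chart_symm hc hx
  have h2 : MDifferentiableAt 𝓘(ℝ, V) 𝓘(ℝ, V) c (c.symm (c x)) := by
    rw [c.left_inv hx]; exact mdiff_chart hc hx
  have h := mfderiv_comp (c x) h2 h1
  have h3 : mfderiv 𝓘(ℝ, V) 𝓘(ℝ, V) (c ∘ c.symm) (c x) = ContinuousLinearMap.id ℝ V := by
    have := mfderiv_id (I := 𝓘(ℝ, V)) (x := c x)
    refine Eq.trans ?_ this
    apply Filter.EventuallyEq.mfderiv_eq
    filter_upwards [c.open_target.mem_nhds (c.map_source hx)] with z hz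
    simp [c.right_inv hz]
  rw [h3] at h
  have h4 := congrArg (fun T : V →L[ℝ] V => T v) h
  rw [c.left_inv hx] at h4
  exact h4.symm

lemma chartDInv_chartD {c : OpenPartialHomeomorph N V}
    (hc : c ∈ IsManifold.maximalAtlas 𝓘(ℝ, V) ∞ N) {x : N} (hx : x ∈ c.source)
    (v : TangentSpace 𝓘(ℝ, V) x) : chartDInv c x (chartD c x v) = v := by
  have h := mfderiv_comp x (mdiff_chart_symm hc hx) (mdiff_chart hc hx)
  have h3 : mfderiv 𝓘(ℝ, V) 𝓘(ℝ, V) (c.symm ∘ c) x = ContinuousLinearMap.id ℝ V := by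
    have := mfderiv_id (I := 𝓘(ℝ, V)) (x := x)
    refine Eq.trans ?_ this
    apply Filter.EventuallyEq.mfderiv_eq
    filter_upwards [c.open_source.mem_nhds hx] with z hz
    simp [c.left_inv hz]
  have h4 := congrArg (fun T : V →L[ℝ] V => T v) (h3.symm.trans h)
  exact h4.symm

lemma chartD_chartDInv_trans {c c' : OpenPartialHomeomorph N V}
    (hc : c ∈ IsManifold.maximalAtlas 𝓘(ℝ, V) ∞ N)
    (hc' : c' ∈ IsManifold.maximalAtlas 𝓘(ℝ, V) ∞ N) {x : N} (hx : x ∈ c.source)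
    (hx' : x ∈ c'.source) (v : V) :
    chartD c' x (chartDInv c x v) = fderiv ℝ (c' ∘ c.symm) (c x) v := by
  have h2 : MDifferentiableAt 𝓘(ℝ, V) 𝓘(ℝ, V) c' (c.symm (c x)) := by
    rw [c.left_inv hx]; exact mdiff_chart hc' hx'
  have h := mfderiv_comp (c x) h2 (mdiff_chart_symm hc hx)
  rw [mfderiv_eq_fderiv] at h
  have h4 := congrArg (fun T : V →L[ℝ] V => T v) h
  rw [c.left_inv hx] at h4
  exact h4.symm

lemma contDiffOn_chart_trans {c c' : OpenPartialHomeomorph N V}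
    (hc : c ∈ IsManifold.maximalAtlas 𝓘(ℝ, V) ∞ N)
    (hc' : c' ∈ IsManifold.maximalAtlas 𝓘(ℝ, V) ∞ N) :
    ContDiffOn ℝ ∞ (c' ∘ c.symm) (c.symm.trans c').source := by
  rw [← contMDiffOn_iff_contDiffOn]
  refine (contMDiffOn_of_mem_maximalAtlas hc').comp
    ((contMDiffOn_symm_of_mem_maximalAtlas hc).mono ?_) ?_
  · intro z hz; exact hz.1
  · intro z hz; exact hz.2

lemma contDiffOn_fderiv_chart_trans {c c' : OpenPartialHomeomorph N V}
    (hc : c ∈ IsManifold.maximalAtlas 𝓘(ℝ, V) ∞ N)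
    (hc' : c' ∈ IsManifold.maximalAtlas 𝓘(ℝ, V) ∞ N) :
    ContDiffOn ℝ ∞ (fderiv ℝ (c' ∘ c.symm)) (c.symm.trans c').source :=
  (contDiffOn_chart_trans hc hc').fderiv_of_isOpen (c.symm.trans c').open_source (by simp)

end ChartDerivatives

section Pullback
variable {V W : Type*} [NormedAddCommGroup V] [NormedSpace ℝ V]
  [NormedAddCommGroup W] [NormedSpace ℝ W]

/-- Pull-back of alternating forms is a smooth function of the linear map. -/
lemma contDiff_pullbackCLM (k : ℕ) : ContDiff ℝ ∞
    (ContinuousAlternatingMap.compContinuousLinearMapCLM :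
      (V →L[ℝ] W) → (W [⋀^Fin k]→L[ℝ] ℝ) →L[ℝ] (V [⋀^Fin k]→L[ℝ] ℝ)) := by
  let alt : ContinuousMultilinearMap ℝ (fun _ : Fin k => V) ℝ →L[ℝ] (V [⋀^Fin k]→L[ℝ] ℝ) :=
    LinearMap.mkContinuous
      { toFun := ContinuousMultilinearMap.alternatization
        map_add' := fun f g => map_add _ f g
        map_smul' := fun r f => by
          ext v
          simp [ContinuousMultilinearMap.alternatization_apply_apply, Finset.mul_sum,
            mul_left_comm, Units.smul_def] } (Fintype.card (Equiv.Perm (Fin k))) (by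
      intro f
      refine ContinuousAlternatingMap.opNorm_le_bound _ (by positivity) fun v => ?_
      simp only [LinearMap.coe_mk, AddHom.coe_mk,
        ContinuousMultilinearMap.alternatization_apply_apply]
      refine (norm_sum_le _ _).trans ?_
      rw [mul_assoc, ← nsmul_eq_mul]
      refine Finset.sum_le_card_nsmul _ _ _ fun σ _ => ?_
      have h1 : ‖Equiv.Perm.sign σ • f (v ∘ σ)‖ = ‖f (v ∘ σ)‖ := by
        rcases Int.units_eq_one_or (Equiv.Perm.sign σ) with h | h <;> simp [h]
      rw [h1]
      refine (f.le_opNorm _).trans_eq ?_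
      congr 1
      exact Equiv.prod_comp σ (fun i => ‖v i‖))
  have key : (ContinuousAlternatingMap.compContinuousLinearMapCLM :
      (V →L[ℝ] W) → (W [⋀^Fin k]→L[ℝ] ℝ) →L[ℝ] (V [⋀^Fin k]→L[ℝ] ℝ)) = fun g =>
      ((Fintype.card (Equiv.Perm (Fin k)) : ℝ)⁻¹) • (alt ∘L
        (ContinuousMultilinearMap.compContinuousLinearMapContinuousMultilinear ℝ
          (fun _ : Fin k => V) (fun _ => W) ℝ (fun _ => g)) ∘L
        (ContinuousAlternatingMap.toContinuousMultilinearMapCLM ℝ)) := by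
    funext g
    ext f v
    have : ∀ σ : Equiv.Perm (Fin k), Equiv.Perm.sign σ • f (fun i => g (v (σ i))) =
        f (fun i => g (v i)) := by
      intro σ
      have := f.toAlternatingMap.map_perm (fun i => g (v i)) σ
      change f (fun i => g (v (σ i))) = Equiv.Perm.sign σ • f (fun i => g (v i)) at this
      rw [this, smul_smul]; simp
    simp [alt, ContinuousMultilinearMap.alternatization_apply_apply, this]
    rfl
  rw [key]
  have h1 : ContDiff ℝ ∞ (fun g : V →L[ℝ] W =>
      ContinuousMultilinearMap.compContinuousLinearMapContinuousMultilinear ℝ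
          (fun _ : Fin k => V) (fun _ => W) ℝ (fun _ => g)) :=
    (ContinuousMultilinearMap.contDiff _).comp (contDiff_pi.2 fun _ => contDiff_id)
  refine ContDiff.const_smul _ (contDiff_const.clm_comp (ContDiff.clm_comp h1 contDiff_const))
end Pullback


/-- The total space of a family of fibres `Q x`, `x ∈ X`. -/
structure Tot {X : Type*} (Q : X → Type*) where
  /-- the base point -/
  base : X
  /-- the point of the fibre -/
  fib : Q base

/-- Fibre coordinates on the family `Q` over a manifold `X`, relative to a set of charts of `X`
covering `X`, with values in a normed space and with smooth transition functions. -/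
structure FibreAtlas (V : Type*) {X : Type*} [NormedAddCommGroup V] [NormedSpace ℝ V]
    [TopologicalSpace X] [ChartedSpace V X] (ι : Type*) (Q : X → Type*)
    (N : Type*) [NormedAddCommGroup N] [NormedSpace ℝ N] where
  /-- charts of the base -/
  chart : ι → OpenPartialHomeomorph X V
  chart_mem : ∀ i, chart i ∈ IsManifold.maximalAtlas 𝓘(ℝ, V) ∞ X
  /-- fibre coordinates -/
  coord : ι → (x : X) → Q x → N
  /-- the point of the fibre with given coordinates -/
  inv : ι → (x : X) → N → Q x
  inv_coord : ∀ i, ∀ x ∈ (chart i).source, ∀ q, inv i x (coord i x q) = q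
  coord_inv : ∀ i, ∀ x ∈ (chart i).source, ∀ a, coord i x (inv i x a) = a
  contDiffOn_coord : ∀ i j, ContDiffOn ℝ ∞
    (fun w : V × N => coord j ((chart i).symm w.1) (inv i ((chart i).symm w.1) w.2))
    (((chart i).symm.trans (chart j)).source ×ˢ univ)
  /-- a preferred chart around each point -/
  indexAt : X → ι
  mem_indexAt : ∀ x, x ∈ (chart (indexAt x)).source

namespace FibreAtlas

variable {V X : Type*} [NormedAddCommGroup V] [NormedSpace ℝ V] [TopologicalSpace X]
  [ChartedSpace V X] {ι : Type*} {Q : X → Type*}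
  {N : Type*} [NormedAddCommGroup N] [NormedSpace ℝ N] (𝒜 : FibreAtlas V ι Q N)

/-- The chart of the total space given by a chart of the base and the fibre coordinates. -/
def totChart (i : ι) : PartialEquiv (Tot Q) (V × N) where
  toFun p := (𝒜.chart i p.base, 𝒜.coord i p.base p.fib)
  invFun w := ⟨(𝒜.chart i).symm w.1, 𝒜.inv i _ w.2⟩
  source := Tot.base ⁻¹' (𝒜.chart i).source
  target := (𝒜.chart i).target ×ˢ univ
  map_source' p hp := ⟨(𝒜.chart i).map_source hp, mem_univ _⟩
  map_target' w hw := (𝒜.chart i).map_target hw.1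
  left_inv' := by
    rintro ⟨x, q⟩ hp
    have hx : x ∈ (𝒜.chart i).source := hp
    have h : ∀ y, y = x → ∀ a, a = 𝒜.coord i x q → (⟨y, 𝒜.inv i y a⟩ : Tot Q) = ⟨x, q⟩ := by
      rintro y rfl a rfl
      rw [𝒜.inv_coord i _ hx]
    exact h _ ((𝒜.chart i).left_inv hx) _ rfl
  right_inv' := by
    rintro ⟨z, a⟩ hw
    have hz : z ∈ (𝒜.chart i).target := hw.1
    exact Prod.ext ((𝒜.chart i).right_inv hz) (𝒜.coord_inv i _ ((𝒜.chart i).map_target hz) a)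

lemma totChart_trans_source (i j : ι) :
    ((𝒜.totChart i).symm.trans (𝒜.totChart j)).source =
      ((𝒜.chart i).symm.trans (𝒜.chart j)).source ×ˢ univ := by
  ext ⟨z, a⟩
  change ((z ∈ _ ∧ _) ∧ _ ∈ _) ↔ ((_ ∧ _) ∧ _)
  simp only [mem_univ, and_true]
  exact Iff.rfl

lemma contDiffOn_totChart_trans (i j : ι) :
    ContDiffOn ℝ ∞ ((𝒜.totChart i).symm.trans (𝒜.totChart j))
      ((𝒜.totChart i).symm.trans (𝒜.totChart j)).source := by
  rw [totChart_trans_source]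
  refine ContDiffOn.prodMk ?_ (𝒜.contDiffOn_coord i j)
  exact (contDiffOn_chart_trans (𝒜.chart_mem i) (𝒜.chart_mem j)).comp contDiffOn_fst
    (fun w hw => hw.1)

/-- The charts `totChart`, as an atlas of the total space. -/
def core : ChartedSpaceCore (V × N) (Tot Q) where
  atlas := range 𝒜.totChart
  chartAt p := 𝒜.totChart (𝒜.indexAt p.base)
  mem_chart_source p := 𝒜.mem_indexAt p.base
  chart_mem_atlas p := mem_range_self _
  open_source := by
    rintro _ _ ⟨i, rfl⟩ ⟨j, rfl⟩
    rw [totChart_trans_source]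
    exact ((𝒜.chart i).symm.trans (𝒜.chart j)).open_source.prod isOpen_univ
  continuousOn_toFun := by
    rintro _ _ ⟨i, rfl⟩ ⟨j, rfl⟩
    exact (𝒜.contDiffOn_totChart_trans i j).continuousOn

lemma isManifold_core :
    @IsManifold ℝ _ (V × N) _ _ (V × N) _ 𝓘(ℝ, V × N) ∞ (Tot Q)
      𝒜.core.toTopologicalSpace 𝒜.core.toChartedSpace := by
  let _ := 𝒜.core.toTopologicalSpace
  let _ := 𝒜.core.toChartedSpace
  refine isManifold_of_contDiffOn _ _ _ ?_
  intro e e' he he'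
  obtain ⟨_, ⟨_, rfl⟩, _, ⟨⟨i, rfl⟩, rfl⟩, rfl⟩ := he
  obtain ⟨_, ⟨_, rfl⟩, _, ⟨⟨j, rfl⟩, rfl⟩, rfl⟩ := he'
  simpa using! 𝒜.contDiffOn_totChart_trans i j

end FibreAtlas

/-! ### Fibred manifolds and adapted charts -/

section Bundles

variable {B F M E : Type*} [NormedAddCommGroup B] [NormedSpace ℝ B]
  [NormedAddCommGroup F] [NormedSpace ℝ F]
  [TopologicalSpace M] [ChartedSpace B M]
  [TopologicalSpace E] [ChartedSpace (B × F) E]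

variable (B F M E) in
/-- A fibred manifold `π : E → M`, that is, a surjective submersion. Fibre bundles are examples.
The base `M` is modelled on `B`, and the total space `E` is modelled on `B × F`. -/
structure FibredManifold where
  /-- the projection -/
  proj : E → M
  surjective : Function.Surjective proj
  isSubmersion : Manifold.IsSubmersionOfComplement F 𝓘(ℝ, B × F) 𝓘(ℝ, B) ∞ proj

/-- The differential of the projection of a fibred manifold. -/
def FibredManifold.tproj (π : FibredManifold B F M E) (e : E) :
    TangentSpace 𝓘(ℝ, B × F) e →L[ℝ] TangentSpace 𝓘(ℝ, B) (π.proj e) :=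
  mfderiv 𝓘(ℝ, B × F) 𝓘(ℝ, B) π.proj e

/-- A pair of charts of `E` and `M` in which the projection is `(x, y) ↦ x`: fibred (or natural)
coordinates `(x^μ, y^a)`. -/
structure AdaptedChart (π : FibredManifold B F M E) where
  /-- the chart `(x, y)` of the total space -/
  tot : OpenPartialHomeomorph E (B × F)
  /-- the chart `x` of the base -/
  bas : OpenPartialHomeomorph M B
  tot_mem : tot ∈ IsManifold.maximalAtlas 𝓘(ℝ, B × F) ∞ E
  bas_mem : bas ∈ IsManifold.maximalAtlas 𝓘(ℝ, B) ∞ M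
  mapsTo : ∀ e ∈ tot.source, π.proj e ∈ bas.source
  fst_tot : ∀ e ∈ tot.source, (tot e).1 = bas (π.proj e)

variable [IsManifold 𝓘(ℝ, B) ∞ M] [IsManifold 𝓘(ℝ, B × F) ∞ E]

lemma FibredManifold.exists_adaptedChart (π : FibredManifold B F M E) (e : E) :
    ∃ c : AdaptedChart π, e ∈ c.tot.source := by
  have h := π.isSubmersion e
  refine ⟨⟨h.domChart.transHomeomorph h.equiv.toHomeomorph, h.codChart, ?_,
    h.codChart_mem_maximalAtlas, fun x hx => h.mapsto_domChart_source_codChart_source hx, ?_⟩,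
    h.mem_domChart_source⟩
  · refine OpenPartialHomeomorph.mem_maximalAtlas_of_contMDiffOn _ ?_ ?_
    · exact h.equiv.contDiff.contMDiff.comp_contMDiffOn
        (contMDiffOn_of_mem_maximalAtlas h.domChart_mem_maximalAtlas)
    · exact (contMDiffOn_symm_of_mem_maximalAtlas h.domChart_mem_maximalAtlas).comp
        h.equiv.symm.contDiff.contMDiff.contMDiffOn (fun z hz => hz)
  · intro x hx
    have h2 : h.domChart x ∈ (h.domChart.extend 𝓘(ℝ, B × F)).target := by
      simpa using h.domChart.map_source hx
    replace h2 := h.writtenInCharts h2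
    have h3 : h.domChart.symm (h.domChart x) = x := h.domChart.left_inv hx
    simp [h3] at h2
    exact h2.symm

/-- A choice of fibred coordinates around each point. -/
def FibredManifold.adaptedChartAt (π : FibredManifold B F M E) (e : E) : AdaptedChart π :=
  (π.exists_adaptedChart e).choose

lemma FibredManifold.mem_adaptedChartAt (π : FibredManifold B F M E) (e : E) :
    e ∈ (π.adaptedChartAt e).tot.source :=
  (π.exists_adaptedChart e).choose_spec

namespace AdaptedChart

variable {π : FibredManifold B F M E} (c c' : AdaptedChart π)

lemma chartD_tproj {e : E} (he : e ∈ c.tot.source) (u : TangentSpace 𝓘(ℝ, B × F) e) :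
    chartD c.bas (π.proj e) (π.tproj e u) = (chartD c.tot e u).1 := by
  have hπ : MDifferentiableAt 𝓘(ℝ, B × F) 𝓘(ℝ, B) π.proj e :=
    ((π.isSubmersion e).contMDiffAt).mdifferentiableAt (by simp)
  have h1 := mfderiv_comp e (mdiff_chart c.bas_mem (c.mapsTo e he)) hπ
  have h2 := mfderiv_comp (I'' := 𝓘(ℝ, B)) e (g := (Prod.fst : B × F → B))
    (by exact mdifferentiableAt_iff_differentiableAt.2 differentiableAt_fst)
    (mdiff_chart c.tot_mem he)
  have h3 : mfderiv 𝓘(ℝ, B × F) 𝓘(ℝ, B) (c.bas ∘ π.proj) e =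
      mfderiv 𝓘(ℝ, B × F) 𝓘(ℝ, B) ((Prod.fst : B × F → B) ∘ c.tot) e := by
    apply Filter.EventuallyEq.mfderiv_eq
    filter_upwards [c.tot.open_source.mem_nhds he] with x hx
    exact (c.fst_tot x hx).symm
  rw [mfderiv_eq_fderiv, fderiv_fst] at h2
  have h4 := congrArg (fun T : (B × F) →L[ℝ] B => T u) ((h1.symm.trans h3).trans h2)
  exact h4

end AdaptedChart

/-! ### Forms at a point, jets and dual jets at a point -/

/-- Alternating `k`-forms on the tangent space `T_x N`. -/
abbrev FormAt {V N : Type*} [NormedAddCommGroup V] [NormedSpace ℝ V] [TopologicalSpace N]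
    [ChartedSpace V N] (k : ℕ) (x : N) : Type _ :=
  TangentSpace 𝓘(ℝ, V) x [⋀^Fin k]→L[ℝ] ℝ

/-- The fibre of `J¹π` at `e`: linear maps `j : T_{π(e)} M → T_e E` with `Tπ ∘ j = id`. -/
structure Jet (π : FibredManifold B F M E) (e : E) where
  /-- the linear map (the differential at `π(e)` of a local section through `e`) -/
  toHom : TangentSpace 𝓘(ℝ, B) (π.proj e) →L[ℝ] TangentSpace 𝓘(ℝ, B × F) e
  tproj_toHom : ∀ v, π.tproj e (toHom v) = v

lemma Jet.ext' {π : FibredManifold B F M E} {e : E} {j j' : Jet π e}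
    (h : ∀ v, j.toHom v = j'.toHom v) : j = j' := by
  cases j; cases j'
  congr
  exact ContinuousLinearMap.ext h

namespace AdaptedChart

variable {π : FibredManifold B F M E} (c c' : AdaptedChart π)

/-- The coordinates `y^a_μ` of a jet. -/
def jetCoord (e : E) (j : Jet π e) : B →L[ℝ] F :=
  ContinuousLinearMap.snd ℝ B F ∘L chartD c.tot e ∘L j.toHom ∘L chartDInv c.bas (π.proj e)

/-- The jet with given coordinates `y^a_μ`. -/
def jetOfCoord {e : E} (he : e ∈ c.tot.source) (A : B →L[ℝ] F) : Jet π e where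
  toHom := chartDInv c.tot e ∘L ((ContinuousLinearMap.id ℝ B).prod A) ∘L chartD c.bas (π.proj e)
  tproj_toHom v := by
    have h := c.chartD_tproj he
      (chartDInv c.tot e (chartD c.bas (π.proj e) v, A (chartD c.bas (π.proj e) v)))
    rw [chartD_chartDInv c.tot_mem he] at h
    have h2 := congrArg (chartDInv c.bas (π.proj e)) h
    rw [chartDInv_chartD c.bas_mem (c.mapsTo e he),
      chartDInv_chartD c.bas_mem (c.mapsTo e he)] at h2
    exact h2

open Classical in
/-- `jetOfCoord`, extended by a junk value outside of the domain of the chart. -/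
def jetInv (e : E) (A : B →L[ℝ] F) : Jet π e :=
  if he : e ∈ c.tot.source then c.jetOfCoord he A
  else (π.adaptedChartAt e).jetOfCoord (π.mem_adaptedChartAt e) 0

lemma jetInv_toHom {e : E} (he : e ∈ c.tot.source) (A : B →L[ℝ] F)
    (v : TangentSpace 𝓘(ℝ, B) (π.proj e)) :
    (c.jetInv e A).toHom v = chartDInv c.tot e
      (chartD c.bas (π.proj e) v, A (chartD c.bas (π.proj e) v)) := by
  rw [jetInv, dif_pos he]; rfl

lemma jetInv_jetCoord {e : E} (he : e ∈ c.tot.source) (j : Jet π e) :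
    c.jetInv e (c.jetCoord e j) = j := by
  apply Jet.ext'
  intro v
  rw [jetInv_toHom _ he]
  have h1 : c.jetCoord e j (chartD c.bas (π.proj e) v) = (chartD c.tot e (j.toHom v)).2 := by
    change (chartD c.tot e (j.toHom (chartDInv c.bas (π.proj e)
      (chartD c.bas (π.proj e) v)))).2 = _
    rw [chartDInv_chartD c.bas_mem (c.mapsTo e he)]
  have h2 : chartD c.bas (π.proj e) v = (chartD c.tot e (j.toHom v)).1 := by
    rw [← c.chartD_tproj he, j.tproj_toHom]
  rw [h1, h2]
  exact chartDInv_chartD c.tot_mem he _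

lemma jetCoord_jetInv {e : E} (he : e ∈ c.tot.source) (A : B →L[ℝ] F) :
    c.jetCoord e (c.jetInv e A) = A := by
  ext v
  change (chartD c.tot e ((c.jetInv e A).toHom (chartDInv c.bas (π.proj e) v))).2 = _
  rw [jetInv_toHom _ he, chartD_chartDInv c.tot_mem he, chartD_chartDInv c.bas_mem (c.mapsTo e he)]

/-- The derivative of the transition function of the base from `c'` to `c`, at the point with
coordinates `z` in the chart `c`. -/
def baseTrans (z : B × F) : B →L[ℝ] B :=
  fderiv ℝ (c.bas ∘ c'.bas.symm) ((c'.tot ∘ c.tot.symm) z).1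

lemma contDiffOn_baseTrans : ContDiffOn ℝ ∞ (c.baseTrans c') (c.tot.symm.trans c'.tot).source := by
  refine (contDiffOn_fderiv_chart_trans c'.bas_mem c.bas_mem).comp
    ((contDiffOn_chart_trans c.tot_mem c'.tot_mem).fst) ?_
  intro z hz
  have h1 : c.tot.symm z ∈ c.tot.source := c.tot.map_target hz.1
  have h2 : c.tot.symm z ∈ c'.tot.source := hz.2
  have h3 := c'.fst_tot _ h2
  change (c'.tot (c.tot.symm z)).1 ∈ _
  rw [h3]
  refine ⟨c'.bas.map_source (c'.mapsTo _ h2), ?_⟩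
  change c'.bas.symm (c'.bas (π.proj (c.tot.symm z))) ∈ c.bas.source
  rw [c'.bas.left_inv (c'.mapsTo _ h2)]
  exact c.mapsTo _ h1

lemma baseTrans_eq {z : B × F} (hz : z ∈ (c.tot.symm.trans c'.tot).source) (v : B) :
    c.baseTrans c' z v = chartD c.bas (π.proj (c.tot.symm z))
      (chartDInv c'.bas (π.proj (c.tot.symm z)) v) := by
  have h1 : c.tot.symm z ∈ c.tot.source := c.tot.map_target hz.1
  have h2 : c.tot.symm z ∈ c'.tot.source := hz.2
  rw [chartD_chartDInv_trans c'.bas_mem c.bas_mem (c'.mapsTo _ h2) (c.mapsTo _ h1), baseTrans,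
    Function.comp_apply, c'.fst_tot _ h2]

lemma totTrans_eq {z : B × F} (hz : z ∈ (c.tot.symm.trans c'.tot).source) (u : B × F) :
    chartD c'.tot (c.tot.symm z) (chartDInv c.tot (c.tot.symm z) u) =
      fderiv ℝ (c'.tot ∘ c.tot.symm) z u := by
  have h1 : c.tot.symm z ∈ c.tot.source := c.tot.map_target hz.1
  rw [chartD_chartDInv_trans c.tot_mem c'.tot_mem h1 hz.2, c.tot.right_inv hz.1]

lemma contDiffOn_jetCoord : ContDiffOn ℝ ∞
    (fun w : (B × F) × (B →L[ℝ] F) => c'.jetCoord (c.tot.symm w.1) (c.jetInv _ w.2))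
    ((c.tot.symm.trans c'.tot).source ×ˢ univ) := by
  have h : ContDiffOn ℝ ∞ (fun w : (B × F) × (B →L[ℝ] F) =>
      ContinuousLinearMap.snd ℝ B F ∘L fderiv ℝ (c'.tot ∘ c.tot.symm) w.1 ∘L
        (ContinuousLinearMap.inl ℝ B F + ContinuousLinearMap.inr ℝ B F ∘L w.2) ∘L
          c.baseTrans c' w.1) ((c.tot.symm.trans c'.tot).source ×ˢ univ) := by
    have h1 := (contDiffOn_fderiv_chart_trans c.tot_mem c'.tot_mem).comp
      (contDiffOn_fst (s := (c.tot.symm.trans c'.tot).source ×ˢ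
        (univ : Set (B →L[ℝ] F)))) (fun w hw => hw.1)
    have h2 := (c.contDiffOn_baseTrans c').comp
      (contDiffOn_fst (s := (c.tot.symm.trans c'.tot).source ×ˢ
        (univ : Set (B →L[ℝ] F)))) (fun w hw => hw.1)
    exact contDiffOn_const.clm_comp (h1.clm_comp
      (((contDiffOn_const.add (contDiffOn_const.clm_comp contDiffOn_snd))).clm_comp h2))
  refine h.congr ?_
  rintro ⟨z, A⟩ ⟨hz, -⟩
  have h1 : c.tot.symm z ∈ c.tot.source := c.tot.map_target hz.1
  ext v
  change (chartD c'.tot (c.tot.symm z) ((c.jetInv _ A).toHom (chartDInv c'.bas _ v))).2 = _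
  rw [jetInv_toHom _ h1, totTrans_eq _ _ hz, ← baseTrans_eq _ _ hz]
  simp [← Prod.snd_add, ← map_add]

end AdaptedChart

end Bundles

/-! ### Linear algebra of the fibre coordinates `p_a^μ` -/

section DualModel

variable {B F : Type*} [NormedAddCommGroup B] [NormedSpace ℝ B]
  [NormedAddCommGroup F] [NormedSpace ℝ F] {k : ℕ}

/-- The components `f ↦ (v₁, …, v_k) ↦ a ((0, f), (v₁, 0), …, (v_k, 0))` of a form on `B × F`. -/
def dualModel (a : (B × F) [⋀^Fin (k + 1)]→L[ℝ] ℝ) : F →L[ℝ] (B [⋀^Fin k]→L[ℝ] ℝ) :=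
  ContinuousAlternatingMap.compContinuousLinearMapCLM (ContinuousLinearMap.inl ℝ B F) ∘L
    a.curryLeft ∘L ContinuousLinearMap.inr ℝ B F

/-- The form `p_a^μ dy^a ∧ d^kx_μ` with given components. -/
def formOfDual (q : F →L[ℝ] (B [⋀^Fin k]→L[ℝ] ℝ)) : (B × F) [⋀^Fin (k + 1)]→L[ℝ] ℝ :=
  ContinuousAlternatingMap.alternatizeUncurryFin
    (ContinuousAlternatingMap.compContinuousLinearMapCLM (ContinuousLinearMap.fst ℝ B F) ∘L
      q ∘L ContinuousLinearMap.snd ℝ B F)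

lemma dualModel_apply (a : (B × F) [⋀^Fin (k + 1)]→L[ℝ] ℝ) (f : F) (v : Fin k → B) :
    dualModel a f v = a (Matrix.vecCons (0, f) fun i => (v i, 0)) := rfl

lemma formOfDual_apply (q : F →L[ℝ] (B [⋀^Fin k]→L[ℝ] ℝ)) (u : Fin (k + 1) → B × F) :
    formOfDual q u = ∑ i : Fin (k + 1), (-1) ^ (i : ℕ) •
      q (u i).2 (fun l => (u (i.succAbove l)).1) :=
  ContinuousAlternatingMap.alternatizeUncurryFin_apply _ _

lemma formOfDual_of_vertical (q : F →L[ℝ] (B [⋀^Fin k]→L[ℝ] ℝ)) (u : Fin (k + 1) → B × F)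
    (i : Fin (k + 1)) (hi : (u i).1 = 0) :
    formOfDual q u = (-1) ^ (i : ℕ) • q (u i).2 (fun l => (u (i.succAbove l)).1) := by
  rw [formOfDual_apply, Finset.sum_eq_single i]
  · intro l _ hl
    obtain ⟨l', hl'⟩ := Fin.exists_succAbove_eq hl.symm
    rw [(q (u l).2).map_coord_zero l' (by simp [hl', hi]), smul_zero]
  · simp

lemma dualModel_formOfDual (q : F →L[ℝ] (B [⋀^Fin k]→L[ℝ] ℝ)) :
    dualModel (formOfDual q) = q := by
  ext f v
  rw [dualModel_apply, formOfDual_of_vertical _ _ 0 rfl]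
  simp

lemma formOfDual_two (q : F →L[ℝ] (B [⋀^Fin k]→L[ℝ] ℝ)) (u : Fin (k + 1) → B × F)
    {i l : Fin (k + 1)} (hil : i ≠ l) (hi : (u i).1 = 0) (hl : (u l).1 = 0) :
    formOfDual q u = 0 := by
  rw [formOfDual_of_vertical _ _ i hi]
  obtain ⟨l', hl'⟩ := Fin.exists_succAbove_eq hil.symm
  rw [(q (u i).2).map_coord_zero l' (by simp [hl', hl]), smul_zero]

lemma formOfDual_dualModel (a : (B × F) [⋀^Fin (k + 1)]→L[ℝ] ℝ)
    (ha : ∀ u : Fin (k + 1) → B × F, ∀ i l, i ≠ l → (u i).1 = 0 → (u l).1 = 0 → a u = 0)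
    (u : Fin (k + 1) → B × F) (i : Fin (k + 1)) (hi : (u i).1 = 0) :
    formOfDual (dualModel a) u = a u := by
  have h1 : a u = (-1) ^ (i : ℕ) • a (Matrix.vecCons (u i) (i.removeNth u)) := by
    rw [← ContinuousAlternatingMap.map_insertNth, Fin.insertNth_self_removeNth]
  rw [h1, formOfDual_of_vertical _ _ i hi, dualModel_apply]
  congr 1
  have h2 : ((0 : B), (u i).2) = u i := Prod.ext hi.symm rfl
  rw [h2]
  have h3 : i.removeNth u = (fun l => ((0 : B), (u (i.succAbove l)).2)) +
      (fun l => ((u (i.succAbove l)).1, (0 : F))) := by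
    funext l
    simp [Fin.removeNth]
  change _ = (a.curryLeft (u i)).toContinuousMultilinearMap (i.removeNth u)
  rw [h3, ContinuousMultilinearMap.map_add_univ, Finset.sum_eq_single ∅]
  · simp; rfl
  · intro s _ hs
    obtain ⟨l, hl⟩ := Finset.nonempty_iff_ne_empty.2 hs
    refine ha _ 0 l.succ (Fin.succ_ne_zero l).symm (by simpa using! hi) ?_
    simp [hl]
  · simp

end DualModel

section Bundles2

variable {B F M E : Type*} [NormedAddCommGroup B] [NormedSpace ℝ B]
  [NormedAddCommGroup F] [NormedSpace ℝ F]
  [TopologicalSpace M] [ChartedSpace B M]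
  [TopologicalSpace E] [ChartedSpace (B × F) E]

/-- `Λ^m_r T*_e E` with `m = k + 1`: the `m`-forms on `T_e E` that vanish when `r` of their
arguments are vertical. -/
def verticalForms (π : FibredManifold B F M E) (k r : ℕ) (e : E) :
    Submodule ℝ (FormAt (V := B × F) (k + 1) e) where
  carrier := {α | ∀ (u : Fin (k + 1) → TangentSpace 𝓘(ℝ, B × F) e) (s : Finset (Fin (k + 1))),
    s.card = r → (∀ i ∈ s, π.tproj e (u i) = 0) → α u = 0}
  add_mem' ha hb u s hs hu := by simp [ha u s hs hu, hb u s hs hu]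
  zero_mem' u s hs hu := rfl
  smul_mem' r a ha u s hs hu := by simp [ha u s hs hu]

/-- Two forms in `Λ^m_2 T*_e E` are equivalent if their difference lies in `Λ^m_1 T*_e E`. -/
def dualJetSetoid (π : FibredManifold B F M E) (k : ℕ) (e : E) : Setoid (verticalForms π k 2 e) where
  r α β := α.1 - β.1 ∈ verticalForms π k 1 e
  iseqv :=
    { refl := fun α => by rw [sub_self]; exact Submodule.zero_mem _
      symm := fun {α β} h => by
        rw [← neg_sub]
        intro u s hs hu
        exact neg_eq_zero.2 (h u s hs hu)
      trans := fun {α β γ} h h' => by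
        rw [← sub_add_sub_cancel α.1 β.1 γ.1]
        exact Submodule.add_mem _ h h' }

/-- The fibre at `e` of `J^{1*}π = Λ^m_2 T*E / Λ^m_1 T*E`, with `m = k + 1`. -/
def DualJet (π : FibredManifold B F M E) (k : ℕ) (e : E) : Type _ :=
  Quotient (dualJetSetoid π k e)

/-- The class in `J^{1*}π` of a form in `Λ^m_2 T*_e E`. -/
def DualJet.mk {π : FibredManifold B F M E} {k : ℕ} {e : E} (α : verticalForms π k 2 e) :
    DualJet π k e :=
  Quotient.mk (dualJetSetoid π k e) α

section FormCoord

variable {V N : Type*} [NormedAddCommGroup V] [NormedSpace ℝ V] [TopologicalSpace N]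
    [ChartedSpace V N] {k : ℕ}

/-- The expression of a form at `x` in a chart. -/
def formCoord (c : OpenPartialHomeomorph N V) (x : N) (α : FormAt (V := V) k x) :
    V [⋀^Fin k]→L[ℝ] ℝ :=
  α.compContinuousLinearMap (chartDInv c x)

/-- The form at `x` with given expression in a chart. -/
def formOfCoord (c : OpenPartialHomeomorph N V) (x : N) (a : V [⋀^Fin k]→L[ℝ] ℝ) :
    FormAt (V := V) k x :=
  a.compContinuousLinearMap (chartD c x)

lemma formOfCoord_formCoord {c : OpenPartialHomeomorph N V}
    (hc : c ∈ IsManifold.maximalAtlas 𝓘(ℝ, V) ∞ N) {x : N} (hx : x ∈ c.source)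
    (α : FormAt (V := V) k x) : formOfCoord c x (formCoord c x α) = α := by
  ext v
  change α (fun i => chartDInv c x (chartD c x (v i))) = α v
  simp only [chartDInv_chartD hc hx]

lemma formCoord_formOfCoord {c : OpenPartialHomeomorph N V}
    (hc : c ∈ IsManifold.maximalAtlas 𝓘(ℝ, V) ∞ N) {x : N} (hx : x ∈ c.source)
    (a : V [⋀^Fin k]→L[ℝ] ℝ) : formCoord c x (formOfCoord c x a) = a := by
  ext v
  change a (fun i => chartD c x (chartDInv c x (v i))) = a v
  simp only [chartD_chartDInv hc hx]

end FormCoord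

variable [IsManifold 𝓘(ℝ, B) ∞ M] [IsManifold 𝓘(ℝ, B × F) ∞ E]

namespace AdaptedChart

variable {π : FibredManifold B F M E} (c c' : AdaptedChart π) {k : ℕ}

lemma tproj_eq_zero_iff {e : E} (he : e ∈ c.tot.source) (u : TangentSpace 𝓘(ℝ, B × F) e) :
    π.tproj e u = 0 ↔ (chartD c.tot e u).1 = 0 := by
  rw [← c.chartD_tproj he]
  constructor
  · intro h; rw [h, map_zero]
  · intro h
    rw [← chartDInv_chartD c.bas_mem (c.mapsTo e he) (π.tproj e u), h, map_zero]

lemma verticalForms_two {e : E} (he : e ∈ c.tot.source) {α : FormAt (V := B × F) (k + 1) e}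
    (hα : α ∈ verticalForms π k 2 e) (u : Fin (k + 1) → B × F) (i l : Fin (k + 1)) (hil : i ≠ l)
    (hi : (u i).1 = 0) (hl : (u l).1 = 0) : formCoord c.tot e α u = 0 := by
  refine hα (fun i => chartDInv c.tot e (u i)) {i, l} (Finset.card_pair hil) ?_
  intro p hp
  rw [c.tproj_eq_zero_iff he, chartD_chartDInv c.tot_mem he]
  simp only [Finset.mem_insert, Finset.mem_singleton] at hp
  rcases hp with rfl | rfl <;> assumption

lemma formOfDual_mem {e : E} (he : e ∈ c.tot.source) (q : F →L[ℝ] (B [⋀^Fin k]→L[ℝ] ℝ)) :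
    formOfCoord c.tot e (formOfDual q) ∈ verticalForms π k 2 e := by
  intro u s hs hu
  obtain ⟨i, l, hil, rfl⟩ := Finset.card_eq_two.1 hs
  exact formOfDual_two q (fun i => chartD c.tot e (u i)) hil
    ((c.tproj_eq_zero_iff he _).1 (hu i (by simp))) ((c.tproj_eq_zero_iff he _).1 (hu l (by simp)))

open Classical in
/-- The coordinates `p_a^μ` of a dual jet (zero outside of the domain of the chart). -/
def dualCoord (e : E) (q : DualJet π k e) : F →L[ℝ] (B [⋀^Fin k]→L[ℝ] ℝ) :=
  if he : e ∈ c.tot.source then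
    Quotient.lift (fun α : verticalForms π k 2 e => dualModel (formCoord c.tot e α.1)) (by
      intro α β h
      ext f v
      refine sub_eq_zero.1 (h _ {0} rfl ?_)
      intro p hp
      rw [Finset.mem_singleton.1 hp, c.tproj_eq_zero_iff he]
      exact congrArg Prod.fst (chartD_chartDInv c.tot_mem he _)) q
  else 0

open Classical in
/-- The dual jet with given coordinates `p_a^μ` (the class of `0` outside of the domain of the
chart). -/
def dualInv (e : E) (q : F →L[ℝ] (B [⋀^Fin k]→L[ℝ] ℝ)) : DualJet π k e :=
  if he : e ∈ c.tot.source then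
    DualJet.mk ⟨formOfCoord c.tot e (formOfDual q), c.formOfDual_mem he q⟩
  else DualJet.mk 0

lemma dualCoord_mk {e : E} (he : e ∈ c.tot.source) (α : verticalForms π k 2 e) :
    c.dualCoord e (DualJet.mk α) = dualModel (formCoord c.tot e α.1) := by
  rw [dualCoord, dif_pos he]
  rfl

lemma dualInv_eq {e : E} (he : e ∈ c.tot.source) (q : F →L[ℝ] (B [⋀^Fin k]→L[ℝ] ℝ)) :
    (c.dualInv e q : DualJet π k e) =
      DualJet.mk ⟨formOfCoord c.tot e (formOfDual q), c.formOfDual_mem he q⟩ := by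
  rw [dualInv, dif_pos he]

lemma dualCoord_dualInv {e : E} (he : e ∈ c.tot.source) (q : F →L[ℝ] (B [⋀^Fin k]→L[ℝ] ℝ)) :
    c.dualCoord e (c.dualInv e q) = q := by
  rw [dualInv_eq _ he, dualCoord_mk _ he, formCoord_formOfCoord c.tot_mem he, dualModel_formOfDual]

lemma dualInv_dualCoord {e : E} (he : e ∈ c.tot.source) (q : DualJet π k e) :
    c.dualInv e (c.dualCoord e q) = q := by
  obtain ⟨α, rfl⟩ : ∃ α, DualJet.mk α = q := Quotient.exists_rep q
  rw [dualCoord_mk _ he, dualInv_eq _ he]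
  refine Quotient.sound ?_
  intro u s hs hu
  obtain ⟨i, rfl⟩ := Finset.card_eq_one.1 hs
  have h1 := (c.tproj_eq_zero_iff he _).1 (hu i (by simp))
  have h2 := formOfDual_dualModel (formCoord c.tot e α.1) (c.verticalForms_two he α.2)
    (fun i => chartD c.tot e (u i)) i h1
  have h3 : formCoord c.tot e α.1 (fun i => chartD c.tot e (u i)) = α.1 u :=
    congrArg (fun β : FormAt (V := B × F) (k + 1) e => β u) (formOfCoord_formCoord c.tot_mem he α.1)
  change formOfDual (dualModel (formCoord c.tot e α.1)) (fun i => chartD c.tot e (u i)) - α.1 u = 0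
  rw [h2, h3, sub_self]

/-- The derivative of the transition function from `c'` to `c`, at the point with coordinates
`z` in the chart `c`. -/
def totTransInv (z : B × F) : (B × F) →L[ℝ] (B × F) :=
  fderiv ℝ (c.tot ∘ c'.tot.symm) ((c'.tot ∘ c.tot.symm) z)

lemma contDiffOn_totTransInv :
    ContDiffOn ℝ ∞ (c.totTransInv c') (c.tot.symm.trans c'.tot).source := by
  refine (contDiffOn_fderiv_chart_trans c'.tot_mem c.tot_mem).comp
    (contDiffOn_chart_trans c.tot_mem c'.tot_mem) ?_
  intro z hz
  have h1 : c.tot.symm z ∈ c.tot.source := c.tot.map_target hz.1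
  have h2 : c.tot.symm z ∈ c'.tot.source := hz.2
  refine ⟨c'.tot.map_source h2, ?_⟩
  change c'.tot.symm (c'.tot (c.tot.symm z)) ∈ c.tot.source
  rwa [c'.tot.left_inv h2]

lemma totTransInv_eq {z : B × F} (hz : z ∈ (c.tot.symm.trans c'.tot).source) (u : B × F) :
    chartD c.tot (c.tot.symm z) (chartDInv c'.tot (c.tot.symm z) u) = c.totTransInv c' z u := by
  have h1 : c.tot.symm z ∈ c.tot.source := c.tot.map_target hz.1
  have h2 : c.tot.symm z ∈ c'.tot.source := hz.2
  rw [chartD_chartDInv_trans c'.tot_mem c.tot_mem h2 h1]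
  rfl

lemma contDiffOn_dualCoord : ContDiffOn ℝ ∞
    (fun w : (B × F) × (F →L[ℝ] (B [⋀^Fin k]→L[ℝ] ℝ)) =>
      c'.dualCoord (c.tot.symm w.1) (c.dualInv (c.tot.symm w.1) w.2))
    ((c.tot.symm.trans c'.tot).source ×ˢ univ) := by
  have h0 := (c.contDiffOn_totTransInv c').comp (contDiffOn_fst
    (s := (c.tot.symm.trans c'.tot).source ×ˢ
      (univ : Set (F →L[ℝ] (B [⋀^Fin k]→L[ℝ] ℝ))))) (fun w hw => hw.1)
  have h : ContDiffOn ℝ ∞ (fun w : (B × F) × (F →L[ℝ] (B [⋀^Fin k]→L[ℝ] ℝ)) =>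
      ContinuousAlternatingMap.compContinuousLinearMapCLM
        (ContinuousLinearMap.fst ℝ B F ∘L c.totTransInv c' w.1 ∘L ContinuousLinearMap.inl ℝ B F)
        ∘L w.2 ∘L (ContinuousLinearMap.snd ℝ B F ∘L c.totTransInv c' w.1 ∘L
          ContinuousLinearMap.inr ℝ B F)) ((c.tot.symm.trans c'.tot).source ×ˢ univ) := by
    refine ContDiffOn.clm_comp ?_ (contDiffOn_snd.clm_comp
      (contDiffOn_const.clm_comp (h0.clm_comp contDiffOn_const)))
    exact (contDiff_pullbackCLM k).comp_contDiffOn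
      (contDiffOn_const.clm_comp (h0.clm_comp contDiffOn_const))
  refine h.congr ?_
  rintro ⟨z, q⟩ ⟨hz, -⟩
  have h1 : c.tot.symm z ∈ c.tot.source := c.tot.map_target hz.1
  have h2 : c.tot.symm z ∈ c'.tot.source := hz.2
  simp only
  rw [dualInv_eq _ h1, dualCoord_mk _ h2]
  ext f v
  rw [dualModel_apply]
  change formOfDual q (fun i => chartD c.tot _ (chartDInv c'.tot _ (Matrix.vecCons _ _ i))) = _
  simp only [totTransInv_eq _ _ hz]
  rw [formOfDual_of_vertical _ _ 0]
  · simp; rfl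
  · rw [← totTransInv_eq _ _ hz, ← c.tproj_eq_zero_iff h1, c'.tproj_eq_zero_iff h2,
      chartD_chartDInv c'.tot_mem h2]
    rfl

lemma contDiffOn_formCoord : ContDiffOn ℝ ∞
    (fun w : (B × F) × (B [⋀^Fin k]→L[ℝ] ℝ) =>
      formCoord c'.bas (π.proj (c.tot.symm w.1)) (formOfCoord c.bas (π.proj (c.tot.symm w.1)) w.2))
    ((c.tot.symm.trans c'.tot).source ×ˢ univ) := by
  have h0 := (c.contDiffOn_baseTrans c').comp (contDiffOn_fst
    (s := (c.tot.symm.trans c'.tot).source ×ˢ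
      (univ : Set (B [⋀^Fin k]→L[ℝ] ℝ)))) (fun w hw => hw.1)
  refine (((contDiff_pullbackCLM k).comp_contDiffOn h0).clm_apply contDiffOn_snd).congr ?_
  rintro ⟨z, a⟩ ⟨hz, -⟩
  ext v
  change a (fun i => chartD c.bas _ (chartDInv c'.bas _ (v i))) = a (fun i => c.baseTrans c' z (v i))
  simp only [c.baseTrans_eq c' hz]

end AdaptedChart

lemma contDiffOn_formCoord_chart {V N : Type*} [NormedAddCommGroup V] [NormedSpace ℝ V]
    [TopologicalSpace N] [ChartedSpace V N] {k : ℕ} {c c' : OpenPartialHomeomorph N V}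
    (hc : c ∈ IsManifold.maximalAtlas 𝓘(ℝ, V) ∞ N)
    (hc' : c' ∈ IsManifold.maximalAtlas 𝓘(ℝ, V) ∞ N) :
    ContDiffOn ℝ ∞ (fun w : V × (V [⋀^Fin k]→L[ℝ] ℝ) =>
      formCoord c' (c.symm w.1) (formOfCoord c (c.symm w.1) w.2))
    ((c.symm.trans c').source ×ˢ univ) := by
  have h0 : ContDiffOn ℝ ∞ (fun z => fderiv ℝ (c ∘ c'.symm) ((c' ∘ c.symm) z))
      (c.symm.trans c').source := by
    refine (contDiffOn_fderiv_chart_trans hc' hc).comp (contDiffOn_chart_trans hc hc') ?_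
    intro z hz
    have h2 : c.symm z ∈ c'.source := hz.2
    refine ⟨c'.map_source h2, ?_⟩
    change c'.symm (c' (c.symm z)) ∈ c.source
    rw [c'.left_inv h2]
    exact c.map_target hz.1
  have h1 := h0.comp (contDiffOn_fst (s := (c.symm.trans c').source ×ˢ
      (univ : Set (V [⋀^Fin k]→L[ℝ] ℝ)))) (fun w hw => hw.1)
  refine (((contDiff_pullbackCLM k).comp_contDiffOn h1).clm_apply contDiffOn_snd).congr ?_
  rintro ⟨z, a⟩ ⟨hz, -⟩
  have h2 : c.symm z ∈ c'.source := hz.2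
  ext v
  change a (fun i => chartD c _ (chartDInv c' _ (v i))) = _
  simp only [chartD_chartDInv_trans hc' hc h2 (c.map_target hz.1)]
  rfl

end Bundles2

/-! ### The bundles `Λ^k T*M`, `E ×_M Λ^k T*M`, `J¹π ×_M Λ^k T*M` and `J^{1*}π ×_M Λ^k T*M` -/

section Spaces

variable {B F M E : Type*} [NormedAddCommGroup B] [NormedSpace ℝ B]
  [NormedAddCommGroup F] [NormedSpace ℝ F]
  [TopologicalSpace M] [ChartedSpace B M]
  [TopologicalSpace E] [ChartedSpace (B × F) E]

/-- The bundle `Λ^k T*M`; its fibre coordinates are the components `s^μ` of a form. -/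
def FormBundle (B M : Type*) [NormedAddCommGroup B] [NormedSpace ℝ B] [TopologicalSpace M]
    [ChartedSpace B M] (k : ℕ) : Type _ :=
  Tot fun x : M => FormAt (V := B) k x

/-- The bundle `𝓔 = E ×_M Λ^k T*M`. -/
def ConfSpace (π : FibredManifold B F M E) (k : ℕ) : Type _ :=
  Tot fun e : E => FormAt (V := B) k (π.proj e)

/-- The bundle `𝓟 = J¹π ×_M Λ^k T*M`. -/
def JetSpace (π : FibredManifold B F M E) (k : ℕ) : Type _ :=
  Tot fun e : E => Jet π e × FormAt (V := B) k (π.proj e)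

/-- The bundle `𝓟* = J^{1*}π ×_M Λ^k T*M`. -/
def DualJetSpace (π : FibredManifold B F M E) (k : ℕ) : Type _ :=
  Tot fun e : E => DualJet π k e × FormAt (V := B) k (π.proj e)

/-- The model space of `Λ^k T*M`: coordinates `(x^μ, s^μ)`. -/
abbrev FormModel (B : Type*) [NormedAddCommGroup B] [NormedSpace ℝ B] (k : ℕ) : Type _ :=
  B × (B [⋀^Fin k]→L[ℝ] ℝ)

/-- The model space of `𝓔`: coordinates `((x^μ, y^a), s^μ)`. -/
abbrev ConfModel (B F : Type*) [NormedAddCommGroup B] [NormedSpace ℝ B] [NormedAddCommGroup F]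
    [NormedSpace ℝ F] (k : ℕ) : Type _ :=
  (B × F) × (B [⋀^Fin k]→L[ℝ] ℝ)

/-- The model space of `𝓟`: coordinates `((x^μ, y^a), (y^a_μ, s^μ))`. -/
abbrev JetModel (B F : Type*) [NormedAddCommGroup B] [NormedSpace ℝ B] [NormedAddCommGroup F]
    [NormedSpace ℝ F] (k : ℕ) : Type _ :=
  (B × F) × ((B →L[ℝ] F) × (B [⋀^Fin k]→L[ℝ] ℝ))

/-- The model space of `𝓟*`: coordinates `((x^μ, y^a), (p_a^μ, s^μ))`. -/
abbrev DualJetModel (B F : Type*) [NormedAddCommGroup B] [NormedSpace ℝ B] [NormedAddCommGroup F]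
    [NormedSpace ℝ F] (k : ℕ) : Type _ :=
  (B × F) × ((F →L[ℝ] (B [⋀^Fin k]→L[ℝ] ℝ)) × (B [⋀^Fin k]→L[ℝ] ℝ))

variable [IsManifold 𝓘(ℝ, B) ∞ M] [IsManifold 𝓘(ℝ, B × F) ∞ E]

/-- The fibre coordinates of `Λ^k T*M`. -/
def formAtlas (B M : Type*) [NormedAddCommGroup B] [NormedSpace ℝ B] [TopologicalSpace M]
    [ChartedSpace B M] [IsManifold 𝓘(ℝ, B) ∞ M] (k : ℕ) :
    FibreAtlas B {c // c ∈ IsManifold.maximalAtlas 𝓘(ℝ, B) ∞ M}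
      (fun x : M => FormAt (V := B) k x) (B [⋀^Fin k]→L[ℝ] ℝ) where
  chart c := c.1
  chart_mem c := c.2
  coord c x α := formCoord c.1 x α
  inv c x a := formOfCoord c.1 x a
  inv_coord c _ hx α := formOfCoord_formCoord c.2 hx α
  coord_inv c _ hx a := formCoord_formOfCoord c.2 hx a
  contDiffOn_coord c c' := contDiffOn_formCoord_chart c.2 c'.2
  indexAt x := ⟨chartAt B x, IsManifold.chart_mem_maximalAtlas x⟩
  mem_indexAt x := mem_chart_source B x

/-- The fibre coordinates of `𝓔`. -/
def confAtlas (π : FibredManifold B F M E) (k : ℕ) :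
    FibreAtlas (B × F) (AdaptedChart π) (fun e : E => FormAt (V := B) k (π.proj e))
      (B [⋀^Fin k]→L[ℝ] ℝ) where
  chart c := c.tot
  chart_mem c := c.tot_mem
  coord c e α := formCoord c.bas (π.proj e) α
  inv c e a := formOfCoord c.bas (π.proj e) a
  inv_coord c e he α := formOfCoord_formCoord c.bas_mem (c.mapsTo e he) α
  coord_inv c e he a := formCoord_formOfCoord c.bas_mem (c.mapsTo e he) a
  contDiffOn_coord c c' := c.contDiffOn_formCoord c'
  indexAt e := π.adaptedChartAt e
  mem_indexAt e := π.mem_adaptedChartAt e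

/-- The fibre coordinates of `𝓟`. -/
def jetAtlas (π : FibredManifold B F M E) (k : ℕ) :
    FibreAtlas (B × F) (AdaptedChart π) (fun e : E => Jet π e × FormAt (V := B) k (π.proj e))
      ((B →L[ℝ] F) × (B [⋀^Fin k]→L[ℝ] ℝ)) where
  chart c := c.tot
  chart_mem c := c.tot_mem
  coord c e q := (c.jetCoord e q.1, formCoord c.bas (π.proj e) q.2)
  inv c e a := (c.jetInv e a.1, formOfCoord c.bas (π.proj e) a.2)
  inv_coord c e he q := Prod.ext (c.jetInv_jetCoord he q.1)
    (formOfCoord_formCoord c.bas_mem (c.mapsTo e he) q.2)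
  coord_inv c e he a := Prod.ext (c.jetCoord_jetInv he a.1)
    (formCoord_formOfCoord c.bas_mem (c.mapsTo e he) a.2)
  contDiffOn_coord c c' := ContDiffOn.prodMk
    ((c.contDiffOn_jetCoord c').comp
      (contDiff_fst.prodMk contDiff_snd.fst).contDiffOn (fun _ hw => ⟨hw.1, mem_univ _⟩))
    ((c.contDiffOn_formCoord c').comp
      (contDiff_fst.prodMk contDiff_snd.snd).contDiffOn (fun _ hw => ⟨hw.1, mem_univ _⟩))
  indexAt e := π.adaptedChartAt e
  mem_indexAt e := π.mem_adaptedChartAt e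

/-- The fibre coordinates of `𝓟*`. -/
def dualJetAtlas (π : FibredManifold B F M E) (k : ℕ) :
    FibreAtlas (B × F) (AdaptedChart π) (fun e : E => DualJet π k e × FormAt (V := B) k (π.proj e))
      ((F →L[ℝ] (B [⋀^Fin k]→L[ℝ] ℝ)) × (B [⋀^Fin k]→L[ℝ] ℝ)) where
  chart c := c.tot
  chart_mem c := c.tot_mem
  coord c e q := (c.dualCoord e q.1, formCoord c.bas (π.proj e) q.2)
  inv c e a := (c.dualInv e a.1, formOfCoord c.bas (π.proj e) a.2)
  inv_coord c e he q := Prod.ext (c.dualInv_dualCoord he q.1)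
    (formOfCoord_formCoord c.bas_mem (c.mapsTo e he) q.2)
  coord_inv c e he a := Prod.ext (c.dualCoord_dualInv he a.1)
    (formCoord_formOfCoord c.bas_mem (c.mapsTo e he) a.2)
  contDiffOn_coord c c' := ContDiffOn.prodMk
    ((c.contDiffOn_dualCoord c').comp
      (contDiff_fst.prodMk contDiff_snd.fst).contDiffOn (fun _ hw => ⟨hw.1, mem_univ _⟩))
    ((c.contDiffOn_formCoord c').comp
      (contDiff_fst.prodMk contDiff_snd.snd).contDiffOn (fun _ hw => ⟨hw.1, mem_univ _⟩))
  indexAt e := π.adaptedChartAt e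
  mem_indexAt e := π.mem_adaptedChartAt e

variable (π : FibredManifold B F M E) (k : ℕ)

instance : TopologicalSpace (FormBundle B M k) := (formAtlas B M k).core.toTopologicalSpace

instance : ChartedSpace (FormModel B k) (FormBundle B M k) := (formAtlas B M k).core.toChartedSpace

instance : IsManifold 𝓘(ℝ, FormModel B k) ∞ (FormBundle B M k) := (formAtlas B M k).isManifold_core

instance : TopologicalSpace (ConfSpace π k) := (confAtlas π k).core.toTopologicalSpace

instance : ChartedSpace (ConfModel B F k) (ConfSpace π k) := (confAtlas π k).core.toChartedSpace

instance : IsManifold 𝓘(ℝ, ConfModel B F k) ∞ (ConfSpace π k) := (confAtlas π k).isManifold_core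

instance : TopologicalSpace (JetSpace π k) := (jetAtlas π k).core.toTopologicalSpace

instance : ChartedSpace (JetModel B F k) (JetSpace π k) := (jetAtlas π k).core.toChartedSpace

instance : IsManifold 𝓘(ℝ, JetModel B F k) ∞ (JetSpace π k) := (jetAtlas π k).isManifold_core

instance : TopologicalSpace (DualJetSpace π k) := (dualJetAtlas π k).core.toTopologicalSpace

instance : ChartedSpace (DualJetModel B F k) (DualJetSpace π k) :=
  (dualJetAtlas π k).core.toChartedSpace

instance : IsManifold 𝓘(ℝ, DualJetModel B F k) ∞ (DualJetSpace π k) :=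
  (dualJetAtlas π k).isManifold_core

end Spaces

section Projections

variable {B F M E : Type*} [NormedAddCommGroup B] [NormedSpace ℝ B]
  [NormedAddCommGroup F] [NormedSpace ℝ F]
  [TopologicalSpace M] [ChartedSpace B M]
  [TopologicalSpace E] [ChartedSpace (B × F) E]
  {π : FibredManifold B F M E} {k : ℕ}

/-- The projection `ρ₁ : 𝓔 → E`. -/
def ConfSpace.toE (q : ConfSpace π k) : E := q.base

/-- The projection `ρ∘ : 𝓔 → M`. -/
def ConfSpace.toM (q : ConfSpace π k) : M := π.proj q.base

/-- The projection `ρ₂ : 𝓔 → Λ^k T*M`. -/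
def ConfSpace.toForm (q : ConfSpace π k) : FormBundle B M k := ⟨π.proj q.base, q.fib⟩

/-- The projection `𝓟 → E`. -/
def JetSpace.toE (p : JetSpace π k) : E := p.base

/-- The projection `τ : 𝓟 → M`. -/
def JetSpace.toM (p : JetSpace π k) : M := π.proj p.base

/-- The jet component of a point of `𝓟`, as a linear map `T_x M → T_e E`. -/
def JetSpace.jet (p : JetSpace π k) :
    TangentSpace 𝓘(ℝ, B) (π.proj p.toE) →L[ℝ] TangentSpace 𝓘(ℝ, B × F) p.toE := p.fib.1.toHom

/-- The form component `s` of a point of `𝓟`. -/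
def JetSpace.form (p : JetSpace π k) : FormAt (V := B) k (π.proj p.toE) := p.fib.2

/-- The projection `ρ : 𝓟 → 𝓔`. -/
def JetSpace.toConf (p : JetSpace π k) : ConfSpace π k := ⟨p.base, p.fib.2⟩

/-- The projection `τ₂ : 𝓟 → Λ^k T*M`. -/
def JetSpace.toForm (p : JetSpace π k) : FormBundle B M k := ⟨π.proj p.base, p.fib.2⟩

/-- The projection `𝓟* → E`. -/
def DualJetSpace.toE (p : DualJetSpace π k) : E := p.base

/-- The projection `𝓟* → M`. -/
def DualJetSpace.toM (p : DualJetSpace π k) : M := π.proj p.base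

/-- The dual jet component of a point of `𝓟*`. -/
def DualJetSpace.dualJet (p : DualJetSpace π k) : DualJet π k p.toE := p.fib.1

/-- The form component `s` of a point of `𝓟*`. -/
def DualJetSpace.form (p : DualJetSpace π k) : FormAt (V := B) k (π.proj p.toE) := p.fib.2

end Projections

/-! ### Differential forms on a manifold -/

section Forms

variable {V N W N' : Type*} [NormedAddCommGroup V] [NormedSpace ℝ V] [TopologicalSpace N]
  [ChartedSpace V N] [NormedAddCommGroup W] [NormedSpace ℝ W] [TopologicalSpace N']
  [ChartedSpace W N'] {k : ℕ}

/-- Fields of alternating `k`-forms on a manifold `N` modelled on `V`. -/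
abbrev Form (V N : Type*) [NormedAddCommGroup V] [NormedSpace ℝ V] [TopologicalSpace N]
    [ChartedSpace V N] (k : ℕ) : Type _ :=
  ∀ x : N, FormAt (V := V) k x

/-- The expression of a form in a chart. -/
def formRep (Ω : Form V N k) (c : OpenPartialHomeomorph N V) (z : V) : V [⋀^Fin k]→L[ℝ] ℝ :=
  formCoord c (c.symm z) (Ω (c.symm z))

/-- Smooth differential forms: those with smooth expressions in the charts. -/
def SmoothForm (Ω : Form V N k) : Prop :=
  ∀ x : N, ContDiffOn ℝ ∞ (formRep Ω (chartAt V x)) (chartAt V x).target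

/-- The exterior derivative, computed in a chart around each point. -/
def extD (Ω : Form V N k) : Form V N (k + 1) := fun x =>
  formOfCoord (chartAt V x) x (extDeriv (formRep Ω (chartAt V x)) (chartAt V x x))

/-- The pull-back of a form by a map. -/
def pullback (f : N' → N) (Ω : Form V N k) : Form W N' k := fun x =>
  (Ω (f x)).compContinuousLinearMap (mfderiv 𝓘(ℝ, W) 𝓘(ℝ, V) f x)

/-- The contraction `ι_v α` (insertion of `v` as the first argument). -/
def contract {x : N} (v : TangentSpace 𝓘(ℝ, V) x) (α : FormAt (V := V) (k + 1) x) :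
    FormAt (V := V) k x :=
  ContinuousAlternatingMap.curryLeft (𝕜 := ℝ) (E := V) (F := ℝ) α v

/-- The wedge product `σ ∧ β` with a one-form `σ`, that is,
`(v₀, …, v_k) ↦ ∑ᵢ (-1)ⁱ σ(vᵢ) β(v₀, …, v̂ᵢ, …, v_k)`. -/
def wedgeOne {x : N} (σ : FormAt (V := V) 1 x) (β : FormAt (V := V) k x) :
    FormAt (V := V) (k + 1) x :=
  ContinuousAlternatingMap.alternatizeUncurryFin (𝕜 := ℝ) (E := V) (F := ℝ)
    (((ContinuousAlternatingMap.ofSubsingleton ℝ V ℝ (0 : Fin 1)).symm σ).smulRight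
      (show V [⋀^Fin k]→L[ℝ] ℝ from β))

/-- The fibre at `p` of the Reeb distribution of `(Θ, Ω)`: the vectors `v ∈ ker Ω` for which
`ι_v dΘ` is annihilated by `ker Ω`. -/
def reebAt (Θ Ω : Form V N (k + 1)) (p : N) : Set (TangentSpace 𝓘(ℝ, V) p) :=
  {v | contract v (Ω p) = 0 ∧
    ∀ z : TangentSpace 𝓘(ℝ, V) p, contract z (Ω p) = 0 → contract z (contract v (extD Θ p)) = 0}

/-- The condition `σ ∧ ι_R Θ = ι_R dΘ` for all `R` in the Reeb distribution, for a smooth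
one-form `σ`. Both sides are tensorial in `R`. -/
def IsDissipationForm (Θ Ω : Form V N (k + 1)) (σ : Form V N 1) : Prop :=
  SmoothForm σ ∧
    ∀ p : N, ∀ R ∈ reebAt Θ Ω p, wedgeOne (σ p) (contract R (Θ p)) = contract R (extD Θ p)

open Classical in
/-- The dissipation form of `(Θ, Ω)`, the unique one-form `σ` with `σ ∧ ι_R Θ = ι_R dΘ` for all
`R` in the Reeb distribution (and `0` if there is no such form or more than one; this does not
happen for multicontact structures). -/
def dissipationForm (Θ Ω : Form V N (k + 1)) : Form V N 1 :=
  if h : ∃! σ : Form V N 1, IsDissipationForm Θ Ω σ then h.choose else 0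

/-- The form `d̄Θ = dΘ + σ_Θ ∧ Θ`. -/
def dBar (Θ Ω : Form V N (k + 1)) : Form V N (k + 2) := fun p =>
  extD Θ p + wedgeOne (dissipationForm Θ Ω p) (Θ p)

/-- `ψ` is, on the open set `U`, a smooth section of `τ : N → M` that satisfies the field equations
`ψ^*Θ = 0` and `ψ^*(ι_X d̄Θ) = 0` for all `X`. -/
structure IsSolution (τ : N → N') (Θ Ω : Form V N (k + 1)) (U : Set N') (ψ : N' → N) : Prop where
  isOpen : IsOpen U
  contMDiffOn : ContMDiffOn 𝓘(ℝ, W) 𝓘(ℝ, V) ∞ ψ U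
  isSection : ∀ x ∈ U, τ (ψ x) = x
  pullback_eq : ∀ x ∈ U, (pullback ψ Θ : Form W N' (k + 1)) x = 0
  pullback_contract_eq : ∀ x ∈ U, ∀ X : TangentSpace 𝓘(ℝ, V) (ψ x),
    (contract X (dBar Θ Ω (ψ x))).compContinuousLinearMap (mfderiv 𝓘(ℝ, W) 𝓘(ℝ, V) ψ x) = 0

/-! ### Vector fields, flows and strong Noether symmetries -/

variable [IsManifold 𝓘(ℝ, V) ∞ N]

/-- Smooth vector fields. -/
def SmoothField (Y : ∀ p : N, TangentSpace 𝓘(ℝ, V) p) : Prop :=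
  ContMDiff 𝓘(ℝ, V) 𝓘(ℝ, V).tangent ∞ fun p => (⟨p, Y p⟩ : TangentBundle 𝓘(ℝ, V) N)

/-- `Y` projects onto `Z` by the map `f`. -/
def ProjectsOnto (f : N → N') (Y : ∀ p : N, TangentSpace 𝓘(ℝ, V) p)
    (Z : ∀ x : N', TangentSpace 𝓘(ℝ, W) x) : Prop :=
  ∀ p : N, mfderiv 𝓘(ℝ, V) 𝓘(ℝ, W) f p (Y p) = Z (f p)

/-- A local flow of a vector field `Y`: local diffeomorphisms `F_t`, for `t` in an open interval
around `0`, from an open set `dom` onto open sets, with `t ↦ F_t(p)` the integral curve of `Y`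
through `p`. -/
structure LocalFlow (Y : ∀ p : N, TangentSpace 𝓘(ℝ, V) p) where
  /-- the time interval -/
  time : Set ℝ
  /-- the domain of the local diffeomorphisms -/
  dom : Set N
  /-- the local diffeomorphisms -/
  toFun : ℝ → N → N
  /-- their inverses -/
  invFun : ℝ → N → N
  isOpen_time : IsOpen time
  ordConnected_time : time.OrdConnected
  zero_mem : 0 ∈ time
  isOpen_dom : IsOpen dom
  map_zero : ∀ p ∈ dom, toFun 0 p = p
  isIntegralCurve : ∀ p ∈ dom, IsMIntegralCurveOn (I := 𝓘(ℝ, V)) (fun t => toFun t p) Y time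
  contMDiffOn : ContMDiffOn (𝓘(ℝ, ℝ).prod 𝓘(ℝ, V)) 𝓘(ℝ, V) ∞
    (fun tp : ℝ × N => toFun tp.1 tp.2) (time ×ˢ dom)
  isOpen_image : ∀ t ∈ time, IsOpen (toFun t '' dom)
  left_inv : ∀ t ∈ time, ∀ p ∈ dom, invFun t (toFun t p) = p
  contMDiffOn_inv : ∀ t ∈ time, ContMDiffOn 𝓘(ℝ, V) 𝓘(ℝ, V) ∞ (invFun t) (toFun t '' dom)

/-- `Φ` preserves the pair `(Θ, Ω)` on the set `D`. -/
def PreservesOn (Θ Ω : Form V N (k + 1)) (D : Set N) (Φ : N → N) : Prop :=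
  ∀ p ∈ D, (pullback Φ Θ : Form V N (k + 1)) p = Θ p ∧ (pullback Φ Ω : Form V N (k + 1)) p = Ω p

/-- A diffeomorphism `Φ` is a strong Noether symmetry if `Φ^*Θ = Θ` and `Φ^*Ω = Ω`. -/
def IsStrongNoether (Θ Ω : Form V N (k + 1)) (Φ : Diffeomorph 𝓘(ℝ, V) 𝓘(ℝ, V) N N ∞) : Prop :=
  PreservesOn Θ Ω univ Φ

/-- A smooth vector field `Y` is an infinitesimal strong Noether symmetry if the local
diffeomorphisms generated by its flow preserve `Θ` and `Ω`. -/
def IsInfStrongNoether (Θ Ω : Form V N (k + 1)) (Y : ∀ p : N, TangentSpace 𝓘(ℝ, V) p) : Prop :=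
  SmoothField Y ∧ ∀ Fl : LocalFlow Y, ∀ t ∈ Fl.time, PreservesOn Θ Ω Fl.dom (Fl.toFun t)

end Forms

/-! ### Multicontact Lagrangian and Hamiltonian systems -/

section Systems

variable {B F M E : Type*} [NormedAddCommGroup B] [NormedSpace ℝ B] [FiniteDimensional ℝ B]
  [NormedAddCommGroup F] [NormedSpace ℝ F] [FiniteDimensional ℝ F]
  [TopologicalSpace M] [ChartedSpace B M] [IsManifold 𝓘(ℝ, B) ∞ M]
  [TopologicalSpace E] [ChartedSpace (B × F) E] [IsManifold 𝓘(ℝ, B × F) ∞ E]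
  {π : FibredManifold B F M E} {k : ℕ}

/-- The form `Ω = τ^*η` on `𝓟`, where `η` is the volume form of `M`. -/
def jetOmega (π : FibredManifold B F M E) (η : Form B M (k + 1)) :
    Form (JetModel B F k) (JetSpace π k) (k + 1) :=
  pullback JetSpace.toM η

/-- The form `Ω = τ^*η` on `𝓟*`, where `η` is the volume form of `M`. -/
def dualJetOmega (π : FibredManifold B F M E) (η : Form B M (k + 1)) :
    Form (DualJetModel B F k) (DualJetSpace π k) (k + 1) :=
  pullback DualJetSpace.toM η

/-- The pull-back `τ₂^*θ` to `𝓟` of the tautological form `θ = s^μ d^{m-1}x_μ` of `Λ^{m-1} T*M`. -/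
def jetTheta (π : FibredManifold B F M E) (k : ℕ) : Form (JetModel B F k) (JetSpace π k) k :=
  fun p => p.form.compContinuousLinearMap
    (π.tproj p.toE ∘L mfderiv 𝓘(ℝ, JetModel B F k) 𝓘(ℝ, B × F) JetSpace.toE p)

/-- The pull-back to `𝓟*` of the tautological form `θ = s^μ d^{m-1}x_μ` of `Λ^{m-1} T*M`. -/
def dualJetTheta (π : FibredManifold B F M E) (k : ℕ) :
    Form (DualJetModel B F k) (DualJetSpace π k) k :=
  fun p => p.form.compContinuousLinearMap
    (π.tproj p.toE ∘L mfderiv 𝓘(ℝ, DualJetModel B F k) 𝓘(ℝ, B × F) DualJetSpace.toE p)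

/-- The jet `j + v_j ∘ A`, where `v_j = id - j ∘ Tπ` is the projection onto the vertical vectors
along `j`. For `A` with vertical values this is `j + A`. -/
def Jet.shift {e : E} (j : Jet π e)
    (A : TangentSpace 𝓘(ℝ, B) (π.proj e) →L[ℝ] TangentSpace 𝓘(ℝ, B × F) e) : Jet π e where
  toHom := j.toHom +
    (ContinuousLinearMap.id ℝ (TangentSpace 𝓘(ℝ, B × F) e) - j.toHom ∘L π.tproj e) ∘L A
  tproj_toHom v := by
    change π.tproj e (j.toHom v + (A v - j.toHom (π.tproj e (A v)))) = v
    rw [map_add, map_sub, j.tproj_toHom, j.tproj_toHom, sub_self, add_zero]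

/-- The Lagrangian along the fibres of `J¹π`, as a function of the vertical displacement of the
jet. -/
def fibreLagrangian (L : JetSpace π k → ℝ) (p : JetSpace π k) (A : B →L[ℝ] B × F) : ℝ :=
  L ⟨p.base, (p.fib.1.shift A, p.fib.2)⟩

/-- The fibre derivative of the Lagrangian, with components `∂L/∂y^a_μ`:
`A ↦ (∂L/∂y^a_μ) (A - j ∘ Tπ ∘ A)^a_μ`. -/
def fibreDeriv (L : JetSpace π k → ℝ) (p : JetSpace π k) : (B →L[ℝ] B × F) →L[ℝ] ℝ :=
  fderiv ℝ (fibreLagrangian L p) 0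

/-- Regular Lagrangians: the Hessian `∂²L/∂y^a_μ∂y^b_ν` is nondegenerate at every point. -/
def IsRegularLagrangian (L : JetSpace π k → ℝ) : Prop :=
  ∀ (p : JetSpace π k) (A : B →L[ℝ] B × F), (∀ v, π.tproj p.toE (A v) = 0) →
    fderiv ℝ (fderiv ℝ (fibreLagrangian L p)) 0 A = 0 → A = 0

/-- The linear map `w ↦ ((u₁, …, u_k) ↦ D(v ↦ η(v, u₁, …, u_k) w))`, where `D` is the fibre
derivative. -/
def momentumMap (η : B [⋀^Fin (k + 1)]→L[ℝ] ℝ) (D : (B →L[ℝ] B × F) →L[ℝ] ℝ) :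
    (B × F) →L[ℝ] (B [⋀^Fin k]→L[ℝ] ℝ) :=
  LinearMap.toContinuousLinearMap
    { toFun := fun w =>
        (D ∘L (ContinuousLinearMap.smulRightL ℝ B (B × F)).flip w).compContinuousAlternatingMap
          η.curryLeft.flipAlternating
      map_add' := fun w w' => by ext; simp
      map_smul' := fun r w => by ext; simp }

/-- The `m`-form `(∂L/∂y^a_μ) (dy^a - y^a_ν dx^ν) ∧ d^{m-1}x_μ + L d^m x` on `T_e E` (the
Poincaré–Cartan form), where `d^m x = η`. -/
def cartanForm (η : Form B M (k + 1)) (L : JetSpace π k → ℝ) (p : JetSpace π k) :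
    FormAt (V := B × F) (k + 1) p.toE :=
  (show FormAt (V := B × F) (k + 1) p.toE from
    ContinuousAlternatingMap.alternatizeUncurryFin (𝕜 := ℝ) (E := B × F) (F := ℝ)
      (ContinuousAlternatingMap.compContinuousLinearMapCLM (π.tproj p.toE) ∘L
        momentumMap (η (π.proj p.toE)) (fibreDeriv L p))) +
  L p • (η (π.proj p.toE)).compContinuousLinearMap (π.tproj p.toE)

/-- The Lagrangian `m`-form `Θ_L = -(∂L/∂y^a_μ) dy^a ∧ d^{m-1}x_μ +
((∂L/∂y^a_μ) y^a_μ - L) d^m x + ds^μ ∧ d^{m-1}x_μ`. -/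
def lagrangianForm (η : Form B M (k + 1)) (L : JetSpace π k → ℝ) :
    Form (JetModel B F k) (JetSpace π k) (k + 1) :=
  fun p => -(cartanForm η L p).compContinuousLinearMap
      (mfderiv 𝓘(ℝ, JetModel B F k) 𝓘(ℝ, B × F) JetSpace.toE p) +
    extD (jetTheta π k) p

variable (π k) in
/-- A Hamiltonian section `h : 𝓟* → Λ^m_2 T*E ×_M Λ^{m-1} T*M`: a smooth choice of representatives
of the classes in `J^{1*}π = Λ^m_2 T*E / Λ^m_1 T*E`. In coordinates it is given by
`p = -H(x^μ, y^a, p_a^μ, s^μ)`. -/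
structure HamiltonianSection where
  /-- the representative, a form in `Λ^m_2 T*E` -/
  toForm : ∀ p : DualJetSpace π k, FormAt (V := B × F) (k + 1) p.toE
  mem : ∀ p, toForm p ∈ verticalForms π k 2 p.toE
  mk_eq : ∀ p, DualJet.mk ⟨toForm p, mem p⟩ = p.dualJet
  smooth : ∀ c : AdaptedChart π,
    ContMDiffOn 𝓘(ℝ, DualJetModel B F k) 𝓘(ℝ, (B × F) [⋀^Fin (k + 1)]→L[ℝ] ℝ) ∞
      (fun p => formCoord c.tot p.toE (toForm p)) (DualJetSpace.toE ⁻¹' c.tot.source)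

/-- The Hamiltonian `m`-form `Θ_H = -(τ̃₁ ∘ h)^*Θ̃ + d(τ̄₂^*θ)`, where `Θ̃` is the Liouville form
of `Λ^m_2 T*E`. -/
def hamiltonianForm (h : HamiltonianSection π k) :
    Form (DualJetModel B F k) (DualJetSpace π k) (k + 1) :=
  fun p => -(h.toForm p).compContinuousLinearMap
      (mfderiv 𝓘(ℝ, DualJetModel B F k) 𝓘(ℝ, B × F) DualJetSpace.toE p) +
    extD (dualJetTheta π k) p

/-- The section `ψ` of `τ : 𝓟 → M` is holonomic on `U`: its jet component is the first jet of its
component in `E`. -/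
def IsHolonomicOn (U : Set M) (ψ : M → JetSpace π k) : Prop :=
  ∀ x ∈ U, ∀ v : TangentSpace 𝓘(ℝ, B) x,
    (ψ x).jet v = mfderiv 𝓘(ℝ, B) 𝓘(ℝ, B × F) (fun x' => (ψ x').toE) x v

/-- Holonomic sections of `τ : 𝓟 → M` on the open set `U` that satisfy the multicontact Lagrangian
equations. -/
def IsLagrangianSolution (η : Form B M (k + 1)) (L : JetSpace π k → ℝ) (U : Set M)
    (ψ : M → JetSpace π k) : Prop :=
  IsSolution (V := JetModel B F k) (W := B) JetSpace.toM (lagrangianForm η L) (jetOmega π η) U ψ ∧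
    IsHolonomicOn U ψ

/-- Sections of `𝓟* → M` on the open set `U` that satisfy the multicontact Hamilton–de Donder–Weyl
equations. -/
def IsHamiltonianSolution (η : Form B M (k + 1)) (h : HamiltonianSection π k) (U : Set M)
    (ψ : M → DualJetSpace π k) : Prop :=
  IsSolution (V := DualJetModel B F k) (W := B) DualJetSpace.toM (hamiltonianForm h)
    (dualJetOmega π η) U ψ

/-! ### Canonical lifts and natural symmetries -/

/-- The map `Φ_E : E → E` obtained from a map `G` of `𝓔` by freezing the variable `s` at the values
of the form `β` on `M`. -/
def frozen (G : ConfSpace π k → ConfSpace π k) (β : Form B M k) (e : E) : E :=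
  (G ⟨e, β (π.proj e)⟩).toE

/-- On the set `D ⊆ 𝓟`, the map `Φ` is the canonical lift `(j¹Φ_E, Ψ)` of the map `G` of `𝓔`, which
covers the map `φ` of `M`: the jet `j` at `(e, j, s)` is mapped to `TΦ_E ∘ j ∘ (Tφ)⁻¹`, where
`Φ_E` is obtained from `G` by freezing the variable `s`. (If `G` is the product of a map
`Φ_E` of `E` and a map of `Λ^{m-1} T*M`, then all choices of `β` give this map `Φ_E`.) -/
structure IsCanonicalLiftOn (G : ConfSpace π k → ConfSpace π k) (φ : M → M)
    (D : Set (JetSpace π k)) (Φ : JetSpace π k → JetSpace π k) : Prop where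
  toConf_map : ∀ p ∈ D, (Φ p).toConf = G p.toConf
  jet_map : ∀ b : FormBundle B M k, ∃ β : Form B M k, SmoothForm β ∧ β b.base = b.fib ∧
    ∀ p ∈ D, p.toForm = b → ∀ v : TangentSpace 𝓘(ℝ, B) (π.proj p.toE),
      (Φ p).jet (mfderiv 𝓘(ℝ, B) 𝓘(ℝ, B) φ (π.proj p.toE) v) =
        mfderiv 𝓘(ℝ, B × F) 𝓘(ℝ, B × F) (frozen G β) p.toE (p.jet v)

/-- The diffeomorphism `Φ` of `𝓟` is natural, over the diffeomorphism `φ` of `M`: it is the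
canonical lift of a diffeomorphism of `𝓔` which restricts to a diffeomorphism `Ψ` of
`Λ^{m-1} T*M` and to the diffeomorphism `φ` of `M`. -/
def IsNatural (Φ : Diffeomorph 𝓘(ℝ, JetModel B F k) 𝓘(ℝ, JetModel B F k)
      (JetSpace π k) (JetSpace π k) ∞)
    (φ : Diffeomorph 𝓘(ℝ, B) 𝓘(ℝ, B) M M ∞) : Prop :=
  ∃ (G : Diffeomorph 𝓘(ℝ, ConfModel B F k) 𝓘(ℝ, ConfModel B F k)
      (ConfSpace π k) (ConfSpace π k) ∞)
    (Ψ : Diffeomorph 𝓘(ℝ, FormModel B k) 𝓘(ℝ, FormModel B k)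
      (FormBundle B M k) (FormBundle B M k) ∞),
    (∀ q, (G q).toForm = Ψ q.toForm) ∧ (∀ q, (G q).toM = φ q.toM) ∧
      IsCanonicalLiftOn G φ univ Φ

/-- The vector field `Y` on `𝓟` is natural, over the vector field `Z` on `M`: it is the canonical
lift of a vector field on `𝓔` that projects onto a vector field on `Λ^{m-1} T*M` and onto `Z`, that
is, the local diffeomorphisms generated by the flow of `Y` are the canonical lifts of those
generated by the flow of the vector field on `𝓔`. -/
def IsInfNatural (Y : ∀ p : JetSpace π k, TangentSpace 𝓘(ℝ, JetModel B F k) p)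
    (Z : ∀ x : M, TangentSpace 𝓘(ℝ, B) x) : Prop :=
  ∃ (Y_conf : ∀ q : ConfSpace π k, TangentSpace 𝓘(ℝ, ConfModel B F k) q)
    (Y_form : ∀ b : FormBundle B M k, TangentSpace 𝓘(ℝ, FormModel B k) b),
    SmoothField Y_conf ∧ SmoothField Y_form ∧ SmoothField Z ∧
      ProjectsOnto ConfSpace.toForm Y_conf Y_form ∧ ProjectsOnto ConfSpace.toM Y_conf Z ∧
      ∀ p₀ : JetSpace π k, ∃ (Fl : LocalFlow Y) (Gl : LocalFlow Y_conf) (φl : LocalFlow Z),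
        Gl.time = Fl.time ∧ φl.time = Fl.time ∧ p₀ ∈ Fl.dom ∧
        (∀ p ∈ Fl.dom, p.toConf ∈ Gl.dom) ∧ (∀ p ∈ Fl.dom, p.toM ∈ φl.dom) ∧
        ∀ t ∈ Fl.time, IsCanonicalLiftOn (Gl.toFun t) (φl.toFun t) Fl.dom (Fl.toFun t)

end Systems

end Multicontact

end

open Multicontact

/-!
The theorem has two ingredients: the field equations are natural, and regularity of the Lagrangian
forces natural symmetries to preserve holonomy.

**The field equations** (`IsSolution.map`). A diffeomorphism `Φ` that preserves `Θ` and `Ω`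
preserves `dΘ`, since the exterior derivative commutes with pull-backs, and therefore the Reeb
distribution. Hence `Φ^*σ` satisfies the equations that characterize the dissipation form `σ`, and
`Φ^*σ = σ` by uniqueness. The maps of a local flow are defined on open sets only, whereas uniqueness
is a statement about global one-forms, so the difference `Φ^*σ - σ` is first cut off with a bump
function (`pullback_dissipationForm`). So `Φ` preserves `d̄Θ`, and the equations for `ψ` at `x` are
the equations for `Φ ∘ ψ ∘ φ⁻¹` at `φ(x)`. This is all that the Hamiltonian statements need; for
vector fields, uniqueness of integral curves shows that the flow of `Y` covers that of `Z`
(`LocalFlow.map_toFun`).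

**Holonomy.** A section of `𝓟` is holonomic exactly if it is tangent to the Cartan distribution, the
vectors whose projection to `E` is the image by the jet of their projection to `M`
(`isHolonomicOn_iff`). The canonical lift of a map `G` of `𝓔` acts on jets through `G` with the
variable `s` frozen, while `s` varies along a section, so the lift preserves the Cartan distribution
once the `E`-component of `G` has zero derivative along the fibres of `𝓔 → E`. This is where
regularity enters (`IsFibredSymmetry.dE_mfderiv_eq_zero`). Let `w` be tangent to such a fibre, and
let `f` be the projection to `E` of its image by `TG`. The equation `Φ^*Θ_L = Θ_L`, evaluated on
lifts of `w` and of other vectors of `𝓔`, expresses the momentum `(∂L/∂y^a_μ) f^a` at `Φ(p)` in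
terms of `G` and of `ds^μ ∧ d^{m-1}x_μ`, so that it is independent of the jet component of `Φ(p)`
(`IsFibredSymmetry.momentumMap_eq`). Its derivative along the jets is zero, that is,
`(∂²L/∂y^a_μ∂y^b_ν) f^a = 0`, and `f = 0` as the Hessian is nondegenerate.

For natural vector fields this applies to the local flows that are canonical lifts. Every other
local flow is, along an integral curve, a composition of these, so it preserves the Cartan
distribution as well (`LocalFlow.mfderiv_mem_of_locally`).
-/

namespace Multicontact

/-! ### Forms in charts and the exterior derivative -/

section FormsInCharts

variable {V N W N' : Type*} [NormedAddCommGroup V] [NormedSpace ℝ V] [TopologicalSpace N]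
  [ChartedSpace V N] [NormedAddCommGroup W] [NormedSpace ℝ W] [TopologicalSpace N']
  [ChartedSpace W N'] {k : ℕ}

lemma formRep_apply_chart (Ω : Form V N k) {c : OpenPartialHomeomorph N V} {x : N}
    (hx : x ∈ c.source) : formRep Ω c (c x) = formCoord c x (Ω x) := by
  unfold formRep
  rw [c.left_inv hx]

variable [IsManifold 𝓘(ℝ, V) ∞ N] [IsManifold 𝓘(ℝ, W) ∞ N']

/-- The differential of a map is expressed in charts by the derivative of its expression. -/
lemma chartD_mfderiv {f : N → N'} {x : N} (hf : MDifferentiableAt 𝓘(ℝ, V) 𝓘(ℝ, W) f x)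
    {c : OpenPartialHomeomorph N V} {c' : OpenPartialHomeomorph N' W}
    (hc : c ∈ IsManifold.maximalAtlas 𝓘(ℝ, V) ∞ N) (hx : x ∈ c.source)
    (hc' : c' ∈ IsManifold.maximalAtlas 𝓘(ℝ, W) ∞ N') (hx' : f x ∈ c'.source)
    (v : TangentSpace 𝓘(ℝ, V) x) :
    chartD c' (f x) (mfderiv 𝓘(ℝ, V) 𝓘(ℝ, W) f x v) =
      fderiv ℝ (c' ∘ f ∘ c.symm) (c x) (chartD c x v) := by
  have hsymm := mdiff_chart_symm hc hx
  have hf' : MDifferentiableAt 𝓘(ℝ, V) 𝓘(ℝ, W) f (c.symm (c x)) := by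
    rw [c.left_inv hx]; exact hf
  have hcf : MDifferentiableAt 𝓘(ℝ, V) 𝓘(ℝ, W) (c' ∘ f) (c.symm (c x)) := by
    rw [c.left_inv hx]; exact (mdiff_chart hc' hx').comp x hf
  have h1 := mfderiv_comp (c x) hcf hsymm
  rw [mfderiv_eq_fderiv] at h1
  have h2 := mfderiv_comp x (mdiff_chart hc' hx') hf
  have h3 := congrArg (fun T : V →L[ℝ] W => T (chartD c x v)) h1
  rw [c.left_inv hx] at h3
  have h4 := chartDInv_chartD hc hx v
  refine Eq.trans ?_ h3.symm
  change _ = mfderiv 𝓘(ℝ, V) 𝓘(ℝ, W) (c' ∘ f) x (chartDInv c x (chartD c x v))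
  rw [h4, h2]
  rfl

lemma contDiffAt_expression {f : N → N'} {x : N} (hf : ContMDiffAt 𝓘(ℝ, V) 𝓘(ℝ, W) ∞ f x)
    {c : OpenPartialHomeomorph N V} {c' : OpenPartialHomeomorph N' W}
    (hc : c ∈ IsManifold.maximalAtlas 𝓘(ℝ, V) ∞ N) (hx : x ∈ c.source)
    (hc' : c' ∈ IsManifold.maximalAtlas 𝓘(ℝ, W) ∞ N') (hx' : f x ∈ c'.source) :
    ContDiffAt ℝ ∞ (c' ∘ f ∘ c.symm) (c x) := by
  rw [← contMDiffAt_iff_contDiffAt]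
  refine ContMDiffAt.comp (c x) (I' := 𝓘(ℝ, W)) ?_ (ContMDiffAt.comp (c x) (I' := 𝓘(ℝ, V)) ?_
    (contMDiffAt_symm_of_mem_maximalAtlas hc (c.map_source hx)))
  · simp only [Function.comp_apply, c.left_inv hx]
    exact contMDiffAt_of_mem_maximalAtlas hc' hx'
  · rw [c.left_inv hx]; exact hf

/-- The expression of a pulled-back form is the pull-back of its expression. -/
lemma formRep_pullback_apply (Ω : Form W N' k) {f : N → N'} {x : N}
    (hf : MDifferentiableAt 𝓘(ℝ, V) 𝓘(ℝ, W) f x)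
    {c : OpenPartialHomeomorph N V} {c' : OpenPartialHomeomorph N' W}
    (hc : c ∈ IsManifold.maximalAtlas 𝓘(ℝ, V) ∞ N) (hx : x ∈ c.source)
    (hc' : c' ∈ IsManifold.maximalAtlas 𝓘(ℝ, W) ∞ N') (hx' : f x ∈ c'.source) :
    formRep (pullback f Ω : Form V N k) c (c x) =
      (formRep Ω c' ((c' ∘ f ∘ c.symm) (c x))).compContinuousLinearMap
        (fderiv ℝ (c' ∘ f ∘ c.symm) (c x)) := by
  rw [formRep_apply_chart _ hx]
  simp only [Function.comp_apply, c.left_inv hx]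
  rw [formRep_apply_chart _ hx']
  ext v
  change Ω (f x) (fun i => mfderiv 𝓘(ℝ, V) 𝓘(ℝ, W) f x (chartDInv c x (v i))) =
    Ω (f x) (fun i => chartDInv c' (f x) (fderiv ℝ (c' ∘ f ∘ c.symm) (c x) (v i)))
  congr 1
  funext i
  have h := chartD_mfderiv hf hc hx hc' hx' (chartDInv c x (v i))
  rw [chartD_chartDInv hc hx] at h
  rw [← h, chartDInv_chartD hc' hx']

lemma formRep_pullback_eventuallyEq (Ω : Form W N' k) {f : N → N'} {x : N}
    (hf : ContMDiffAt 𝓘(ℝ, V) 𝓘(ℝ, W) ∞ f x)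
    {c : OpenPartialHomeomorph N V} {c' : OpenPartialHomeomorph N' W}
    (hc : c ∈ IsManifold.maximalAtlas 𝓘(ℝ, V) ∞ N) (hx : x ∈ c.source)
    (hc' : c' ∈ IsManifold.maximalAtlas 𝓘(ℝ, W) ∞ N') (hx' : f x ∈ c'.source) :
    formRep (pullback f Ω : Form V N k) c =ᶠ[𝓝 (c x)] fun z =>
      (formRep Ω c' ((c' ∘ f ∘ c.symm) z)).compContinuousLinearMap
        (fderiv ℝ (c' ∘ f ∘ c.symm) z) := by
  have h1 : ∀ᶠ y in 𝓝 x, MDifferentiableAt 𝓘(ℝ, V) 𝓘(ℝ, W) f y ∧ f y ∈ c'.source := by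
    have h2 := (contMDiffAt_iff_contMDiffAt_nhds (n := 1) (by simp)).1
      (hf.of_le (show (1 : WithTop ℕ∞) ≤ ∞ by simp))
    filter_upwards [h2, hf.continuousAt.preimage_mem_nhds (c'.open_source.mem_nhds hx')]
      with y hy hy'
    exact ⟨hy.mdifferentiableAt (by simp), hy'⟩
  have h3 := (c.continuousAt_symm (c.map_source hx))
  rw [ContinuousAt, c.left_inv hx] at h3
  filter_upwards [h3.eventually h1, c.open_target.mem_nhds (c.map_source hx)] with z hz hz'
  have := formRep_pullback_apply Ω hz.1 hc (c.map_target hz') hc' hz.2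
  rwa [c.right_inv hz'] at this

lemma formRep_congr {Ω Ω' : Form V N k} {c : OpenPartialHomeomorph N V} {x : N}
    (hx : x ∈ c.source) (h : ∀ᶠ y in 𝓝 x, Ω y = Ω' y) :
    formRep Ω c =ᶠ[𝓝 (c x)] formRep Ω' c := by
  have h3 := (c.continuousAt_symm (c.map_source hx))
  rw [ContinuousAt, c.left_inv hx] at h3
  filter_upwards [h3.eventually h] with z hz
  rw [formRep, formRep, hz]

lemma extD_congr {Ω Ω' : Form V N k} {x : N} (h : ∀ᶠ y in 𝓝 x, Ω y = Ω' y) :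
    extD Ω x = extD Ω' x := by
  rw [extD, extD, (formRep_congr (mem_chart_source V x) h).extDeriv_eq]

lemma contDiffAt_formRep_pullback {n : WithTop ℕ∞} (hn : n ≤ ∞) {Ω : Form W N' k} {f : N → N'}
    {x : N} (hf : ContMDiffAt 𝓘(ℝ, V) 𝓘(ℝ, W) ∞ f x)
    {c : OpenPartialHomeomorph N V} {c' : OpenPartialHomeomorph N' W}
    (hc : c ∈ IsManifold.maximalAtlas 𝓘(ℝ, V) ∞ N) (hx : x ∈ c.source)
    (hc' : c' ∈ IsManifold.maximalAtlas 𝓘(ℝ, W) ∞ N') (hx' : f x ∈ c'.source)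
    (hΩ : ContDiffAt ℝ n (formRep Ω c') (c' (f x))) :
    ContDiffAt ℝ n (formRep (pullback f Ω : Form V N k) c) (c x) := by
  refine ContDiffAt.congr_of_eventuallyEq ?_ (formRep_pullback_eventuallyEq Ω hf hc hx hc' hx')
  have hf' := contDiffAt_expression hf hc hx hc' hx'
  have h1 : ContDiffAt ℝ ∞ (fderiv ℝ (c' ∘ f ∘ c.symm)) (c x) := hf'.fderiv_right (by simp)
  have h2 := ((contDiff_pullbackCLM k).contDiffAt.comp (c x) h1).of_le hn
  refine h2.clm_apply (ContDiffAt.comp (g := formRep Ω c') (c x) ?_ (hf'.of_le hn))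
  simpa [c.left_inv hx] using hΩ

lemma differentiableAt_formRep_pullback {Ω : Form W N' k} {f : N → N'}
    {x : N} (hf : ContMDiffAt 𝓘(ℝ, V) 𝓘(ℝ, W) ∞ f x)
    {c : OpenPartialHomeomorph N V} {c' : OpenPartialHomeomorph N' W}
    (hc : c ∈ IsManifold.maximalAtlas 𝓘(ℝ, V) ∞ N) (hx : x ∈ c.source)
    (hc' : c' ∈ IsManifold.maximalAtlas 𝓘(ℝ, W) ∞ N') (hx' : f x ∈ c'.source)
    (hΩ : DifferentiableAt ℝ (formRep Ω c') (c' (f x))) :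
    DifferentiableAt ℝ (formRep (pullback f Ω : Form V N k) c) (c x) := by
  refine DifferentiableAt.congr_of_eventuallyEq ?_
    (formRep_pullback_eventuallyEq Ω hf hc hx hc' hx')
  have hf' := contDiffAt_expression hf hc hx hc' hx'
  have h1 : ContDiffAt ℝ ∞ (fderiv ℝ (c' ∘ f ∘ c.symm)) (c x) := hf'.fderiv_right (by simp)
  have h2 := ((contDiff_pullbackCLM k).contDiffAt.comp (c x) h1).differentiableAt (by simp)
  refine h2.clm_apply (DifferentiableAt.comp (g := formRep Ω c') (c x) ?_
    (hf'.differentiableAt (by simp)))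
  simpa [c.left_inv hx] using hΩ

/-- The exterior derivative commutes with the pull-back by a smooth map, at the points where the
form is differentiable. -/
lemma extD_pullback_of_differentiableAt {Ω : Form W N' k} {f : N → N'} {x : N}
    (hf : ContMDiffAt 𝓘(ℝ, V) 𝓘(ℝ, W) ∞ f x)
    (hΩ : DifferentiableAt ℝ (formRep Ω (chartAt W (f x))) (chartAt W (f x) (f x))) :
    extD (pullback f Ω : Form V N k) x =
      (extD Ω (f x)).compContinuousLinearMap (mfderiv 𝓘(ℝ, V) 𝓘(ℝ, W) f x) := by
  have hc : chartAt V x ∈ IsManifold.maximalAtlas 𝓘(ℝ, V) ∞ N := IsManifold.chart_mem_maximalAtlas x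
  have hc' : chartAt W (f x) ∈ IsManifold.maximalAtlas 𝓘(ℝ, W) ∞ N' :=
    IsManifold.chart_mem_maximalAtlas _
  have hx := mem_chart_source V x
  have hx' := mem_chart_source W (f x)
  have hf' := contDiffAt_expression hf hc hx hc' hx'
  have h1 := (formRep_pullback_eventuallyEq Ω hf hc hx hc' hx').extDeriv_eq
  rw [extDeriv_pullback (by simpa [(chartAt V x).left_inv hx] using hΩ) hf'
    (by simpa using WithTop.coe_le_coe.2 (le_top : (2 : ℕ∞) ≤ ⊤))] at h1
  simp only [Function.comp_apply, (chartAt V x).left_inv hx] at h1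
  rw [extD, h1]
  ext v
  change extDeriv (formRep Ω (chartAt W (f x))) (chartAt W (f x) (f x))
    (fun i => fderiv ℝ (chartAt W (f x) ∘ f ∘ (chartAt V x).symm) (chartAt V x x)
      (chartD (chartAt V x) x (v i))) =
    extDeriv (formRep Ω (chartAt W (f x))) (chartAt W (f x) (f x))
    (fun i => chartD (chartAt W (f x)) (f x) (mfderiv 𝓘(ℝ, V) 𝓘(ℝ, W) f x (v i)))
  congr 1
  funext i
  exact (chartD_mfderiv (hf.mdifferentiableAt (by simp)) hc hx hc' hx' (v i)).symm

/-- The value of `extD` at a point of non-differentiability, where `fderiv` is zero by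
convention. -/
lemma extD_eq_zero_of_not_differentiableAt {Ω : Form V N k} {x : N}
    (hΩ : ¬ DifferentiableAt ℝ (formRep Ω (chartAt V x)) (chartAt V x x)) : extD Ω x = 0 := by
  rw [extD, extDeriv, fderiv_zero_of_not_differentiableAt hΩ]
  ext v
  simp [formOfCoord, ContinuousAlternatingMap.alternatizeUncurryFin_apply]

/-- Smoothness of a form can be tested in arbitrary charts around the points. -/
lemma SmoothForm.contDiffAt {Ω : Form V N k} (hΩ : SmoothForm Ω) {x : N}
    {c : OpenPartialHomeomorph N V} (hc : c ∈ IsManifold.maximalAtlas 𝓘(ℝ, V) ∞ N)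
    (hx : x ∈ c.source) : ContDiffAt ℝ ∞ (formRep Ω c) (c x) := by
  -- a change of charts is the pull-back by the identity map
  have h := contDiffAt_formRep_pullback le_rfl (Ω := Ω) (f := (id : N → N)) contMDiffAt_id hc hx
    (IsManifold.chart_mem_maximalAtlas x) (mem_chart_source V x)
    ((hΩ x).contDiffAt ((chartAt V x).open_target.mem_nhds (mem_chart_target V x)))
  have h2 : (pullback id Ω : Form V N k) = Ω := by
    funext y
    ext v
    change Ω y (fun i => mfderiv 𝓘(ℝ, V) 𝓘(ℝ, V) id y (v i)) = _
    simp [mfderiv_id]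
  rwa [h2] at h

lemma smoothForm_of_contDiffAt {Ω : Form V N k}
    (h : ∀ (x : N) (c : OpenPartialHomeomorph N V), c ∈ IsManifold.maximalAtlas 𝓘(ℝ, V) ∞ N →
      x ∈ c.source → ContDiffAt ℝ ∞ (formRep Ω c) (c x)) : SmoothForm Ω := by
  intro x z hz
  have := h _ _ (IsManifold.chart_mem_maximalAtlas x) ((chartAt V x).map_target hz)
  rw [(chartAt V x).right_inv hz] at this
  exact this.contDiffWithinAt

end FormsInCharts

/-! ### Diffeomorphisms onto open sets -/

section LocalDiffeos

variable {V N W N' : Type*} [NormedAddCommGroup V] [NormedSpace ℝ V] [TopologicalSpace N]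
  [ChartedSpace V N] [NormedAddCommGroup W] [NormedSpace ℝ W] [TopologicalSpace N']
  [ChartedSpace W N']

variable (V W) in
/-- The map `Φ` restricts to a diffeomorphism of the open set `D` onto an open set, with inverse
`Φ'`. -/
structure IsDiffeoOn (Φ : N → N') (Φ' : N' → N) (D : Set N) : Prop where
  isOpen : IsOpen D
  isOpen_image : IsOpen (Φ '' D)
  left_inv : ∀ p ∈ D, Φ' (Φ p) = p
  contMDiffOn : ContMDiffOn 𝓘(ℝ, V) 𝓘(ℝ, W) ∞ Φ D
  contMDiffOn_inv : ContMDiffOn 𝓘(ℝ, W) 𝓘(ℝ, V) ∞ Φ' (Φ '' D)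

namespace IsDiffeoOn

variable {Φ : N → N'} {Φ' : N' → N} {D : Set N} {p : N}

lemma symm (h : IsDiffeoOn V W Φ Φ' D) : IsDiffeoOn W V Φ' Φ (Φ '' D) where
  isOpen := h.isOpen_image
  isOpen_image := by
    convert h.isOpen
    rw [image_image]
    exact (image_congr h.left_inv).trans (image_id D)
  left_inv := by
    rintro _ ⟨p, hp, rfl⟩
    rw [h.left_inv p hp]
  contMDiffOn := h.contMDiffOn_inv
  contMDiffOn_inv := by
    convert h.contMDiffOn
    rw [image_image]
    exact (image_congr h.left_inv).trans (image_id D)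

lemma contMDiffAt (h : IsDiffeoOn V W Φ Φ' D) (hp : p ∈ D) : ContMDiffAt 𝓘(ℝ, V) 𝓘(ℝ, W) ∞ Φ p :=
  h.contMDiffOn.contMDiffAt (h.isOpen.mem_nhds hp)

lemma contMDiffAt_inv (h : IsDiffeoOn V W Φ Φ' D) (hp : p ∈ D) :
    ContMDiffAt 𝓘(ℝ, W) 𝓘(ℝ, V) ∞ Φ' (Φ p) :=
  h.symm.contMDiffAt (mem_image_of_mem Φ hp)

lemma mdifferentiableAt (h : IsDiffeoOn V W Φ Φ' D) (hp : p ∈ D) :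
    MDifferentiableAt 𝓘(ℝ, V) 𝓘(ℝ, W) Φ p :=
  (h.contMDiffAt hp).mdifferentiableAt (by simp)

lemma mdifferentiableAt_inv (h : IsDiffeoOn V W Φ Φ' D) (hp : p ∈ D) :
    MDifferentiableAt 𝓘(ℝ, W) 𝓘(ℝ, V) Φ' (Φ p) :=
  (h.contMDiffAt_inv hp).mdifferentiableAt (by simp)

lemma mfderiv_inv_mfderiv (h : IsDiffeoOn V W Φ Φ' D) (hp : p ∈ D) (v : TangentSpace 𝓘(ℝ, V) p) :
    mfderiv 𝓘(ℝ, W) 𝓘(ℝ, V) Φ' (Φ p) (mfderiv 𝓘(ℝ, V) 𝓘(ℝ, W) Φ p v) = v := by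
  have h1 := mfderiv_comp p (h.mdifferentiableAt_inv hp) (h.mdifferentiableAt hp)
  have h2 : mfderiv 𝓘(ℝ, V) 𝓘(ℝ, V) (Φ' ∘ Φ) p = mfderiv 𝓘(ℝ, V) 𝓘(ℝ, V) id p := by
    apply Filter.EventuallyEq.mfderiv_eq
    filter_upwards [h.isOpen.mem_nhds hp] with q hq using h.left_inv q hq
  rw [mfderiv_id] at h2
  have h3 := congrArg (fun T : V →L[ℝ] V => T v) (h1.symm.trans h2)
  exact h3

lemma mfderiv_mfderiv_inv (h : IsDiffeoOn V W Φ Φ' D) (hp : p ∈ D)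
    (w : TangentSpace 𝓘(ℝ, W) (Φ p)) :
    mfderiv 𝓘(ℝ, V) 𝓘(ℝ, W) Φ p (mfderiv 𝓘(ℝ, W) 𝓘(ℝ, V) Φ' (Φ p) w) = w := by
  have h1 := h.symm.mfderiv_inv_mfderiv (mem_image_of_mem Φ hp) w
  rw [h.left_inv p hp] at h1
  exact h1

lemma surjective_mfderiv (h : IsDiffeoOn V W Φ Φ' D) (hp : p ∈ D) :
    Function.Surjective (mfderiv 𝓘(ℝ, V) 𝓘(ℝ, W) Φ p) :=
  fun w => ⟨_, h.mfderiv_mfderiv_inv hp w⟩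

lemma mono (h : IsDiffeoOn V W Φ Φ' D) {D₁ : Set N} (h₁ : D₁ ⊆ D) (hD₁ : IsOpen D₁) :
    IsDiffeoOn V W Φ Φ' D₁ where
  isOpen := hD₁
  isOpen_image := by
    have h2 : Φ '' D₁ = Φ '' D ∩ Φ' ⁻¹' D₁ := by
      ext q
      constructor
      · rintro ⟨p, hp, rfl⟩
        exact ⟨mem_image_of_mem Φ (h₁ hp), by rwa [mem_preimage, h.left_inv p (h₁ hp)]⟩
      · rintro ⟨⟨p, hp, rfl⟩, hq⟩
        rw [mem_preimage, h.left_inv p hp] at hq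
        exact mem_image_of_mem Φ hq
    rw [h2]
    exact h.contMDiffOn_inv.continuousOn.isOpen_inter_preimage h.isOpen_image hD₁
  left_inv p hp := h.left_inv p (h₁ hp)
  contMDiffOn := h.contMDiffOn.mono h₁
  contMDiffOn_inv := h.contMDiffOn_inv.mono (image_mono h₁)

/-- The exterior derivative commutes with the pull-back by a diffeomorphism. No regularity of the
form is needed: the form is differentiable where its pull-back is, and `extD` vanishes at all other
points. -/
lemma extD_pullback (h : IsDiffeoOn V W Φ Φ' D) [IsManifold 𝓘(ℝ, V) ∞ N]
    [IsManifold 𝓘(ℝ, W) ∞ N'] {k : ℕ} (Ω : Form W N' k) (hp : p ∈ D) :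
    extD (pullback Φ Ω : Form V N k) p =
      (extD Ω (Φ p)).compContinuousLinearMap (mfderiv 𝓘(ℝ, V) 𝓘(ℝ, W) Φ p) := by
  by_cases hΩ : DifferentiableAt ℝ (formRep Ω (chartAt W (Φ p))) (chartAt W (Φ p) (Φ p))
  · exact extD_pullback_of_differentiableAt (h.contMDiffAt hp) hΩ
  · rw [extD_eq_zero_of_not_differentiableAt hΩ, extD_eq_zero_of_not_differentiableAt]
    · rfl
    · intro h1
      apply hΩ
      -- near `Φ p`, the form is the pull-back of `Φ^*Ω` by the inverse map
      have h2 := differentiableAt_formRep_pullback (h.contMDiffAt_inv hp)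
        (Ω := (pullback Φ Ω : Form V N k)) (c := chartAt W (Φ p)) (c' := chartAt V p)
        (IsManifold.chart_mem_maximalAtlas _) (mem_chart_source W (Φ p))
        (IsManifold.chart_mem_maximalAtlas _) (by rw [h.left_inv p hp]; exact mem_chart_source V p)
        (by rwa [h.left_inv p hp])
      refine h2.congr_of_eventuallyEq (formRep_congr (mem_chart_source W (Φ p)) ?_)
      filter_upwards [h.isOpen_image.mem_nhds (mem_image_of_mem Φ hp)]
      rintro _ ⟨q, hq, rfl⟩
      ext v
      have h3 : ∀ i, mfderiv 𝓘(ℝ, V) 𝓘(ℝ, W) Φ q (mfderiv 𝓘(ℝ, W) 𝓘(ℝ, V) Φ' (Φ q) (v i)) = v i :=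
        fun i => h.mfderiv_mfderiv_inv hq (v i)
      change Ω (Φ q) v = Ω (Φ (Φ' (Φ q))) (fun i => mfderiv 𝓘(ℝ, V) 𝓘(ℝ, W) Φ (Φ' (Φ q))
        (mfderiv 𝓘(ℝ, W) 𝓘(ℝ, V) Φ' (Φ q) (v i)))
      rw [h.left_inv q hq]
      exact congrArg (Ω (Φ q)) (funext h3).symm

end IsDiffeoOn

lemma isDiffeoOn_of_diffeomorph (Φ : Diffeomorph 𝓘(ℝ, V) 𝓘(ℝ, W) N N' ∞) :
    IsDiffeoOn V W Φ Φ.symm univ where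
  isOpen := isOpen_univ
  isOpen_image := by
    have h : Φ '' univ = univ := image_univ_of_surjective Φ.surjective
    rw [h]
    exact isOpen_univ
  left_inv p _ := Φ.symm_apply_apply p
  contMDiffOn := Φ.contMDiff.contMDiffOn
  contMDiffOn_inv := Φ.symm.contMDiff.contMDiffOn

lemma LocalFlow.isDiffeoOn [IsManifold 𝓘(ℝ, V) ∞ N] {Y : ∀ p : N, TangentSpace 𝓘(ℝ, V) p}
    (Fl : LocalFlow Y) {t : ℝ} (ht : t ∈ Fl.time) :
    IsDiffeoOn V V (Fl.toFun t) (Fl.invFun t) Fl.dom where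
  isOpen := Fl.isOpen_dom
  isOpen_image := Fl.isOpen_image t ht
  left_inv := Fl.left_inv t ht
  contMDiffOn := Fl.contMDiffOn.comp (contMDiffOn_const.prodMk contMDiffOn_id)
    (fun _ hp => ⟨ht, hp⟩)
  contMDiffOn_inv := Fl.contMDiffOn_inv t ht

end LocalDiffeos

/-! ### Invariance of the Reeb distribution, the dissipation form and the field equations -/

section Invariance

variable {V N W N' : Type*} [NormedAddCommGroup V] [NormedSpace ℝ V] [TopologicalSpace N]
  [ChartedSpace V N] [NormedAddCommGroup W] [NormedSpace ℝ W] [TopologicalSpace N']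
  [ChartedSpace W N'] {k : ℕ}

lemma contract_comp {x : N} {y : N'} (α : FormAt (V := W) (k + 1) y)
    (T : TangentSpace 𝓘(ℝ, V) x →L[ℝ] TangentSpace 𝓘(ℝ, W) y) (v : TangentSpace 𝓘(ℝ, V) x) :
    contract v (α.compContinuousLinearMap T : FormAt (V := V) (k + 1) x) =
      (contract (T v) α).compContinuousLinearMap T := by
  ext u
  change α (fun i => T (Matrix.vecCons v u i)) = α (Matrix.vecCons (T v) fun i => T (u i))
  congr 1
  funext i
  refine Fin.cases ?_ (fun j => ?_) i <;> simp

lemma wedgeOne_apply {x : N} (σ : FormAt (V := V) 1 x) (β : FormAt (V := V) k x)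
    (u : Fin (k + 1) → TangentSpace 𝓘(ℝ, V) x) :
    wedgeOne σ β u = ∑ i : Fin (k + 1),
      (-1) ^ (i : ℕ) • (σ (fun _ => u i) * β (i.removeNth u)) :=
  ContinuousAlternatingMap.alternatizeUncurryFin_apply _ _

lemma wedgeOne_comp {x : N} {y : N'} (σ : FormAt (V := W) 1 y) (β : FormAt (V := W) k y)
    (T : TangentSpace 𝓘(ℝ, V) x →L[ℝ] TangentSpace 𝓘(ℝ, W) y) :
    ((wedgeOne σ β).compContinuousLinearMap T : FormAt (V := V) (k + 1) x) =
      wedgeOne (σ.compContinuousLinearMap T) (β.compContinuousLinearMap T) := by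
  ext u
  rw [wedgeOne_apply]
  exact wedgeOne_apply σ β (fun i => T (u i))

lemma wedgeOne_add {x : N} (σ σ' : FormAt (V := V) 1 x) (β : FormAt (V := V) k x) :
    wedgeOne (σ + σ') β = wedgeOne σ β + wedgeOne σ' β := by
  ext u
  rw [ContinuousAlternatingMap.add_apply, wedgeOne_apply, wedgeOne_apply, wedgeOne_apply,
    ← Finset.sum_add_distrib]
  refine Finset.sum_congr rfl fun i _ => ?_
  rw [ContinuousAlternatingMap.add_apply, add_mul, smul_add]

lemma wedgeOne_smul {x : N} (r : ℝ) (σ : FormAt (V := V) 1 x) (β : FormAt (V := V) k x) :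
    wedgeOne (r • σ) β = r • wedgeOne σ β := by
  ext u
  rw [ContinuousAlternatingMap.smul_apply, wedgeOne_apply, wedgeOne_apply, Finset.smul_sum]
  refine Finset.sum_congr rfl fun i _ => ?_
  rw [ContinuousAlternatingMap.smul_apply, smul_eq_mul, smul_eq_mul, mul_assoc,
    mul_smul_comm]

lemma comp_injective_of_surjective {x : N} {y : N'} {α β : FormAt (V := W) k y}
    {T : TangentSpace 𝓘(ℝ, V) x →L[ℝ] TangentSpace 𝓘(ℝ, W) y} (hT : Function.Surjective T)
    (h : (α.compContinuousLinearMap T : FormAt (V := V) k x) = β.compContinuousLinearMap T) :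
    α = β := by
  ext u
  choose S hS using hT
  have h1 := congrArg (fun γ : FormAt (V := V) k x => γ (fun i => S (u i))) h
  change α (fun i => T (S (u i))) = β (fun i => T (S (u i))) at h1
  simpa only [hS] using h1

variable [IsManifold 𝓘(ℝ, V) ∞ N] [IsManifold 𝓘(ℝ, W) ∞ N']

variable {Φ Φ' : N → N} {D : Set N} {Θ Ω : Form V N (k + 1)} {p : N}

/-- A local diffeomorphism that preserves `Θ` preserves `dΘ`. -/
lemma extD_comp_of_preservesOn (h : IsDiffeoOn V V Φ Φ' D) (hpres : PreservesOn Θ Ω D Φ)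
    (hp : p ∈ D) :
    ((extD Θ (Φ p)).compContinuousLinearMap (mfderiv 𝓘(ℝ, V) 𝓘(ℝ, V) Φ p) :
      FormAt (V := V) (k + 2) p) = extD Θ p := by
  rw [← h.extD_pullback Θ hp]
  apply extD_congr
  filter_upwards [h.isOpen.mem_nhds hp] with q hq using (hpres q hq).1

/-- A local diffeomorphism that preserves `Θ` and `Ω` preserves the Reeb distribution. -/
lemma mfderiv_mem_reebAt (h : IsDiffeoOn V V Φ Φ' D) (hpres : PreservesOn Θ Ω D Φ)
    (hp : p ∈ D) {R : TangentSpace 𝓘(ℝ, V) p} (hR : R ∈ reebAt Θ Ω p) :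
    mfderiv 𝓘(ℝ, V) 𝓘(ℝ, V) Φ p R ∈ reebAt Θ Ω (Φ p) := by
  have hΩ : ∀ v, (contract (mfderiv 𝓘(ℝ, V) 𝓘(ℝ, V) Φ p v) (Ω (Φ p))).compContinuousLinearMap
      (mfderiv 𝓘(ℝ, V) 𝓘(ℝ, V) Φ p) = contract v (Ω p) := by
    intro v
    rw [← contract_comp, ← (hpres p hp).2]
    rfl
  have hs := h.surjective_mfderiv hp
  refine ⟨comp_injective_of_surjective hs ((hΩ R).trans hR.1), fun z hz => ?_⟩
  obtain ⟨z, rfl⟩ := hs z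
  have h1 : contract z (Ω p) = 0 := by
    rw [← hΩ, hz]
    rfl
  have h2 := hR.2 z h1
  rw [← extD_comp_of_preservesOn h hpres hp, contract_comp, contract_comp] at h2
  exact comp_injective_of_surjective hs h2

/-- The pull-back of a dissipation form by a symmetry satisfies the defining equations of a
dissipation form. -/
lemma IsDissipationForm.pullback_eq (h : IsDiffeoOn V V Φ Φ' D) (hpres : PreservesOn Θ Ω D Φ)
    {σ : Form V N 1} (hσ : IsDissipationForm Θ Ω σ) (hp : p ∈ D)
    {R : TangentSpace 𝓘(ℝ, V) p} (hR : R ∈ reebAt Θ Ω p) :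
    wedgeOne ((pullback Φ σ : Form V N 1) p) (contract R (Θ p)) = contract R (extD Θ p) := by
  have h1 := hσ.2 (Φ p) _ (mfderiv_mem_reebAt h hpres hp hR)
  have h2 := congrArg (fun α : FormAt (V := V) (k + 1) (Φ p) =>
    (α.compContinuousLinearMap (mfderiv 𝓘(ℝ, V) 𝓘(ℝ, V) Φ p) : FormAt (V := V) (k + 1) p)) h1
  simp only [wedgeOne_comp, ← contract_comp, extD_comp_of_preservesOn h hpres hp] at h2
  rw [← h2, ← (hpres p hp).1]
  rfl

variable [FiniteDimensional ℝ V] [T2Space N]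

/-- A symmetry defined on an open set preserves the dissipation form: with a bump function `χ`
supported in that open set, `σ + χ (Φ^*σ - σ)` is again a dissipation form, so it equals `σ` by
uniqueness. -/
lemma pullback_dissipationForm (h : IsDiffeoOn V V Φ Φ' D) (hpres : PreservesOn Θ Ω D Φ)
    (hp : p ∈ D) :
    (pullback Φ (dissipationForm Θ Ω) : Form V N 1) p = dissipationForm Θ Ω p := by
  unfold dissipationForm
  split_ifs with hex
  · set σ := hex.choose with hσdef
    have hσ : IsDissipationForm Θ Ω σ := hex.choose_spec.1
    obtain ⟨χ, -, hχ⟩ := (SmoothBumpFunction.nhds_basis_tsupport (I := 𝓘(ℝ, V)) p).mem_iff.1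
      (h.isOpen.mem_nhds hp)
    let σ' : Form V N 1 := fun y => σ y + χ y • ((pullback Φ σ : Form V N 1) y - σ y)
    have hσ' : IsDissipationForm Θ Ω σ' := by
      refine ⟨smoothForm_of_contDiffAt fun x c hc hx => ?_, fun q R hR => ?_⟩
      · by_cases hxD : x ∈ D
        · have h1 := hσ.1.contDiffAt hc hx
          have h2 : ContDiffAt ℝ ∞ (formRep (pullback Φ σ : Form V N 1) c) (c x) :=
            contDiffAt_formRep_pullback le_rfl (h.contMDiffAt hxD) hc hx
              (IsManifold.chart_mem_maximalAtlas (Φ x)) (mem_chart_source V (Φ x))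
              (hσ.1.contDiffAt (IsManifold.chart_mem_maximalAtlas _) (mem_chart_source V (Φ x)))
          have h3 : ContDiffAt ℝ ∞ (χ ∘ c.symm) (c x) := by
            rw [← contMDiffAt_iff_contDiffAt]
            exact χ.contMDiff.contMDiffAt.comp (c x)
              (contMDiffAt_symm_of_mem_maximalAtlas hc (c.map_source hx))
          exact h1.add (h3.smul (h2.sub h1))
        · have hxχ : x ∉ tsupport χ := fun hx' => hxD (hχ hx')
          refine (hσ.1.contDiffAt hc hx).congr_of_eventuallyEq (formRep_congr hx ?_)
          filter_upwards [(isClosed_tsupport χ).isOpen_compl.mem_nhds hxχ] with y hy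
          simp [σ', image_eq_zero_of_notMem_tsupport hy]
      · by_cases hqD : q ∈ D
        · have h1 := hσ.2 q R hR
          have h2 := hσ.pullback_eq h hpres hqD hR
          have h3 : σ' q = (1 - χ q) • σ q + χ q • (pullback Φ σ : Form V N 1) q := by
            ext u
            change σ q u + χ q * ((pullback Φ σ : Form V N 1) q u - σ q u) =
              (1 - χ q) * σ q u + χ q * (pullback Φ σ : Form V N 1) q u
            ring
          rw [h3, wedgeOne_add, wedgeOne_smul, wedgeOne_smul, h1, h2, ← add_smul]
          simp
        · have h1 : χ q = 0 := image_eq_zero_of_notMem_tsupport fun hx' => hqD (hχ hx')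
          simpa [σ', h1] using hσ.2 q R hR
    have h1 : σ' = σ := hex.unique hσ' hσ
    have h2 := congrFun h1 p
    simpa [σ', sub_eq_zero] using h2
  · rfl

/-- A local diffeomorphism that preserves `Θ` and `Ω` preserves `d̄Θ`. -/
lemma dBar_comp_of_preservesOn (h : IsDiffeoOn V V Φ Φ' D) (hpres : PreservesOn Θ Ω D Φ)
    (hp : p ∈ D) :
    ((dBar Θ Ω (Φ p)).compContinuousLinearMap (mfderiv 𝓘(ℝ, V) 𝓘(ℝ, V) Φ p) :
      FormAt (V := V) (k + 2) p) = dBar Θ Ω p := by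
  have h1 := extD_comp_of_preservesOn h hpres hp
  have h2 := wedgeOne_comp (dissipationForm Θ Ω (Φ p)) (Θ (Φ p))
    (mfderiv 𝓘(ℝ, V) 𝓘(ℝ, V) Φ p)
  have h3 := pullback_dissipationForm h hpres hp
  have h4 := (hpres p hp).1
  rw [pullback] at h3 h4
  rw [h3, h4] at h2
  rw [dBar, dBar, ← h1, ← h2]
  rfl

/-- A symmetry `Φ`, defined on an open set and covering `φ`, maps solutions to solutions. -/
theorem IsSolution.map {τ : N → N'} {φ φ' : N' → N'} {D' : Set N'}
    (h : IsDiffeoOn V V Φ Φ' D) (hpres : PreservesOn Θ Ω D Φ) (hφ : IsDiffeoOn W W φ φ' D')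
    (hτ : ∀ p ∈ D, τ p ∈ D' → τ (Φ p) = φ (τ p)) {U : Set N'} {ψ : N' → N}
    (hU : U ⊆ D') (hψ : MapsTo ψ U D) (hsol : IsSolution (V := V) (W := W) τ Θ Ω U ψ) :
    IsSolution (V := V) (W := W) τ Θ Ω (φ '' U) (Φ ∘ ψ ∘ φ') := by
  have hφU := hφ.mono hU hsol.isOpen
  have hd : ∀ x ∈ U, mfderiv 𝓘(ℝ, W) 𝓘(ℝ, V) (Φ ∘ ψ ∘ φ') (φ x) =
      mfderiv 𝓘(ℝ, V) 𝓘(ℝ, V) Φ (ψ x) ∘L mfderiv 𝓘(ℝ, W) 𝓘(ℝ, V) ψ x ∘L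
        mfderiv 𝓘(ℝ, W) 𝓘(ℝ, W) φ' (φ x) := by
    intro x hx
    have h1 : MDifferentiableAt 𝓘(ℝ, W) 𝓘(ℝ, V) ψ (φ' (φ x)) := by
      rw [hφU.left_inv x hx]
      exact (hsol.contMDiffOn.contMDiffAt (hsol.isOpen.mem_nhds hx)).mdifferentiableAt (by simp)
    have h2 : MDifferentiableAt 𝓘(ℝ, V) 𝓘(ℝ, V) Φ ((ψ ∘ φ') (φ x)) := by
      rw [Function.comp_apply, hφU.left_inv x hx]
      exact h.mdifferentiableAt (hψ hx)
    have h3 := hφU.mdifferentiableAt_inv hx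
    rw [mfderiv_comp (φ x) h2 (h1.comp _ h3), mfderiv_comp (φ x) h1 h3]
    exact congrArg (fun y => (show V →L[ℝ] V from mfderiv 𝓘(ℝ, V) 𝓘(ℝ, V) Φ (ψ y)) ∘L
      (show W →L[ℝ] V from mfderiv 𝓘(ℝ, W) 𝓘(ℝ, V) ψ y) ∘L
        (show W →L[ℝ] W from mfderiv 𝓘(ℝ, W) 𝓘(ℝ, W) φ' (φ x))) (hφU.left_inv x hx)
  have hval : ∀ x ∈ U, (Φ ∘ ψ ∘ φ') (φ x) = Φ (ψ x) := by
    intro x hx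
    simp only [Function.comp_apply, hφU.left_inv x hx]
  refine ⟨hφU.isOpen_image, ?_, ?_, ?_, ?_⟩
  · refine h.contMDiffOn.comp (hsol.contMDiffOn.comp hφU.contMDiffOn_inv ?_) ?_
    · rintro _ ⟨x, hx, rfl⟩
      rwa [mem_preimage, hφU.left_inv x hx]
    · rintro _ ⟨x, hx, rfl⟩
      rw [mem_preimage, Function.comp_apply, hφU.left_inv x hx]
      exact hψ hx
  · rintro _ ⟨x, hx, rfl⟩
    have hx' := hsol.isSection x hx
    rw [hval x hx, hτ _ (hψ hx) (by rw [hx']; exact hU hx), hx']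
  · rintro _ ⟨x, hx, rfl⟩
    have h1 := hsol.pullback_eq x hx
    have h2 := (hpres _ (hψ hx)).1
    rw [pullback] at h1 h2
    rw [pullback, hd x hx, hval x hx]
    rw [← h2] at h1
    ext u
    exact congrArg (fun α : FormAt (V := W) (k + 1) x =>
      α (fun i => mfderiv 𝓘(ℝ, W) 𝓘(ℝ, W) φ' (φ x) (u i))) h1
  · rintro _ ⟨x, hx, rfl⟩ X
    rw [hd x hx]
    -- the type of `X` depends on the point, which is rewritten next
    revert X
    rw [hval x hx]
    intro X
    obtain ⟨X, rfl⟩ := h.surjective_mfderiv (hψ hx) X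
    have h1 := hsol.pullback_contract_eq x hx X
    rw [← dBar_comp_of_preservesOn h hpres (hψ hx), contract_comp] at h1
    ext u
    exact congrArg (fun α : FormAt (V := W) (k + 1) x =>
      α (fun i => mfderiv 𝓘(ℝ, W) 𝓘(ℝ, W) φ' (φ x) (u i))) h1

end Invariance

/-! ### Flows -/

section Flows

variable {V N W N' : Type*} [NormedAddCommGroup V] [NormedSpace ℝ V] [TopologicalSpace N]
  [ChartedSpace V N] [NormedAddCommGroup W] [NormedSpace ℝ W] [TopologicalSpace N']
  [ChartedSpace W N'] [IsManifold 𝓘(ℝ, V) ∞ N] [IsManifold 𝓘(ℝ, W) ∞ N']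

/-- Integral curves of a smooth vector field on an open interval are determined by one value. -/
lemma SmoothField.eqOn_of_isMIntegralCurveOn [FiniteDimensional ℝ V] [T2Space N]
    {Y : ∀ p : N, TangentSpace 𝓘(ℝ, V) p} (hY : SmoothField Y) {J : Set ℝ} (hJ : IsOpen J)
    (hJ' : J.OrdConnected) {γ γ' : ℝ → N} (hγ : IsMIntegralCurveOn (I := 𝓘(ℝ, V)) γ Y J)
    (hγ' : IsMIntegralCurveOn (I := 𝓘(ℝ, V)) γ' Y J) {t₀ : ℝ} (ht₀ : t₀ ∈ J)
    (h : γ t₀ = γ' t₀) : EqOn γ γ' J := by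
  have : CompleteSpace V := FiniteDimensional.complete ℝ V
  have : IsManifold 𝓘(ℝ, V) 1 N := IsManifold.of_le (n := ∞) (by simp)
  intro t ht
  have hlow : ∀ x ∈ J, ∃ a ∈ J, a < x := by
    intro x hx
    obtain ⟨l, u, hxlu, hlu⟩ := mem_nhds_iff_exists_Ioo_subset.1 (hJ.mem_nhds hx)
    obtain ⟨a, ha⟩ := exists_between hxlu.1
    exact ⟨a, hlu ⟨ha.1, ha.2.trans hxlu.2⟩, ha.2⟩
  have hupp : ∀ x ∈ J, ∃ b ∈ J, x < b := by
    intro x hx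
    obtain ⟨l, u, hxlu, hlu⟩ := mem_nhds_iff_exists_Ioo_subset.1 (hJ.mem_nhds hx)
    obtain ⟨b, hb⟩ := exists_between hxlu.2
    exact ⟨b, hlu ⟨hxlu.1.trans hb.1, hb.2⟩, hb.1⟩
  -- `t₀` and `t` lie in a bounded open subinterval of `J`
  obtain ⟨a, haJ, ha⟩ := hlow (min t₀ t) (by rcases min_choice t₀ t with h | h <;> rwa [h])
  obtain ⟨b, hbJ, hb⟩ := hupp (max t₀ t) (by rcases max_choice t₀ t with h | h <;> rwa [h])
  rw [lt_min_iff] at ha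
  rw [max_lt_iff] at hb
  have hsub : Ioo a b ⊆ J := Ioo_subset_Icc_self.trans (hJ'.out haJ hbJ)
  exact isMIntegralCurveOn_Ioo_eqOn_of_contMDiff_boundaryless ⟨ha.1, hb.1⟩
    (ContMDiff.of_le hY (by simp)) (hγ.mono hsub) (hγ'.mono hsub) h ⟨ha.2, hb.2⟩

/-- A map by which `Y` projects onto `Z` maps integral curves of `Y` to integral curves of `Z`. -/
lemma ProjectsOnto.isMIntegralCurveOn {f : N → N'} {Y : ∀ p : N, TangentSpace 𝓘(ℝ, V) p}
    {Z : ∀ x : N', TangentSpace 𝓘(ℝ, W) x} (h : ProjectsOnto f Y Z)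
    (hf : MDifferentiable 𝓘(ℝ, V) 𝓘(ℝ, W) f) {γ : ℝ → N} {J : Set ℝ}
    (hγ : IsMIntegralCurveOn (I := 𝓘(ℝ, V)) γ Y J) :
    IsMIntegralCurveOn (I := 𝓘(ℝ, W)) (f ∘ γ) Z J := by
  intro t ht
  have h1 := (hf (γ t)).hasMFDerivAt.comp_hasMFDerivWithinAt t (hγ t ht)
  have h2 : (mfderiv 𝓘(ℝ, V) 𝓘(ℝ, W) f (γ t)) ∘L
      ((1 : ℝ →L[ℝ] ℝ).smulRight (Y (γ t))) = (1 : ℝ →L[ℝ] ℝ).smulRight (Z ((f ∘ γ) t)) := by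
    apply ContinuousLinearMap.ext
    intro r
    change mfderiv 𝓘(ℝ, V) 𝓘(ℝ, W) f (γ t) (r • Y (γ t)) = r • Z (f (γ t))
    rw [map_smul, h (γ t)]
  rw [← h2]
  exact h1

/-- The flows of a vector field and of its projection are intertwined by the projection map. -/
lemma LocalFlow.map_toFun [FiniteDimensional ℝ W] [T2Space N'] {f : N → N'}
    {Y : ∀ p : N, TangentSpace 𝓘(ℝ, V) p} {Z : ∀ x : N', TangentSpace 𝓘(ℝ, W) x}
    (h : ProjectsOnto f Y Z) (hf : MDifferentiable 𝓘(ℝ, V) 𝓘(ℝ, W) f) (hZ : SmoothField Z)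
    (Fl : LocalFlow Y) (φl : LocalFlow Z) {t : ℝ} (ht : t ∈ Fl.time ∩ φl.time) {p : N}
    (hp : p ∈ Fl.dom) (hp' : f p ∈ φl.dom) :
    f (Fl.toFun t p) = φl.toFun t (f p) := by
  refine hZ.eqOn_of_isMIntegralCurveOn (J := Fl.time ∩ φl.time)
    (Fl.isOpen_time.inter φl.isOpen_time) (Fl.ordConnected_time.inter φl.ordConnected_time)
    ((h.isMIntegralCurveOn hf (Fl.isIntegralCurve p hp)).mono inter_subset_left)
    ((φl.isIntegralCurve (f p) hp').mono inter_subset_right) ⟨Fl.zero_mem, φl.zero_mem⟩ ?_ ht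
  simp [Fl.map_zero p hp, φl.map_zero _ hp']

/-- The group law of the flow, for two local flows of the same vector field. -/
lemma LocalFlow.toFun_eq_comp [FiniteDimensional ℝ V] [T2Space N]
    {Y : ∀ p : N, TangentSpace 𝓘(ℝ, V) p} (hY : SmoothField Y) (Fl Fl₀ : LocalFlow Y) {s t : ℝ}
    (hs : s ∈ Fl.time) (ht : t ∈ Fl.time) (hts : t - s ∈ Fl₀.time) {p : N} (hp : p ∈ Fl.dom)
    (hp' : Fl.toFun s p ∈ Fl₀.dom) :
    Fl.toFun t p = Fl₀.toFun (t - s) (Fl.toFun s p) := by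
  have h0 := (Fl₀.isIntegralCurve _ hp').comp_add (-s)
  refine hY.eqOn_of_isMIntegralCurveOn (J := Fl.time ∩ {r | r + -s ∈ Fl₀.time})
    (Fl.isOpen_time.inter (Fl₀.isOpen_time.preimage (by fun_prop))) ?_
    ((Fl.isIntegralCurve p hp).mono inter_subset_left) (h0.mono inter_subset_right)
    (t₀ := s) ⟨hs, ?_⟩ ?_ ⟨ht, ?_⟩
  · refine Fl.ordConnected_time.inter ⟨fun x hx y hy z hz => ?_⟩
    exact Fl₀.ordConnected_time.out hx hy ⟨by linarith [hz.1], by linarith [hz.2]⟩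
  · simpa using Fl₀.zero_mem
  · simp [Fl₀.map_zero _ hp']
  · simpa [sub_eq_add_neg] using hts

lemma LocalFlow.continuousOn_curve {Y : ∀ p : N, TangentSpace 𝓘(ℝ, V) p} (Fl : LocalFlow Y)
    {p : N} (hp : p ∈ Fl.dom) : ContinuousOn (fun t => Fl.toFun t p) Fl.time :=
  (Fl.isIntegralCurve p hp).continuousOn

/-- If sets of tangent vectors are preserved by some local flow of `Y` around each point, then they
are preserved by all local flows of `Y`: the times at which the transported vector belongs to the
given sets form an open and closed subset of the time interval. -/
theorem LocalFlow.mfderiv_mem_of_locally [FiniteDimensional ℝ V] [T2Space N]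
    {Y : ∀ p : N, TangentSpace 𝓘(ℝ, V) p} (hY : SmoothField Y)
    (C : ∀ p : N, Set (TangentSpace 𝓘(ℝ, V) p))
    (hC : ∀ p₀ : N, ∃ Fl : LocalFlow Y, p₀ ∈ Fl.dom ∧ ∀ t ∈ Fl.time, ∀ p ∈ Fl.dom, ∀ ξ ∈ C p,
      mfderiv 𝓘(ℝ, V) 𝓘(ℝ, V) (Fl.toFun t) p ξ ∈ C (Fl.toFun t p))
    (Fl : LocalFlow Y) {t : ℝ} (ht : t ∈ Fl.time) {p : N} (hp : p ∈ Fl.dom)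
    {ξ : TangentSpace 𝓘(ℝ, V) p} (hξ : ξ ∈ C p) :
    mfderiv 𝓘(ℝ, V) 𝓘(ℝ, V) (Fl.toFun t) p ξ ∈ C (Fl.toFun t p) := by
  -- by the group law, membership at the time `s` implies membership at nearby times `r`
  have hstep : ∀ Fl₀ : LocalFlow Y, (∀ t ∈ Fl₀.time, ∀ p ∈ Fl₀.dom, ∀ ξ ∈ C p,
      mfderiv 𝓘(ℝ, V) 𝓘(ℝ, V) (Fl₀.toFun t) p ξ ∈ C (Fl₀.toFun t p)) →
      ∀ s ∈ Fl.time, ∀ r ∈ Fl.time, r - s ∈ Fl₀.time → Fl.toFun s p ∈ Fl₀.dom →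
      mfderiv 𝓘(ℝ, V) 𝓘(ℝ, V) (Fl.toFun s) p ξ ∈ C (Fl.toFun s p) →
      mfderiv 𝓘(ℝ, V) 𝓘(ℝ, V) (Fl.toFun r) p ξ ∈ C (Fl.toFun r p) := by
    intro Fl₀ hFl₀ s hs r hr hrs hps hmem
    have h1 := hFl₀ _ hrs _ hps _ hmem
    have hds := Fl.isDiffeoOn hs
    have hd₀ := Fl₀.isDiffeoOn hrs
    have h2 : mfderiv 𝓘(ℝ, V) 𝓘(ℝ, V) (Fl.toFun r) p =
        mfderiv 𝓘(ℝ, V) 𝓘(ℝ, V) (Fl₀.toFun (r - s) ∘ Fl.toFun s) p := by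
      apply Filter.EventuallyEq.mfderiv_eq
      filter_upwards [Fl.isOpen_dom.mem_nhds hp, (hds.contMDiffAt hp).continuousAt.preimage_mem_nhds
        (Fl₀.isOpen_dom.mem_nhds hps)] with q hq hq'
      exact Fl.toFun_eq_comp hY Fl₀ hs hr hrs hq hq'
    rw [mfderiv_comp p (hd₀.mdifferentiableAt hps) (hds.mdifferentiableAt hp)] at h2
    rw [h2, Fl.toFun_eq_comp hY Fl₀ hs hr hrs hp hps]
    exact h1
  have hconn : IsPreconnected Fl.time := Fl.ordConnected_time.isPreconnected
  refine hconn.induction₂' (fun s r =>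
      mfderiv 𝓘(ℝ, V) 𝓘(ℝ, V) (Fl.toFun s) p ξ ∈ C (Fl.toFun s p) →
      mfderiv 𝓘(ℝ, V) 𝓘(ℝ, V) (Fl.toFun r) p ξ ∈ C (Fl.toFun r p)) ?_ ?_ Fl.zero_mem ht ?_
  · intro s hs
    obtain ⟨Fl₀, hp₀, hFl₀⟩ := hC (Fl.toFun s p)
    have h1 : ∀ᶠ r in 𝓝[Fl.time] s, r - s ∈ Fl₀.time ∧ s - r ∈ Fl₀.time := by
      apply nhdsWithin_le_nhds
      have ha : ContinuousAt (fun r : ℝ => r - s) s := by fun_prop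
      have hb : ContinuousAt (fun r : ℝ => s - r) s := by fun_prop
      have h0 : Fl₀.time ∈ 𝓝 (s - s) := by
        rw [sub_self]
        exact Fl₀.isOpen_time.mem_nhds Fl₀.zero_mem
      filter_upwards [ha.preimage_mem_nhds h0, hb.preimage_mem_nhds h0] with r hr hr'
      exact ⟨hr, hr'⟩
    have h2 := (Fl.continuousOn_curve hp s hs).preimage_mem_nhdsWithin
      (Fl₀.isOpen_dom.mem_nhds hp₀)
    filter_upwards [h1, h2, self_mem_nhdsWithin] with r hr hr' hrt
    exact ⟨hstep Fl₀ hFl₀ s hs r hrt hr.1 hp₀, hstep Fl₀ hFl₀ r hrt s hs hr.2 hr'⟩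
  · intro x y z hx hy hz h1 h2 h3
    exact h2 (h1 h3)
  · have h1 : mfderiv 𝓘(ℝ, V) 𝓘(ℝ, V) (Fl.toFun 0) p = mfderiv 𝓘(ℝ, V) 𝓘(ℝ, V) id p := by
      apply Filter.EventuallyEq.mfderiv_eq
      filter_upwards [Fl.isOpen_dom.mem_nhds hp] with q hq using Fl.map_zero q hq
    rw [h1, Fl.map_zero p hp, mfderiv_id]
    exact hξ

end Flows

/-! ### Charts and projections of the bundles -/

instance finiteDimensional_continuousAlternatingMap {B : Type*} [NormedAddCommGroup B]
    [NormedSpace ℝ B] [FiniteDimensional ℝ B] (k : ℕ) :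
    FiniteDimensional ℝ (B [⋀^Fin k]→L[ℝ] ℝ) :=
  FiniteDimensional.of_injective
    ((AlternatingMap.toMultilinearMapLM (R := ℝ) (S := ℝ) (M := B) (N := ℝ) (ι := Fin k)) ∘ₗ
      ContinuousAlternatingMap.toAlternatingMapLinear (R := ℝ) (A := ℝ) (M := B) (N := ℝ))
    (AlternatingMap.coe_multilinearMap_injective.comp
      ContinuousAlternatingMap.toAlternatingMap_injective)

namespace FibreAtlas

variable {V X : Type*} [NormedAddCommGroup V] [NormedSpace ℝ V] [TopologicalSpace X]
  [ChartedSpace V X] {ι : Type*} {Q : X → Type*}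
  {N : Type*} [NormedAddCommGroup N] [NormedSpace ℝ N] (𝒜 : FibreAtlas V ι Q N)

lemma continuous_base :
    @Continuous _ _ 𝒜.core.toTopologicalSpace _ (Tot.base : Tot Q → X) := by
  let _ := 𝒜.core.toTopologicalSpace
  rw [continuous_iff_continuousAt]
  intro p
  let i := 𝒜.indexAt p.base
  let c := 𝒜.core.openPartialHomeomorph (𝒜.totChart i) (mem_range_self i)
  have hp : p ∈ c.source := 𝒜.mem_indexAt p.base
  have h1 : ContinuousAt (fun q => (𝒜.chart i).symm (c q).1) p :=
    ContinuousAt.comp (g := (𝒜.chart i).symm) (f := fun q => (c q).1)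
      ((𝒜.chart i).continuousAt_symm ((𝒜.chart i).map_source hp)) (c.continuousAt hp).fst
  refine h1.congr ?_
  filter_upwards [c.open_source.mem_nhds hp] with q hq
  exact (𝒜.chart i).left_inv hq

/-- The total space over a Hausdorff base is Hausdorff: points of the same fibre lie in the domain
of a common chart. -/
lemma t2Space [T2Space X] : @T2Space (Tot Q) 𝒜.core.toTopologicalSpace := by
  let _ := 𝒜.core.toTopologicalSpace
  refine ⟨fun p q hpq => ?_⟩
  by_cases h : p.base = q.base
  · let i := 𝒜.indexAt p.base
    let c := 𝒜.core.openPartialHomeomorph (𝒜.totChart i) (mem_range_self i)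
    have hp : p ∈ c.source := 𝒜.mem_indexAt p.base
    have hq : q ∈ c.source := by
      change q.base ∈ (𝒜.chart i).source
      rw [← h]
      exact 𝒜.mem_indexAt p.base
    obtain ⟨u, v, hu, hv, hpu, hqv, huv⟩ := t2_separation (fun h' => hpq (c.injOn hp hq h'))
    refine ⟨_, _, c.isOpen_inter_preimage hu, c.isOpen_inter_preimage hv, ⟨hp, hpu⟩, ⟨hq, hqv⟩, ?_⟩
    exact (huv.preimage c).mono inter_subset_right inter_subset_right
  · obtain ⟨u, v, hu, hv, hpu, hqv, huv⟩ := t2_separation h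
    exact ⟨_, _, hu.preimage 𝒜.continuous_base, hv.preimage 𝒜.continuous_base, hpu, hqv,
      huv.preimage _⟩

end FibreAtlas

section Expression

variable {V N W N' : Type*} [NormedAddCommGroup V] [NormedSpace ℝ V] [TopologicalSpace N]
  [ChartedSpace V N] [NormedAddCommGroup W] [NormedSpace ℝ W] [TopologicalSpace N']
  [ChartedSpace W N'] [IsManifold 𝓘(ℝ, V) ∞ N] [IsManifold 𝓘(ℝ, W) ∞ N']
  {f : N → N'} {x : N} {c : OpenPartialHomeomorph N V} {c' : OpenPartialHomeomorph N' W}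
  {g : V → W}

/-- A map with a smooth expression `g` in charts is smooth. -/
lemma contMDiffAt_of_expression
    (hc : c ∈ IsManifold.maximalAtlas 𝓘(ℝ, V) ∞ N) (hx : x ∈ c.source)
    (hc' : c' ∈ IsManifold.maximalAtlas 𝓘(ℝ, W) ∞ N') (hg : ContDiffAt ℝ ∞ g (c x))
    (hf : ∀ y ∈ c.source, f y ∈ c'.source ∧ c' (f y) = g (c y)) :
    ContMDiffAt 𝓘(ℝ, V) 𝓘(ℝ, W) ∞ f x := by
  have h1 : ContMDiffAt 𝓘(ℝ, V) 𝓘(ℝ, W) ∞ (c'.symm ∘ g ∘ c) x := by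
    refine ContMDiffAt.comp x (I' := 𝓘(ℝ, W)) ?_
      (hg.contMDiffAt.comp x (contMDiffAt_of_mem_maximalAtlas hc hx))
    refine contMDiffAt_symm_of_mem_maximalAtlas hc' ?_
    rw [Function.comp_apply, ← (hf x hx).2]
    exact c'.map_source (hf x hx).1
  refine h1.congr_of_eventuallyEq ?_
  filter_upwards [c.open_source.mem_nhds hx] with y hy
  rw [Function.comp_apply, Function.comp_apply, ← (hf y hy).2, c'.left_inv (hf y hy).1]

lemma chartD_mfderiv_of_expression
    (hc : c ∈ IsManifold.maximalAtlas 𝓘(ℝ, V) ∞ N) (hx : x ∈ c.source)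
    (hc' : c' ∈ IsManifold.maximalAtlas 𝓘(ℝ, W) ∞ N') (hg : ContDiffAt ℝ ∞ g (c x))
    (hf : ∀ y ∈ c.source, f y ∈ c'.source ∧ c' (f y) = g (c y)) (v : TangentSpace 𝓘(ℝ, V) x) :
    chartD c' (f x) (mfderiv 𝓘(ℝ, V) 𝓘(ℝ, W) f x v) = fderiv ℝ g (c x) (chartD c x v) := by
  have h1 := (contMDiffAt_of_expression hc hx hc' hg hf).mdifferentiableAt (by simp)
  rw [chartD_mfderiv h1 hc hx hc' (hf x hx).1]
  have h2 : c' ∘ f ∘ c.symm =ᶠ[𝓝 (c x)] g := by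
    filter_upwards [c.open_target.mem_nhds (c.map_source hx)] with z hz
    rw [Function.comp_apply, Function.comp_apply, (hf _ (c.map_target hz)).2, c.right_inv hz]
  rw [h2.fderiv_eq]

end Expression

section Bundles

variable {B F M E : Type*} [NormedAddCommGroup B] [NormedSpace ℝ B]
  [NormedAddCommGroup F] [NormedSpace ℝ F]
  [TopologicalSpace M] [ChartedSpace B M] [IsManifold 𝓘(ℝ, B) ∞ M]
  [TopologicalSpace E] [ChartedSpace (B × F) E] [IsManifold 𝓘(ℝ, B × F) ∞ E]
  {π : FibredManifold B F M E} {k : ℕ}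

instance [T2Space E] : T2Space (JetSpace π k) := (jetAtlas π k).t2Space

instance [T2Space E] : T2Space (DualJetSpace π k) := (dualJetAtlas π k).t2Space

lemma FibredManifold.contMDiff_proj (π : FibredManifold B F M E) :
    ContMDiff 𝓘(ℝ, B × F) 𝓘(ℝ, B) ∞ π.proj :=
  fun e => (π.isSubmersion e).contMDiffAt

lemma FibredManifold.mdifferentiableAt_proj (π : FibredManifold B F M E) (e : E) :
    MDifferentiableAt 𝓘(ℝ, B × F) 𝓘(ℝ, B) π.proj e :=
  (π.contMDiff_proj e).mdifferentiableAt (by simp)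

/-- The fibred coordinates `((x, y), (y_μ, s))` of `𝓟` over an adapted chart. -/
noncomputable def jetChart (k : ℕ) (c : AdaptedChart π) :
    OpenPartialHomeomorph (JetSpace π k) (JetModel B F k) :=
  (jetAtlas π k).core.openPartialHomeomorph ((jetAtlas π k).totChart c) (mem_range_self c)

/-- The fibred coordinates `((x, y), s)` of `𝓔` over an adapted chart. -/
noncomputable def confChart (k : ℕ) (c : AdaptedChart π) :
    OpenPartialHomeomorph (ConfSpace π k) (ConfModel B F k) :=
  (confAtlas π k).core.openPartialHomeomorph ((confAtlas π k).totChart c) (mem_range_self c)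

/-- The fibred coordinates `((x, y), (p^μ, s))` of `𝓟*` over an adapted chart. -/
noncomputable def dualJetChart (k : ℕ) (c : AdaptedChart π) :
    OpenPartialHomeomorph (DualJetSpace π k) (DualJetModel B F k) :=
  (dualJetAtlas π k).core.openPartialHomeomorph ((dualJetAtlas π k).totChart c) (mem_range_self c)

variable (c : AdaptedChart π)

lemma jetChart_mem_maximalAtlas :
    jetChart k c ∈ IsManifold.maximalAtlas 𝓘(ℝ, JetModel B F k) ∞ (JetSpace π k) :=
  IsManifold.subset_maximalAtlas (mem_iUnion₂.2 ⟨_, mem_range_self c, rfl⟩)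

lemma confChart_mem_maximalAtlas :
    confChart k c ∈ IsManifold.maximalAtlas 𝓘(ℝ, ConfModel B F k) ∞ (ConfSpace π k) :=
  IsManifold.subset_maximalAtlas (mem_iUnion₂.2 ⟨_, mem_range_self c, rfl⟩)

lemma dualJetChart_mem_maximalAtlas :
    dualJetChart k c ∈ IsManifold.maximalAtlas 𝓘(ℝ, DualJetModel B F k) ∞ (DualJetSpace π k) :=
  IsManifold.subset_maximalAtlas (mem_iUnion₂.2 ⟨_, mem_range_self c, rfl⟩)

lemma chartAt_jetSpace (p : JetSpace π k) :
    chartAt (JetModel B F k) p = jetChart k (π.adaptedChartAt p.toE) := rfl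

lemma mem_jetChart_source (p : JetSpace π k) :
    p ∈ (jetChart k (π.adaptedChartAt p.toE)).source := π.mem_adaptedChartAt p.toE

lemma mem_confChart_source (q : ConfSpace π k) :
    q ∈ (confChart k (π.adaptedChartAt q.toE)).source := π.mem_adaptedChartAt q.toE

lemma mem_dualJetChart_source (p : DualJetSpace π k) :
    p ∈ (dualJetChart k (π.adaptedChartAt p.toE)).source := π.mem_adaptedChartAt p.toE

variable {c}

lemma JetSpace.contMDiff_toE :
    ContMDiff 𝓘(ℝ, JetModel B F k) 𝓘(ℝ, B × F) ∞ (JetSpace.toE : JetSpace π k → E) := fun p =>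
  contMDiffAt_of_expression (jetChart_mem_maximalAtlas _) (mem_jetChart_source p)
    (π.adaptedChartAt p.toE).tot_mem (g := Prod.fst) contDiffAt_fst (fun _ hy => ⟨hy, rfl⟩)

lemma ConfSpace.contMDiff_toE :
    ContMDiff 𝓘(ℝ, ConfModel B F k) 𝓘(ℝ, B × F) ∞ (ConfSpace.toE : ConfSpace π k → E) := fun p =>
  contMDiffAt_of_expression (confChart_mem_maximalAtlas _) (mem_confChart_source p)
    (π.adaptedChartAt p.toE).tot_mem (g := Prod.fst) contDiffAt_fst (fun _ hy => ⟨hy, rfl⟩)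

lemma DualJetSpace.contMDiff_toE :
    ContMDiff 𝓘(ℝ, DualJetModel B F k) 𝓘(ℝ, B × F) ∞ (DualJetSpace.toE : DualJetSpace π k → E) :=
  fun p => contMDiffAt_of_expression (dualJetChart_mem_maximalAtlas _) (mem_dualJetChart_source p)
    (π.adaptedChartAt p.toE).tot_mem (g := Prod.fst) contDiffAt_fst (fun _ hy => ⟨hy, rfl⟩)

/-- The expression of the projection `𝓟 → 𝓔`, which forgets the coordinates `y_μ`. -/
noncomputable def forgetJet (B F : Type*) [NormedAddCommGroup B] [NormedSpace ℝ B]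
    [NormedAddCommGroup F] [NormedSpace ℝ F] (k : ℕ) : JetModel B F k →L[ℝ] ConfModel B F k :=
  (ContinuousLinearMap.fst ℝ _ _).prod
    (ContinuousLinearMap.snd ℝ _ _ ∘L ContinuousLinearMap.snd ℝ _ _)

lemma JetSpace.contMDiff_toConf : ContMDiff 𝓘(ℝ, JetModel B F k) 𝓘(ℝ, ConfModel B F k) ∞
    (JetSpace.toConf : JetSpace π k → ConfSpace π k) := fun p =>
  contMDiffAt_of_expression (jetChart_mem_maximalAtlas _) (mem_jetChart_source p)
    (confChart_mem_maximalAtlas (π.adaptedChartAt p.toE)) (g := forgetJet B F k)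
    (forgetJet B F k).contDiff.contDiffAt (fun _ hy => ⟨hy, rfl⟩)

lemma JetSpace.contMDiff_toM :
    ContMDiff 𝓘(ℝ, JetModel B F k) 𝓘(ℝ, B) ∞ (JetSpace.toM : JetSpace π k → M) :=
  π.contMDiff_proj.comp JetSpace.contMDiff_toE

lemma ConfSpace.contMDiff_toM :
    ContMDiff 𝓘(ℝ, ConfModel B F k) 𝓘(ℝ, B) ∞ (ConfSpace.toM : ConfSpace π k → M) :=
  π.contMDiff_proj.comp ConfSpace.contMDiff_toE

lemma DualJetSpace.contMDiff_toM :
    ContMDiff 𝓘(ℝ, DualJetModel B F k) 𝓘(ℝ, B) ∞ (DualJetSpace.toM : DualJetSpace π k → M) :=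
  π.contMDiff_proj.comp DualJetSpace.contMDiff_toE

/-- The differential of the projection `𝓟 → E`. -/
noncomputable abbrev JetSpace.dE (p : JetSpace π k) :
    TangentSpace 𝓘(ℝ, JetModel B F k) p →L[ℝ] TangentSpace 𝓘(ℝ, B × F) p.toE :=
  mfderiv 𝓘(ℝ, JetModel B F k) 𝓘(ℝ, B × F) JetSpace.toE p

/-- The differential of the projection `𝓟 → 𝓔`. -/
noncomputable abbrev JetSpace.dConf (p : JetSpace π k) :
    TangentSpace 𝓘(ℝ, JetModel B F k) p →L[ℝ] TangentSpace 𝓘(ℝ, ConfModel B F k) p.toConf :=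
  mfderiv 𝓘(ℝ, JetModel B F k) 𝓘(ℝ, ConfModel B F k) JetSpace.toConf p

/-- The differential of the projection `𝓔 → E`. -/
noncomputable abbrev ConfSpace.dE (q : ConfSpace π k) :
    TangentSpace 𝓘(ℝ, ConfModel B F k) q →L[ℝ] TangentSpace 𝓘(ℝ, B × F) q.toE :=
  mfderiv 𝓘(ℝ, ConfModel B F k) 𝓘(ℝ, B × F) ConfSpace.toE q

lemma JetSpace.mdifferentiableAt_toE (p : JetSpace π k) :
    MDifferentiableAt 𝓘(ℝ, JetModel B F k) 𝓘(ℝ, B × F) JetSpace.toE p :=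
  (JetSpace.contMDiff_toE p).mdifferentiableAt (by simp)

lemma JetSpace.mdifferentiableAt_toConf (p : JetSpace π k) :
    MDifferentiableAt 𝓘(ℝ, JetModel B F k) 𝓘(ℝ, ConfModel B F k) JetSpace.toConf p :=
  (JetSpace.contMDiff_toConf p).mdifferentiableAt (by simp)

lemma JetSpace.mdifferentiableAt_toM (p : JetSpace π k) :
    MDifferentiableAt 𝓘(ℝ, JetModel B F k) 𝓘(ℝ, B) JetSpace.toM p :=
  (JetSpace.contMDiff_toM p).mdifferentiableAt (by simp)

lemma ConfSpace.mdifferentiableAt_toE (q : ConfSpace π k) :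
    MDifferentiableAt 𝓘(ℝ, ConfModel B F k) 𝓘(ℝ, B × F) ConfSpace.toE q :=
  (ConfSpace.contMDiff_toE q).mdifferentiableAt (by simp)

lemma JetSpace.dE_eq (p : JetSpace π k) (u : TangentSpace 𝓘(ℝ, JetModel B F k) p) :
    p.dE u = p.toConf.dE (p.dConf u) := by
  have h := mfderiv_comp p (ConfSpace.mdifferentiableAt_toE p.toConf) p.mdifferentiableAt_toConf
  exact congrArg (fun T : JetModel B F k →L[ℝ] B × F => T u) h

lemma JetSpace.mfderiv_toM (p : JetSpace π k) (u : TangentSpace 𝓘(ℝ, JetModel B F k) p) :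
    mfderiv 𝓘(ℝ, JetModel B F k) 𝓘(ℝ, B) JetSpace.toM p u = π.tproj p.toE (p.dE u) := by
  have h := mfderiv_comp p (π.mdifferentiableAt_proj p.toE) p.mdifferentiableAt_toE
  exact congrArg (fun T : JetModel B F k →L[ℝ] B => T u) h

lemma JetSpace.chartD_dE (p : JetSpace π k) (hp : p.toE ∈ c.tot.source)
    (u : TangentSpace 𝓘(ℝ, JetModel B F k) p) :
    chartD c.tot p.toE (p.dE u) = (chartD (jetChart k c) p u).1 := by
  have h := chartD_mfderiv_of_expression (f := (JetSpace.toE : JetSpace π k → E))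
    (jetChart_mem_maximalAtlas c) (x := p) hp c.tot_mem
    (g := Prod.fst) contDiffAt_fst (fun _ hy => ⟨hy, rfl⟩) u
  rwa [fderiv_fst] at h

lemma JetSpace.chartD_dConf (p : JetSpace π k) (hp : p.toE ∈ c.tot.source)
    (u : TangentSpace 𝓘(ℝ, JetModel B F k) p) :
    chartD (confChart k c) p.toConf (p.dConf u) = forgetJet B F k (chartD (jetChart k c) p u) := by
  have h := chartD_mfderiv_of_expression (f := (JetSpace.toConf : JetSpace π k → ConfSpace π k))
    (jetChart_mem_maximalAtlas c) (x := p) hp (confChart_mem_maximalAtlas c)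
    (g := forgetJet B F k) (forgetJet B F k).contDiff.contDiffAt (fun _ hy => ⟨hy, rfl⟩) u
  rwa [(forgetJet B F k).fderiv] at h

lemma ConfSpace.chartD_dE (q : ConfSpace π k) (hq : q.toE ∈ c.tot.source)
    (u : TangentSpace 𝓘(ℝ, ConfModel B F k) q) :
    chartD c.tot q.toE (q.dE u) = (chartD (confChart k c) q u).1 := by
  have h := chartD_mfderiv_of_expression (f := (ConfSpace.toE : ConfSpace π k → E))
    (confChart_mem_maximalAtlas c) (x := q) hq c.tot_mem
    (g := Prod.fst) contDiffAt_fst (fun _ hy => ⟨hy, rfl⟩) u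
  rwa [fderiv_fst] at h

lemma JetSpace.surjective_dConf (p : JetSpace π k) : Function.Surjective p.dConf := by
  intro w
  set c := π.adaptedChartAt p.toE
  have hp : p.toE ∈ c.tot.source := π.mem_adaptedChartAt p.toE
  let z := chartD (confChart k c) p.toConf w
  refine ⟨chartDInv (jetChart k c) p (z.1, (0, z.2)), ?_⟩
  have h := p.chartD_dConf hp (chartDInv (jetChart k c) p (z.1, (0, z.2)))
  rw [chartD_chartDInv (jetChart_mem_maximalAtlas c) (x := p) hp] at h
  have h2 := congrArg (chartDInv (confChart k c) p.toConf) h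
  rw [chartDInv_chartD (confChart_mem_maximalAtlas c) (x := p.toConf) hp] at h2
  rw [h2]
  exact chartDInv_chartD (confChart_mem_maximalAtlas c) (x := p.toConf) hp w

lemma ConfSpace.surjective_dE (q : ConfSpace π k) : Function.Surjective q.dE := by
  intro w
  set c := π.adaptedChartAt q.toE
  have hq : q.toE ∈ c.tot.source := π.mem_adaptedChartAt q.toE
  refine ⟨chartDInv (confChart k c) q (chartD c.tot q.toE w, 0), ?_⟩
  have h := q.chartD_dE hq (chartDInv (confChart k c) q (chartD c.tot q.toE w, 0))
  rw [chartD_chartDInv (confChart_mem_maximalAtlas c) (x := q) hq] at h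
  have h2 := congrArg (chartDInv c.tot q.toE) h
  rwa [chartDInv_chartD c.tot_mem hq, chartDInv_chartD c.tot_mem hq] at h2

lemma FibredManifold.surjective_tproj (π : FibredManifold B F M E) (e : E) :
    Function.Surjective (π.tproj e) := fun v =>
  ⟨_, ((π.adaptedChartAt e).jetOfCoord (π.mem_adaptedChartAt e) 0).tproj_toHom v⟩

/-- The section of `𝓔 → E` given by a form on `M`. -/
noncomputable def formSection (π : FibredManifold B F M E) (β : Form B M k) (e : E) :
    ConfSpace π k :=
  ⟨e, β (π.proj e)⟩

lemma contMDiff_formSection {β : Form B M k} (hβ : SmoothForm β) :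
    ContMDiff 𝓘(ℝ, B × F) 𝓘(ℝ, ConfModel B F k) ∞ (formSection π β) := by
  intro e
  set c := π.adaptedChartAt e
  have he : e ∈ c.tot.source := π.mem_adaptedChartAt e
  refine contMDiffAt_of_expression c.tot_mem he (confChart_mem_maximalAtlas c)
    (g := fun z => (z, formRep β c.bas z.1)) ?_ (fun y hy => ⟨hy, ?_⟩)
  · refine contDiffAt_id.prodMk (ContDiffAt.comp (g := formRep β c.bas) (c.tot e) ?_ contDiffAt_fst)
    rw [c.fst_tot e he]
    exact hβ.contDiffAt c.bas_mem (c.mapsTo e he)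
  · change _ = (c.tot y, formRep β c.bas (c.tot y).1)
    rw [c.fst_tot y hy, formRep_apply_chart _ (c.mapsTo y hy)]
    rfl

lemma dE_mfderiv_formSection {β : Form B M k} (hβ : SmoothForm β) (e : E)
    (u : TangentSpace 𝓘(ℝ, B × F) e) :
    (formSection π β e).dE
      (mfderiv 𝓘(ℝ, B × F) 𝓘(ℝ, ConfModel B F k) (formSection π β) e u) = u := by
  have h := mfderiv_comp e (ConfSpace.mdifferentiableAt_toE (formSection π β e))
    ((contMDiff_formSection hβ e).mdifferentiableAt (by simp))
  have h2 : ConfSpace.toE ∘ formSection π β = (id : E → E) := rfl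
  rw [h2, mfderiv_id] at h
  exact (congrArg (fun T : (B × F) →L[ℝ] B × F => T u) h).symm

end Bundles

/-! ### The Lagrangian form on vectors over vertical vectors -/

section Lagrangian

variable {B F M E : Type*} [NormedAddCommGroup B] [NormedSpace ℝ B] [FiniteDimensional ℝ B]
  [NormedAddCommGroup F] [NormedSpace ℝ F] [FiniteDimensional ℝ F]
  [TopologicalSpace M] [ChartedSpace B M] [IsManifold 𝓘(ℝ, B) ∞ M]
  [TopologicalSpace E] [ChartedSpace (B × F) E] [IsManifold 𝓘(ℝ, B × F) ∞ E]
  {π : FibredManifold B F M E} {k : ℕ}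

/-- The form `θ = s^μ d^{m-1}x_μ`, in fibred coordinates `((x, y), s)`, as a linear function of the
point. -/
noncomputable def thetaModel (B F : Type*) [NormedAddCommGroup B] [NormedSpace ℝ B]
    [NormedAddCommGroup F] [NormedSpace ℝ F] (k : ℕ) :
    ConfModel B F k →L[ℝ] (ConfModel B F k [⋀^Fin k]→L[ℝ] ℝ) :=
  ContinuousAlternatingMap.compContinuousLinearMapCLM
    (ContinuousLinearMap.fst ℝ B F ∘L ContinuousLinearMap.fst ℝ _ _) ∘L
    ContinuousLinearMap.snd ℝ _ _

/-- The form `dθ = ds^μ ∧ d^{m-1}x_μ` on `𝓔`, written in the fibred coordinates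
chosen around each point. -/
noncomputable def confDTheta (q : ConfSpace π k) : FormAt (V := ConfModel B F k) (k + 1) q :=
  formOfCoord (confChart k (π.adaptedChartAt q.toE)) q
    (ContinuousAlternatingMap.alternatizeUncurryFin (thetaModel B F k))

lemma formRep_jetTheta (c : AdaptedChart π) {z : JetModel B F k} (hz : z ∈ (jetChart k c).target) :
    formRep (jetTheta π k) (jetChart k c) z =
      (thetaModel B F k (forgetJet B F k z)).compContinuousLinearMap (forgetJet B F k) := by
  obtain ⟨p, hp, rfl⟩ : ∃ p ∈ (jetChart k c).source, jetChart k c p = z :=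
    ⟨_, (jetChart k c).map_target hz, (jetChart k c).right_inv hz⟩
  rw [formRep_apply_chart _ hp]
  have hpE : p.toE ∈ c.tot.source := hp
  ext v
  change p.form (fun i => π.tproj p.toE (p.dE (chartDInv (jetChart k c) p (v i)))) =
    p.form (fun i => chartDInv c.bas (π.proj p.toE) (v i).1.1)
  congr 1
  funext i
  rw [← chartDInv_chartD c.bas_mem (c.mapsTo _ hpE) (π.tproj p.toE _), c.chartD_tproj hpE,
    p.chartD_dE hpE, chartD_chartDInv (jetChart_mem_maximalAtlas c) hp]

/-- The form `ds^μ ∧ d^{m-1}x_μ` on `𝓟` is the pull-back of the corresponding form on `𝓔`. -/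
lemma extD_jetTheta (p : JetSpace π k) :
    extD (jetTheta π k) p = (confDTheta p.toConf).compContinuousLinearMap p.dConf := by
  set c := π.adaptedChartAt p.toE with hc
  have hp : p ∈ (jetChart k c).source := mem_jetChart_source p
  let T : JetModel B F k →L[ℝ] (JetModel B F k [⋀^Fin k]→L[ℝ] ℝ) :=
    ContinuousAlternatingMap.compContinuousLinearMapCLM (forgetJet B F k) ∘L
      thetaModel B F k ∘L forgetJet B F k
  have h1 : formRep (jetTheta π k) (jetChart k c) =ᶠ[𝓝 (jetChart k c p)] T := by
    filter_upwards [(jetChart k c).open_target.mem_nhds ((jetChart k c).map_source hp)] with z hz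
    rw [formRep_jetTheta c hz]
    rfl
  have h2 : extDeriv (formRep (jetTheta π k) (jetChart k c)) (jetChart k c p) =
      ContinuousAlternatingMap.alternatizeUncurryFin T := by
    rw [h1.extDeriv_eq, extDeriv]
    exact congrArg _ (ContinuousLinearMap.fderiv (𝕜 := ℝ) (E := JetModel B F k)
      (F := JetModel B F k [⋀^Fin k]→L[ℝ] ℝ) T)
  rw [extD, chartAt_jetSpace, ← hc, h2]
  ext u
  change ContinuousAlternatingMap.alternatizeUncurryFin T
    (fun i => chartD (jetChart k c) p (u i)) =
    ContinuousAlternatingMap.alternatizeUncurryFin (thetaModel B F k)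
      (fun i => chartD (confChart k c) p.toConf (p.dConf (u i)))
  simp only [p.chartD_dConf (c := c) hp]
  rw [ContinuousAlternatingMap.alternatizeUncurryFin_apply,
    ContinuousAlternatingMap.alternatizeUncurryFin_apply]
  rfl

/-- For alternating forms pulled back by `P`, all terms of the alternatization but one insert the
vector `f ∈ ker P` into a form. -/
lemma alternatizeUncurryFin_vecCons {V W : Type*} [NormedAddCommGroup V] [NormedSpace ℝ V]
    [NormedAddCommGroup W] [NormedSpace ℝ W] (μ : V →L[ℝ] (W [⋀^Fin k]→L[ℝ] ℝ)) (P : V →L[ℝ] W)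
    {f : V} (hf : P f = 0) (u : Fin k → V) :
    ContinuousAlternatingMap.alternatizeUncurryFin
      (ContinuousAlternatingMap.compContinuousLinearMapCLM P ∘L μ) (Matrix.vecCons f u) =
      μ f (fun i => P (u i)) := by
  rw [ContinuousAlternatingMap.alternatizeUncurryFin_apply, Finset.sum_eq_single 0]
  · simp only [Fin.val_zero, pow_zero, one_smul, Matrix.cons_val_zero]
    rfl
  · intro i _ hi
    obtain ⟨l, hl⟩ := Fin.exists_succAbove_eq hi.symm
    change (-1) ^ (i : ℕ) • μ (Matrix.vecCons f u i)
      (fun l => P (Matrix.vecCons f u (i.succAbove l))) = 0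
    rw [ContinuousAlternatingMap.map_coord_zero _ l, smul_zero]
    rw [hl]
    exact hf
  · simp

/-- The Poincaré–Cartan form on a vertical vector is the momentum of that vector. -/
lemma cartanForm_vecCons (η : Form B M (k + 1)) (L : JetSpace π k → ℝ) (p : JetSpace π k)
    {f : TangentSpace 𝓘(ℝ, B × F) p.toE} (hf : π.tproj p.toE f = 0)
    (u : Fin k → TangentSpace 𝓘(ℝ, B × F) p.toE) :
    cartanForm η L p (Matrix.vecCons f u) =
      momentumMap (B := B) (F := F) (η (π.proj p.toE)) (fibreDeriv L p) f
        (fun i => π.tproj p.toE (u i)) := by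
  have h1 : (η (π.proj p.toE)).compContinuousLinearMap (π.tproj p.toE) (Matrix.vecCons f u) = 0 :=
    (η (π.proj p.toE)).map_coord_zero 0 hf
  have h2 := alternatizeUncurryFin_vecCons (V := B × F) (W := B)
    (momentumMap (B := B) (F := F) (η (π.proj p.toE)) (fibreDeriv L p)) (π.tproj p.toE) hf u
  refine (congrArg₂ (fun r s : ℝ => r + L p * s) h2 h1).trans ?_
  rw [mul_zero, add_zero]
  rfl

/-- The Lagrangian form on a vector whose projection to `E` is vertical. -/
lemma lagrangianForm_vecCons (η : Form B M (k + 1)) (L : JetSpace π k → ℝ) (p : JetSpace π k)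
    {w : TangentSpace 𝓘(ℝ, JetModel B F k) p} (hw : π.tproj p.toE (p.dE w) = 0)
    (u : Fin k → TangentSpace 𝓘(ℝ, JetModel B F k) p) :
    lagrangianForm η L p (Matrix.vecCons w u) =
      -momentumMap (B := B) (F := F) (η (π.proj p.toE)) (fibreDeriv L p) (p.dE w)
        (fun i => π.tproj p.toE (p.dE (u i))) +
      confDTheta p.toConf (Matrix.vecCons (p.dConf w) fun i => p.dConf (u i)) := by
  have hcons : ∀ {X Y : Type _} (g : X → Y) (a : X) (b : Fin k → X),
      (fun i => g (Matrix.vecCons a b i)) = Matrix.vecCons (g a) fun i => g (b i) := by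
    intro X Y g a b
    funext i
    refine Fin.cases ?_ (fun j => ?_) i <;> simp
  rw [← cartanForm_vecCons η L p hw, ← hcons p.dConf w u, ← hcons p.dE w u]
  have h := congrArg (fun α : FormAt (V := JetModel B F k) (k + 1) p => α (Matrix.vecCons w u))
    (extD_jetTheta p)
  exact congrArg (fun r : ℝ => -(cartanForm η L p fun i => p.dE (Matrix.vecCons w u i)) + r) h

/-- The Lagrangian form on a vector whose projection to `E` is vertical. Apart from the fibre
derivative of `L`, the value depends only on the projections of the arguments to `𝓔`. -/
lemma lagrangianForm_vecCons_of_dConf (η : Form B M (k + 1)) (L : JetSpace π k → ℝ)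
    (p : JetSpace π k) {w : TangentSpace 𝓘(ℝ, JetModel B F k) p}
    {u : Fin k → TangentSpace 𝓘(ℝ, JetModel B F k) p}
    {w' : TangentSpace 𝓘(ℝ, ConfModel B F k) p.toConf}
    {u' : Fin k → TangentSpace 𝓘(ℝ, ConfModel B F k) p.toConf} (hw' : p.dConf w = w')
    (hu' : ∀ i, p.dConf (u i) = u' i) (hw : π.tproj p.toConf.toE (p.toConf.dE w') = 0) :
    lagrangianForm η L p (Matrix.vecCons w u) =
      -momentumMap (B := B) (F := F) (η (π.proj p.toConf.toE)) (fibreDeriv L p) (p.toConf.dE w')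
        (fun i => π.tproj p.toConf.toE (p.toConf.dE (u' i))) +
      confDTheta p.toConf (Matrix.vecCons w' u') := by
  obtain rfl := funext hu'
  subst hw'
  have h := lagrangianForm_vecCons η L p (w := w)
    ((congrArg (π.tproj p.toE) (p.dE_eq w)).trans hw) u
  have key : ∀ (T : B × F →L[ℝ] (B [⋀^Fin k]→L[ℝ] ℝ)) (P : B × F → B) (a b : B × F)
      (x y : Fin k → B × F) (r : ℝ), a = b → x = y →
      -T a (fun i => P (x i)) + r = -T b (fun i => P (y i)) + r := by
    rintro T P a _ x _ r rfl rfl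
    rfl
  have hu : (fun i => p.dE (u i) : Fin k → B × F) = fun i => p.toConf.dE (p.dConf (u i)) :=
    funext fun i => p.dE_eq (u i)
  refine h.trans ?_
  generalize confDTheta p.toConf _ = r
  exact key (momentumMap (B := B) (F := F) (η (π.proj p.toE)) (fibreDeriv L p)) (π.tproj p.toE)
    (p.dE w) (p.toConf.dE (p.dConf w)) _ _ r (p.dE_eq w) hu

/-! ### The fibre derivatives of the Lagrangian -/

/-- The point of `𝓟` obtained by the shift `Jet.shift` of the jet component. -/
noncomputable def JetSpace.shift (p : JetSpace π k) (A : B →L[ℝ] B × F) : JetSpace π k :=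
  ⟨p.base, (p.fib.1.shift A, p.fib.2)⟩

/-- The coordinates of the shifted jet are an affine function of the shift. -/
lemma contDiff_jetCoord_shift (c : AdaptedChart π) (p : JetSpace π k) :
    ContDiff ℝ ∞ fun A : B →L[ℝ] B × F => c.jetCoord p.toE (p.fib.1.shift A) := by
  have h : ∀ A : B →L[ℝ] B × F, c.jetCoord p.toE (p.fib.1.shift A) =
      (ContinuousLinearMap.snd ℝ B F ∘L (show B × F →L[ℝ] B × F from chartD c.tot p.toE)) ∘L
        ((show B →L[ℝ] B × F from p.fib.1.toHom) +
          ((ContinuousLinearMap.id ℝ (B × F)) - (show B →L[ℝ] B × F from p.fib.1.toHom) ∘L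
            (show B × F →L[ℝ] B from π.tproj p.toE)) ∘L A) ∘L
        (show B →L[ℝ] B from chartDInv c.bas (π.proj p.toE)) := fun A => rfl
  simp only [h]
  exact contDiff_const.clm_comp ((contDiff_const.add (contDiff_const.clm_comp contDiff_id)).clm_comp
    contDiff_const)

lemma contDiff_jetChart_shift (c : AdaptedChart π) (p : JetSpace π k) :
    ContDiff ℝ ∞ fun A : B →L[ℝ] B × F => jetChart k c (p.shift A) := by
  change ContDiff ℝ ∞ fun A : B →L[ℝ] B × F => (c.tot p.toE,
    (c.jetCoord p.toE (p.fib.1.shift A), formCoord c.bas (π.proj p.toE) p.form))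
  exact contDiff_const.prodMk ((contDiff_jetCoord_shift c p).prodMk contDiff_const)

lemma contDiff_fibreLagrangian {L : JetSpace π k → ℝ}
    (hL : ContMDiff 𝓘(ℝ, JetModel B F k) 𝓘(ℝ, ℝ) ∞ L) (p : JetSpace π k) :
    ContDiff ℝ ∞ (fibreLagrangian L p) := by
  set c := π.adaptedChartAt p.toE
  have hc := jetChart_mem_maximalAtlas (k := k) c
  have hp : ∀ A, p.shift A ∈ (jetChart k c).source := fun A => π.mem_adaptedChartAt p.toE
  have h1 : fibreLagrangian L p =
      (L ∘ (jetChart k c).symm) ∘ fun A => jetChart k c (p.shift A) := by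
    funext A
    rw [Function.comp_apply, Function.comp_apply, (jetChart k c).left_inv (hp A)]
    rfl
  rw [contDiff_iff_contDiffAt, h1]
  intro A
  refine ContDiffAt.comp A ?_ (contDiff_jetChart_shift c p).contDiffAt
  rw [← contMDiffAt_iff_contDiffAt]
  exact hL.contMDiffAt.comp _
    (contMDiffAt_symm_of_mem_maximalAtlas hc ((jetChart k c).map_source (hp A)))

lemma Jet.shift_zero {e : E} (j : Jet π e) : j.shift (0 : B →L[ℝ] B × F) = j := by
  have key : ∀ (J : B →L[ℝ] B × F) (P : B × F →L[ℝ] B) (v : B),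
      J v + ((0 : B →L[ℝ] B × F) v - J (P ((0 : B →L[ℝ] B × F) v))) = J v := by
    intro J P v
    simp
  exact Jet.ext' fun v => key j.toHom (π.tproj e) v

lemma JetSpace.shift_zero (p : JetSpace π k) : p.shift 0 = p :=
  congrArg (fun j => (⟨p.base, (j, p.fib.2)⟩ : JetSpace π k)) p.fib.1.shift_zero

lemma Jet.shift_shift {e : E} (j : Jet π e) (A C : B →L[ℝ] B × F)
    (hC : ∀ v, π.tproj e (C v) = 0) :
    Jet.shift (j.shift A) C = j.shift (A + C : B →L[ℝ] B × F) := by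
  have key : ∀ (J J' : B →L[ℝ] B × F) (P : B × F →L[ℝ] B) (v : B), P (C v) = 0 →
      (J v + (A v - J (P (A v)))) + (C v - J' (P (C v))) =
        J v + ((A + C) v - J (P ((A + C) v))) := by
    intro J J' P v h
    rw [show (A + C) v = A v + C v from rfl, map_add, h, map_zero, sub_zero, add_zero, add_assoc,
      sub_add_eq_add_sub]
  exact Jet.ext' fun v => key j.toHom (j.shift A).toHom (π.tproj e) v (hC v)

/-- The fibre derivative at a shifted jet, in vertical directions: vertical shifts add up, so it is
a derivative of the same function on the fibre. -/
lemma fibreDeriv_shift {L : JetSpace π k → ℝ}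
    (hL : ContMDiff 𝓘(ℝ, JetModel B F k) 𝓘(ℝ, ℝ) ∞ L) (p : JetSpace π k) (A C : B →L[ℝ] B × F)
    (hC : ∀ v, π.tproj p.toE (C v) = 0) :
    fibreDeriv L (p.shift A) C = fderiv ℝ (fibreLagrangian L p) A C := by
  have h1 : ∀ r : ℝ, fibreLagrangian L (p.shift A) (0 + r • C) =
      fibreLagrangian L p (A + r • C) := by
    intro r
    have h2 : (p.fib.1.shift A).shift (r • C) = p.fib.1.shift (A + r • C) :=
      Jet.shift_shift _ _ _ fun v => by
        have key : ∀ (P : B × F →L[ℝ] B) (a : B × F), P a = 0 → P (r • a) = 0 := by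
          intro P a ha
          rw [map_smul, ha, smul_zero]
        exact key (π.tproj p.toE) (C v) (hC v)
    rw [zero_add]
    exact congrArg (fun j => L ⟨p.base, (j, p.fib.2)⟩) h2
  have h2 := ((contDiff_fibreLagrangian hL (p.shift A)).differentiable (by simp)
    0).hasFDerivAt.hasLineDerivAt C
  have h3 := ((contDiff_fibreLagrangian hL p).differentiable (by simp)
    A).hasFDerivAt.hasLineDerivAt C
  rw [HasLineDerivAt] at h2 h3
  simp only [h1] at h2
  exact h2.unique h3

end Lagrangian

/-! ### Symmetries of the Lagrangian form and the Cartan distribution -/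

section CartanDistribution

variable {B F M E : Type*} [NormedAddCommGroup B] [NormedSpace ℝ B] [FiniteDimensional ℝ B]
  [NormedAddCommGroup F] [NormedSpace ℝ F] [FiniteDimensional ℝ F]
  [TopologicalSpace M] [ChartedSpace B M] [IsManifold 𝓘(ℝ, B) ∞ M]
  [TopologicalSpace E] [ChartedSpace (B × F) E] [IsManifold 𝓘(ℝ, B × F) ∞ E]
  {π : FibredManifold B F M E} {k : ℕ}

/-- The map `Φ`, a diffeomorphism of the open set `D ⊆ 𝓟` onto an open set, preserves the
Lagrangian form and the volume form, and covers a diffeomorphism `G` between open sets of `𝓔` and a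
map `φ` of `M`. -/
structure IsFibredSymmetry (η : Form B M (k + 1)) (L : JetSpace π k → ℝ)
    (Φ Φ' : JetSpace π k → JetSpace π k) (D : Set (JetSpace π k))
    (G G' : ConfSpace π k → ConfSpace π k) (DG : Set (ConfSpace π k)) (φ : M → M) : Prop where
  isDiffeoOn : IsDiffeoOn (JetModel B F k) (JetModel B F k) Φ Φ' D
  isDiffeoOn_conf : IsDiffeoOn (ConfModel B F k) (ConfModel B F k) G G' DG
  mapsTo : ∀ p ∈ D, p.toConf ∈ DG
  toConf_map : ∀ p ∈ D, (Φ p).toConf = G p.toConf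
  toM_map : ∀ p ∈ D, (Φ p).toM = φ p.toM
  mdifferentiableAt : ∀ p ∈ D, MDifferentiableAt 𝓘(ℝ, B) 𝓘(ℝ, B) φ p.toM
  preservesOn : PreservesOn (lagrangianForm η L) (jetOmega π η) D Φ

/-- Small shifts of the jet of a point of an open set stay in the open set. -/
lemma JetSpace.eventually_shift_mem {U : Set (JetSpace π k)} (hU : IsOpen U) {p : JetSpace π k}
    (hp : p ∈ U) : ∀ᶠ A in 𝓝 (0 : B →L[ℝ] B × F), p.shift A ∈ U := by
  set c := π.adaptedChartAt p.toE
  have hc : ∀ A, p.shift A ∈ (jetChart k c).source := fun A => π.mem_adaptedChartAt p.toE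
  have h1 : ContinuousAt (fun A => (jetChart k c).symm (jetChart k c (p.shift A))) 0 :=
    ((jetChart k c).continuousAt_symm ((jetChart k c).map_source (hc 0))).comp
      (f := fun A => jetChart k c (p.shift A)) (contDiff_jetChart_shift c p).continuous.continuousAt
  simp only [(jetChart k c).left_inv (hc _)] at h1
  exact h1.preimage_mem_nhds (hU.mem_nhds (by rwa [p.shift_zero]))

variable {η : Form B M (k + 1)} {L : JetSpace π k → ℝ} {Φ Φ' : JetSpace π k → JetSpace π k}
  {D : Set (JetSpace π k)} {G G' : ConfSpace π k → ConfSpace π k} {DG : Set (ConfSpace π k)}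
  {φ : M → M} {p : JetSpace π k}

namespace IsFibredSymmetry

lemma dConf_mfderiv (h : IsFibredSymmetry η L Φ Φ' D G G' DG φ) (hp : p ∈ D)
    (ξ : TangentSpace 𝓘(ℝ, JetModel B F k) p) :
    (Φ p).dConf (mfderiv 𝓘(ℝ, JetModel B F k) 𝓘(ℝ, JetModel B F k) Φ p ξ) =
      mfderiv 𝓘(ℝ, ConfModel B F k) 𝓘(ℝ, ConfModel B F k) G p.toConf (p.dConf ξ) := by
  have h1 := mfderiv_comp p (Φ p).mdifferentiableAt_toConf (h.isDiffeoOn.mdifferentiableAt hp)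
  have h2 := mfderiv_comp p (h.isDiffeoOn_conf.mdifferentiableAt (h.mapsTo p hp))
    p.mdifferentiableAt_toConf
  have h3 : mfderiv 𝓘(ℝ, JetModel B F k) 𝓘(ℝ, ConfModel B F k) (JetSpace.toConf ∘ Φ) p =
      mfderiv 𝓘(ℝ, JetModel B F k) 𝓘(ℝ, ConfModel B F k) (G ∘ JetSpace.toConf) p := by
    apply Filter.EventuallyEq.mfderiv_eq
    filter_upwards [h.isDiffeoOn.isOpen.mem_nhds hp] with q hq using h.toConf_map q hq
  exact congrArg (fun T : JetModel B F k →L[ℝ] ConfModel B F k => T ξ)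
    ((h1.symm.trans h3).trans h2)

lemma mfderiv_toM (h : IsFibredSymmetry η L Φ Φ' D G G' DG φ) (hp : p ∈ D)
    (ξ : TangentSpace 𝓘(ℝ, JetModel B F k) p) :
    mfderiv 𝓘(ℝ, JetModel B F k) 𝓘(ℝ, B) JetSpace.toM (Φ p)
      (mfderiv 𝓘(ℝ, JetModel B F k) 𝓘(ℝ, JetModel B F k) Φ p ξ) =
      mfderiv 𝓘(ℝ, B) 𝓘(ℝ, B) φ p.toM
        (mfderiv 𝓘(ℝ, JetModel B F k) 𝓘(ℝ, B) JetSpace.toM p ξ) := by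
  have h1 := mfderiv_comp p (Φ p).mdifferentiableAt_toM (h.isDiffeoOn.mdifferentiableAt hp)
  have h2 := mfderiv_comp p (h.mdifferentiableAt p hp) p.mdifferentiableAt_toM
  have h3 : mfderiv 𝓘(ℝ, JetModel B F k) 𝓘(ℝ, B) (JetSpace.toM ∘ Φ) p =
      mfderiv 𝓘(ℝ, JetModel B F k) 𝓘(ℝ, B) (φ ∘ JetSpace.toM) p := by
    apply Filter.EventuallyEq.mfderiv_eq
    filter_upwards [h.isDiffeoOn.isOpen.mem_nhds hp] with q hq using h.toM_map q hq
  exact congrArg (fun T : JetModel B F k →L[ℝ] B => T ξ) ((h1.symm.trans h3).trans h2)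

/-- Invariance of the Lagrangian form, evaluated on a vector along the fibres of `𝓔 → E`: the
momentum at `Φ p₁` of the image of that vector depends on `p₁` only through its projection to `𝓔`,
that is, not on its jet component. -/
lemma momentumMap_eq (h : IsFibredSymmetry η L Φ Φ' D G G' DG φ) {p₁ : JetSpace π k} (hp₁ : p₁ ∈ D)
    {q₁ q₂ : ConfSpace π k} (h₁ : p₁.toConf = q₁) (h₂ : (Φ p₁).toConf = q₂)
    (w : TangentSpace 𝓘(ℝ, ConfModel B F k) q₁) (hw : q₁.dE w = 0)
    (hv : π.tproj q₂.toE
      (q₂.dE (mfderiv 𝓘(ℝ, ConfModel B F k) 𝓘(ℝ, ConfModel B F k) G q₁ w)) = 0)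
    (u : Fin k → TangentSpace 𝓘(ℝ, ConfModel B F k) q₂) :
    momentumMap (B := B) (F := F) (η (π.proj q₂.toE)) (fibreDeriv L (Φ p₁))
      (q₂.dE (mfderiv 𝓘(ℝ, ConfModel B F k) 𝓘(ℝ, ConfModel B F k) G q₁ w))
      (fun i => π.tproj q₂.toE (q₂.dE (u i))) =
    confDTheta q₂ (Matrix.vecCons
      (mfderiv 𝓘(ℝ, ConfModel B F k) 𝓘(ℝ, ConfModel B F k) G q₁ w : ConfModel B F k) u) -
    confDTheta q₁ (Matrix.vecCons w fun i =>
      (mfderiv 𝓘(ℝ, ConfModel B F k) 𝓘(ℝ, ConfModel B F k) G' q₂ (u i) : ConfModel B F k)) := by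
  subst h₁ h₂
  -- evaluate `Φ^*Θ = Θ` at `p₁` on lifts of `w` and of the images of the `u i` by `G'`
  obtain ⟨ξ, rfl⟩ := p₁.surjective_dConf w
  choose S hS using (Φ p₁).surjective_dConf
  let u₁ : Fin k → TangentSpace 𝓘(ℝ, JetModel B F k) p₁ := fun i =>
    mfderiv 𝓘(ℝ, JetModel B F k) 𝓘(ℝ, JetModel B F k) Φ' (Φ p₁) (S (u i))
  have hu₁ : ∀ i, mfderiv 𝓘(ℝ, JetModel B F k) 𝓘(ℝ, JetModel B F k) Φ p₁ (u₁ i) = S (u i) :=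
    fun i => h.isDiffeoOn.mfderiv_mfderiv_inv hp₁ _
  have hξ := h.dConf_mfderiv hp₁ ξ
  have hu₁' : ∀ i, p₁.dConf (u₁ i) =
      mfderiv 𝓘(ℝ, ConfModel B F k) 𝓘(ℝ, ConfModel B F k) G' (Φ p₁).toConf (u i) := by
    intro i
    have h3 := h.dConf_mfderiv hp₁ (u₁ i)
    rw [hu₁, hS] at h3
    have h4 := h.isDiffeoOn_conf.mfderiv_inv_mfderiv (h.mapsTo p₁ hp₁) (p₁.dConf (u₁ i))
    rw [← h3, ← h.toConf_map p₁ hp₁] at h4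
    exact h4.symm
  have h5 := congrArg (fun α : FormAt (V := JetModel B F k) (k + 1) p₁ => α (Matrix.vecCons ξ u₁))
    (h.preservesOn p₁ hp₁).1
  have h6 : (pullback Φ (lagrangianForm η L) : Form (JetModel B F k) (JetSpace π k) (k + 1)) p₁
      (Matrix.vecCons ξ u₁) = lagrangianForm η L (Φ p₁) (Matrix.vecCons
        (mfderiv 𝓘(ℝ, JetModel B F k) 𝓘(ℝ, JetModel B F k) Φ p₁ ξ) fun i => S (u i)) := by
    refine congrArg (lagrangianForm η L (Φ p₁)) ?_
    funext i
    refine Fin.cases ?_ (fun j => ?_) i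
    · rfl
    · exact hu₁ j
  have h7 := lagrangianForm_vecCons_of_dConf η L (Φ p₁) hξ (fun i => hS (u i)) hv
  have h8 := lagrangianForm_vecCons_of_dConf η L p₁ (w := ξ) (u := u₁) rfl hu₁'
    ((congrArg (π.tproj p₁.toE) hw).trans (map_zero _))
  -- no momentum at `p₁`, as `w` projects to zero in `E`
  have h9 : ∀ v, momentumMap (B := B) (F := F) (η (π.proj p₁.toConf.toE)) (fibreDeriv L p₁)
      (p₁.toConf.dE (p₁.dConf ξ)) v = 0 := by
    intro v
    have key : ∀ (T : B × F →L[ℝ] (B [⋀^Fin k]→L[ℝ] ℝ)) (a : B × F), a = 0 → T a v = 0 := by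
      rintro T _ rfl
      rw [map_zero]
      rfl
    exact key _ _ hw
  have h10 := h7.symm.trans (h6.symm.trans (h5.trans h8))
  have h11 := h9 fun i => π.tproj p₁.toConf.toE (p₁.toConf.dE
    (mfderiv 𝓘(ℝ, ConfModel B F k) 𝓘(ℝ, ConfModel B F k) G' (Φ p₁).toConf (u i)))
  linarith

/-- The image by `G` of a vector along the fibres of `𝓔 → E` is tangent to the fibres of `𝓔 → E`:
its momentum is the same at all jets near `Φ p`, so that its projection to `E` lies in the
kernel of the Hessian of a regular Lagrangian. In coordinates, `G` maps `y^a` to a function that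
does not depend on `s^μ`. -/
lemma dE_mfderiv_eq_zero (h : IsFibredSymmetry η L Φ Φ' D G G' DG φ) (hη : ∀ x, η x ≠ 0)
    (hL : ContMDiff 𝓘(ℝ, JetModel B F k) 𝓘(ℝ, ℝ) ∞ L) (hreg : IsRegularLagrangian L) (hp : p ∈ D)
    (w : TangentSpace 𝓘(ℝ, ConfModel B F k) p.toConf) (hw : p.toConf.dE w = 0) :
    (Φ p).toConf.dE
      (mfderiv 𝓘(ℝ, ConfModel B F k) 𝓘(ℝ, ConfModel B F k) G p.toConf w) = 0 := by
  set q' := (Φ p).toConf with hq'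
  set f : TangentSpace 𝓘(ℝ, B × F) q'.toE :=
    q'.dE (mfderiv 𝓘(ℝ, ConfModel B F k) 𝓘(ℝ, ConfModel B F k) G p.toConf w) with hf
  -- `f` is vertical, as `Φ` covers the map `φ` of `M`
  have hv : π.tproj q'.toE f = 0 := by
    obtain ⟨ξ, hξ⟩ := p.surjective_dConf w
    have h0 : p.dE ξ = 0 := (p.dE_eq ξ).trans ((congrArg p.toConf.dE hξ).trans hw)
    have h1 : mfderiv 𝓘(ℝ, JetModel B F k) 𝓘(ℝ, B) JetSpace.toM p ξ = 0 :=
      (p.mfderiv_toM ξ).trans ((congrArg (π.tproj p.toE) h0).trans (map_zero _))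
    have h2 := (JetSpace.mfderiv_toM (Φ p) _).trans (congrArg (π.tproj (Φ p).toE)
      ((JetSpace.dE_eq (Φ p) _).trans (congrArg (Φ p).toConf.dE ((h.dConf_mfderiv hp ξ).trans
        (congrArg (mfderiv 𝓘(ℝ, ConfModel B F k) 𝓘(ℝ, ConfModel B F k) G p.toConf) hξ)))))
    exact h2.symm.trans ((h.mfderiv_toM hp ξ).trans
      ((congrArg (mfderiv 𝓘(ℝ, B) 𝓘(ℝ, B) φ p.toM) h1).trans (map_zero _)))
  obtain ⟨u, hu⟩ : ∃ u : Fin (k + 1) → B, (show B [⋀^Fin (k + 1)]→L[ℝ] ℝ from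
      η (π.proj q'.toE)) u ≠ 0 := by
    by_contra hcon
    push Not at hcon
    exact hη _ (ContinuousAlternatingMap.ext hcon)
  choose S₁ hS₁ using π.surjective_tproj q'.toE
  choose S₂ hS₂ using q'.surjective_dE
  let u' : Fin k → TangentSpace 𝓘(ℝ, ConfModel B F k) q' := fun i => S₂ (S₁ (Fin.tail u i))
  have hu' : ∀ i, π.tproj q'.toE (q'.dE (u' i)) = Fin.tail u i := fun i => by
    simp only [u', hS₂]
    exact hS₁ _
  -- the covector `η(·, u₁, …, u_k)` is nonzero, and the momentum of `f` on `(u₁, …, u_k)` is the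
  -- fibre derivative in the direction `A₀ = ξ ⊗ f`
  let ξ : B →L[ℝ] ℝ := (show B [⋀^Fin (k + 1)]→L[ℝ] ℝ from
    η (π.proj q'.toE)).curryLeft.flipAlternating (Fin.tail u)
  have hξ : ξ (u 0) ≠ 0 := by
    have h1 : ξ (u 0) = (show B [⋀^Fin (k + 1)]→L[ℝ] ℝ from η (π.proj q'.toE)) u :=
      congrArg (show B [⋀^Fin (k + 1)]→L[ℝ] ℝ from η (π.proj q'.toE)) (Fin.cons_self_tail u)
    rwa [h1]
  let A₀ : B →L[ℝ] B × F := ξ.smulRight (show B × F from f)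
  have hA₀ : ∀ v, π.tproj (Φ p).toE (A₀ v) = 0 := by
    intro v
    have key : ∀ (P : B × F →L[ℝ] B) (a : B × F), P a = 0 → P (ξ v • a) = 0 := by
      intro P a ha
      rw [map_smul, ha, smul_zero]
    exact key (π.tproj q'.toE) f hv
  obtain ⟨K, hK⟩ : ∃ K : ℝ, ∀ p₁ ∈ D, p₁.toConf = p.toConf → (Φ p₁).toConf = q' →
      fibreDeriv L (Φ p₁) A₀ = K := by
    have htail : (fun i => π.tproj q'.toE (q'.dE (u' i)) : Fin k → B) = Fin.tail u := funext hu'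
    exact ⟨_, fun p₁ hp₁ h₁ h₂ => (congrArg (fun t : Fin k → B => fibreDeriv L (Φ p₁)
      (((show B [⋀^Fin (k + 1)]→L[ℝ] ℝ from
        η (π.proj q'.toE)).curryLeft.flipAlternating t).smulRight (show B × F from f)))
          htail).symm.trans (h.momentumMap_eq hp₁ h₁ h₂ w hw hv u')⟩
  -- every jet near that of `Φ p`, over the same point of `𝓔`, belongs to some `Φ p₁` with `p₁` over
  -- the same point of `𝓔` as `p`
  have hconst : ∀ᶠ A in 𝓝 (0 : B →L[ℝ] B × F), fderiv ℝ (fibreLagrangian L (Φ p)) A A₀ = K := by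
    filter_upwards [JetSpace.eventually_shift_mem h.isDiffeoOn.isOpen_image
      (mem_image_of_mem Φ hp)] with A hA
    obtain ⟨p₁, hp₁, hA⟩ := hA
    have h₂ : (Φ p₁).toConf = q' := by
      rw [hA]
      rfl
    have h₁ : p₁.toConf = p.toConf := by
      have h3 := h₂
      rw [hq', h.toConf_map p₁ hp₁, h.toConf_map p hp] at h3
      rw [← h.isDiffeoOn_conf.left_inv _ (h.mapsTo p₁ hp₁), h3,
        h.isDiffeoOn_conf.left_inv _ (h.mapsTo p hp)]
    rw [← fibreDeriv_shift hL (Φ p) A A₀ hA₀, ← hA]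
    exact hK p₁ hp₁ h₁ h₂
  have hfL := contDiff_fibreLagrangian hL (Φ p)
  have hd : DifferentiableAt ℝ (fderiv ℝ (fibreLagrangian L (Φ p))) 0 :=
    (hfL.fderiv_right (m := ∞) (by simp)).differentiable (by simp) 0
  have hsymm : IsSymmSndFDerivAt ℝ (fibreLagrangian L (Φ p)) 0 :=
    hfL.contDiffAt.isSymmSndFDerivAt
      (by simpa using WithTop.coe_le_coe.2 (le_top : (2 : ℕ∞) ≤ ⊤))
  -- so `A₀` lies in the kernel of the Hessian
  have hzero : fderiv ℝ (fderiv ℝ (fibreLagrangian L (Φ p))) 0 A₀ = 0 := by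
    ext C
    rw [hsymm A₀ C]
    have h1 := (hd.hasFDerivAt.clm_apply (hasFDerivAt_const A₀ 0))
    have h2 : HasFDerivAt (fun A => fderiv ℝ (fibreLagrangian L (Φ p)) A A₀)
        (0 : (B →L[ℝ] B × F) →L[ℝ] ℝ) 0 :=
      (hasFDerivAt_const K 0).congr_of_eventuallyEq hconst
    have h3 := congrArg (fun T : (B →L[ℝ] B × F) →L[ℝ] ℝ => T C) (h1.unique h2)
    simpa using h3
  have h1 := hreg (Φ p) A₀ hA₀ hzero
  have h2 := congrArg (fun T : B →L[ℝ] B × F => T (u 0)) h1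
  exact (smul_eq_zero.1 (show ξ (u 0) • (show B × F from f) = 0 from h2)).resolve_left hξ

end IsFibredSymmetry

/-- The Cartan distribution on `𝓟`: the vectors whose projection to `E` is the image by the jet of
their projection to `M`. -/
def cartanDistribution (p : JetSpace π k) : Set (TangentSpace 𝓘(ℝ, JetModel B F k) p) :=
  {ξ | p.dE ξ = p.jet (mfderiv 𝓘(ℝ, JetModel B F k) 𝓘(ℝ, B) JetSpace.toM p ξ)}

/-- A symmetry of the Lagrangian form that is a canonical lift preserves the Cartan distribution:
on `𝓔`, a vector in the distribution differs by a vector along the fibres of `𝓔 → E` from the image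
by `e ↦ (e, β(π(e)))` of its projection to `E`, and `TG` maps such a difference to zero in `E`. -/
theorem IsFibredSymmetry.mfderiv_mem_cartanDistribution
    (h : IsFibredSymmetry η L Φ Φ' D G G' DG φ) (hη : ∀ x, η x ≠ 0)
    (hL : ContMDiff 𝓘(ℝ, JetModel B F k) 𝓘(ℝ, ℝ) ∞ L) (hreg : IsRegularLagrangian L)
    (hlift : IsCanonicalLiftOn G φ D Φ) (hp : p ∈ D)
    {ξ : TangentSpace 𝓘(ℝ, JetModel B F k) p} (hξ : ξ ∈ cartanDistribution p) :
    mfderiv 𝓘(ℝ, JetModel B F k) 𝓘(ℝ, JetModel B F k) Φ p ξ ∈ cartanDistribution (Φ p) := by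
  obtain ⟨β, hβ, hβb, hjet⟩ := hlift.jet_map p.toForm
  have hsec : formSection π β p.toE = p.toConf :=
    congrArg (fun s => (⟨p.base, s⟩ : ConfSpace π k)) hβb
  set dG := mfderiv 𝓘(ℝ, ConfModel B F k) 𝓘(ℝ, ConfModel B F k) G p.toConf with hdG
  set v := mfderiv 𝓘(ℝ, JetModel B F k) 𝓘(ℝ, B) JetSpace.toM p ξ with hvdef
  set ζ : ConfModel B F k :=
    mfderiv 𝓘(ℝ, B × F) 𝓘(ℝ, ConfModel B F k) (formSection π β) p.toE (p.dE ξ) with hζ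
  obtain ⟨X, hX⟩ : ∃ X : ConfModel B F k, X = p.dConf ξ := ⟨_, rfl⟩
  -- the vectors `X` and `ζ` of `𝓔` have the same projection to `E`
  have hdE : p.toConf.dE (X - ζ) = 0 := by
    have h1 := dE_mfderiv_formSection (π := π) hβ p.toE (p.dE ξ)
    rw [hsec] at h1
    have h2 : p.toConf.dE X = p.dE ξ := (congrArg p.toConf.dE hX).trans (p.dE_eq ξ).symm
    have key : ∀ (T : ConfModel B F k →L[ℝ] B × F) (a b : ConfModel B F k), T a = T b →
        T (a - b) = 0 := by
      intro T a b hab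
      rw [map_sub, hab, sub_self]
    exact key p.toConf.dE X ζ (h2.trans h1.symm)
  have hG₁ : (Φ p).toConf.dE (dG (p.dConf ξ)) = (Φ p).toConf.dE (dG ζ) := by
    have key : ∀ (T : ConfModel B F k →L[ℝ] B × F) (S : ConfModel B F k →L[ℝ] ConfModel B F k)
        (a b : ConfModel B F k), T (S (a - b)) = 0 → T (S a) = T (S b) := by
      intro T S a b hab
      rwa [map_sub, map_sub, sub_eq_zero] at hab
    rw [← hX]
    exact key (Φ p).toConf.dE dG X ζ (h.dE_mfderiv_eq_zero hη hL hreg hp _ hdE)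
  -- the chain rule for `Φ_E = ρ₁ ∘ G ∘ (id, β ∘ π)`
  have hfrozen : mfderiv 𝓘(ℝ, B × F) 𝓘(ℝ, B × F) (frozen G β) p.toE (p.dE ξ) =
      (Φ p).toConf.dE (dG ζ) := by
    have hGd : MDifferentiableAt 𝓘(ℝ, ConfModel B F k) 𝓘(ℝ, ConfModel B F k) G
        (formSection π β p.toE) := by
      rw [hsec]
      exact h.isDiffeoOn_conf.mdifferentiableAt (h.mapsTo p hp)
    have hsd := (contMDiff_formSection (π := π) hβ p.toE).mdifferentiableAt (by simp)
    have h1 := mfderiv_comp p.toE (ConfSpace.mdifferentiableAt_toE (G (formSection π β p.toE)))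
      (hGd.comp p.toE hsd)
    rw [mfderiv_comp p.toE hGd hsd] at h1
    have h2 := congrArg (fun T : B × F →L[ℝ] B × F => T (p.dE ξ)) h1
    refine h2.trans ?_
    have h3 : ∀ q q₁ : ConfSpace π k, q = q₁ →
        (G q).dE (mfderiv 𝓘(ℝ, ConfModel B F k) 𝓘(ℝ, ConfModel B F k) G q ζ) =
        ((G q₁).dE (mfderiv 𝓘(ℝ, ConfModel B F k) 𝓘(ℝ, ConfModel B F k) G q₁ ζ) : B × F) := by
      rintro q _ rfl
      rfl
    refine (h3 _ _ hsec).trans ?_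
    have h4 : ∀ q q₁ : ConfSpace π k, q = q₁ → ∀ a : ConfModel B F k,
        (q.dE a : B × F) = q₁.dE a := by
      rintro q _ rfl a
      rfl
    exact h4 _ _ (h.toConf_map p hp).symm _
  have h1 : (Φ p).dE (mfderiv 𝓘(ℝ, JetModel B F k) 𝓘(ℝ, JetModel B F k) Φ p ξ) =
      (Φ p).toConf.dE (dG (p.dConf ξ)) := by
    rw [JetSpace.dE_eq, h.dConf_mfderiv hp]
  have h2 := hjet p hp rfl v
  have h3 : p.jet v = p.dE ξ := hξ.symm
  rw [h3] at h2
  have h4 := congrArg (fun b : B => ((Φ p).jet b : B × F)) (h.mfderiv_toM hp ξ)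
  exact h1.trans (hG₁.trans (hfrozen.symm.trans (h2.symm.trans h4.symm)))

/-- A section is holonomic if and only if it is tangent to the Cartan distribution. -/
lemma isHolonomicOn_iff {U : Set M} (hU : IsOpen U) {ψ : M → JetSpace π k}
    (hψ : ContMDiffOn 𝓘(ℝ, B) 𝓘(ℝ, JetModel B F k) ∞ ψ U) (hsec : ∀ x ∈ U, (ψ x).toM = x) :
    IsHolonomicOn U ψ ↔ ∀ x ∈ U, ∀ v : TangentSpace 𝓘(ℝ, B) x,
      mfderiv 𝓘(ℝ, B) 𝓘(ℝ, JetModel B F k) ψ x v ∈ cartanDistribution (ψ x) := by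
  refine forall₂_congr fun x hx => forall_congr' fun v => ?_
  have hψx : MDifferentiableAt 𝓘(ℝ, B) 𝓘(ℝ, JetModel B F k) ψ x :=
    (hψ.contMDiffAt (hU.mem_nhds hx)).mdifferentiableAt (by simp)
  have h1 := congrArg (fun T : B →L[ℝ] B × F => T v)
    (mfderiv_comp x (ψ x).mdifferentiableAt_toE hψx)
  have h2 : mfderiv 𝓘(ℝ, JetModel B F k) 𝓘(ℝ, B) JetSpace.toM (ψ x)
      (mfderiv 𝓘(ℝ, B) 𝓘(ℝ, JetModel B F k) ψ x v) = (v : B) := by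
    have h3 := mfderiv_comp x (ψ x).mdifferentiableAt_toM hψx
    have h4 : mfderiv 𝓘(ℝ, B) 𝓘(ℝ, B) (JetSpace.toM ∘ ψ) x = mfderiv 𝓘(ℝ, B) 𝓘(ℝ, B) id x := by
      apply Filter.EventuallyEq.mfderiv_eq
      filter_upwards [hU.mem_nhds hx] with y hy using hsec y hy
    rw [mfderiv_id] at h4
    exact congrArg (fun T : B →L[ℝ] B => T v) (h3.symm.trans h4)
  have h3 := congrArg (fun b : B => ((ψ x).jet b : B × F)) h2
  constructor
  · intro h
    exact h1.symm.trans (h.symm.trans h3.symm)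
  · intro h
    exact h3.symm.trans (h.symm.trans h1.symm)

/-- A symmetry that preserves the Cartan distribution maps holonomic solutions to holonomic
solutions. -/
theorem IsLagrangianSolution.map [T2Space E] {φ' : M → M} {D' : Set M}
    (h : IsDiffeoOn (JetModel B F k) (JetModel B F k) Φ Φ' D)
    (hpres : PreservesOn (lagrangianForm η L) (jetOmega π η) D Φ) (hφ : IsDiffeoOn B B φ φ' D')
    (hτ : ∀ p ∈ D, p.toM ∈ D' → (Φ p).toM = φ p.toM)
    (hC : ∀ p ∈ D, ∀ ξ ∈ cartanDistribution p,
      mfderiv 𝓘(ℝ, JetModel B F k) 𝓘(ℝ, JetModel B F k) Φ p ξ ∈ cartanDistribution (Φ p))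
    {U : Set M} {ψ : M → JetSpace π k} (hU : U ⊆ D') (hψ : MapsTo ψ U D)
    (hsol : IsLagrangianSolution η L U ψ) :
    IsLagrangianSolution η L (φ '' U) (Φ ∘ ψ ∘ φ') := by
  have hmap := hsol.1.map h hpres hφ hτ hU hψ
  refine ⟨hmap, (isHolonomicOn_iff hmap.isOpen hmap.contMDiffOn hmap.isSection).2 ?_⟩
  have hhol := (isHolonomicOn_iff hsol.1.isOpen hsol.1.contMDiffOn hsol.1.isSection).1 hsol.2
  rintro _ ⟨x, hx, rfl⟩ v
  have hx' : φ' (φ x) = x := hφ.left_inv x (hU hx)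
  have hψd : MDifferentiableAt 𝓘(ℝ, B) 𝓘(ℝ, JetModel B F k) ψ (φ' (φ x)) := by
    rw [hx']
    exact (hsol.1.contMDiffOn.contMDiffAt (hsol.1.isOpen.mem_nhds hx)).mdifferentiableAt (by simp)
  have hφd := hφ.mdifferentiableAt_inv (hU hx)
  have hΦd : MDifferentiableAt 𝓘(ℝ, JetModel B F k) 𝓘(ℝ, JetModel B F k) Φ (ψ (φ' (φ x))) := by
    rw [hx']
    exact h.mdifferentiableAt (hψ hx)
  have h1 := mfderiv_comp (φ x) hΦd (hψd.comp (φ x) hφd)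
  rw [mfderiv_comp (φ x) hψd hφd] at h1
  rw [h1]
  have h2 : ∀ y, y ∈ U → ∀ v : B, mfderiv 𝓘(ℝ, JetModel B F k) 𝓘(ℝ, JetModel B F k) Φ (ψ y)
      (mfderiv 𝓘(ℝ, B) 𝓘(ℝ, JetModel B F k) ψ y v) ∈ cartanDistribution (Φ (ψ y)) :=
    fun y hy v => hC _ (hψ hy) _ (hhol y hy v)
  exact h2 (φ' (φ x)) (by rwa [hx']) (mfderiv 𝓘(ℝ, B) 𝓘(ℝ, B) φ' (φ x) v)

end CartanDistribution

/-! ### Natural symmetries preserve the Cartan distribution -/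

/-- Vector fields whose local flows are related by `f` around each point are related by `f`. -/
lemma projectsOnto_of_locally {V W N N' : Type*} [NormedAddCommGroup V] [NormedSpace ℝ V]
    [TopologicalSpace N] [ChartedSpace V N] [IsManifold 𝓘(ℝ, V) ∞ N]
    [NormedAddCommGroup W] [NormedSpace ℝ W]
    [TopologicalSpace N'] [ChartedSpace W N'] [IsManifold 𝓘(ℝ, W) ∞ N'] {f : N → N'}
    (hf : MDifferentiable 𝓘(ℝ, V) 𝓘(ℝ, W) f) {Y : ∀ p : N, TangentSpace 𝓘(ℝ, V) p}
    {Z : ∀ x : N', TangentSpace 𝓘(ℝ, W) x}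
    (h : ∀ p : N, ∃ (Fl : LocalFlow Y) (φl : LocalFlow Z), φl.time = Fl.time ∧ p ∈ Fl.dom ∧
      f p ∈ φl.dom ∧ ∀ t ∈ Fl.time, f (Fl.toFun t p) = φl.toFun t (f p)) :
    ProjectsOnto f Y Z := by
  intro p
  obtain ⟨Fl, φl, htime, hp, hfp, hflow⟩ := h p
  have h0 : Fl.time ∈ 𝓝 (0 : ℝ) := Fl.isOpen_time.mem_nhds Fl.zero_mem
  have h1 := (hf (Fl.toFun 0 p)).hasMFDerivAt.comp (0 : ℝ)
    ((Fl.isIntegralCurve p hp 0 Fl.zero_mem).hasMFDerivAt h0)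
  have h2 := ((φl.isIntegralCurve (f p) hfp 0 φl.zero_mem).hasMFDerivAt
    (htime ▸ h0)).congr_of_eventuallyEq (f₁ := f ∘ fun t => Fl.toFun t p)
      (Filter.eventually_of_mem h0 hflow)
  have h3 := congrArg (fun T : ℝ →L[ℝ] W => T 1) (hasMFDerivAt_unique h1 h2)
  have h4 : mfderiv 𝓘(ℝ, V) 𝓘(ℝ, W) f (Fl.toFun 0 p) (Y (Fl.toFun 0 p)) =
      (Z (φl.toFun 0 (f p)) : W) := by
    have key : ∀ (T : V →L[ℝ] W) (a : V) (b : W),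
        (T ∘L (1 : ℝ →L[ℝ] ℝ).smulRight a) 1 = (1 : ℝ →L[ℝ] ℝ).smulRight b 1 → T a = b := by
      intro T a b hab
      simpa using hab
    exact key _ _ _ h3
  rw [φl.map_zero _ hfp] at h4
  have h5 : ∀ q, q = p → mfderiv 𝓘(ℝ, V) 𝓘(ℝ, W) f q (Y q) = (Z (f p) : W) →
      mfderiv 𝓘(ℝ, V) 𝓘(ℝ, W) f p (Y p) = Z (f p) := by
    rintro q rfl hq
    exact hq
  exact h5 _ (Fl.map_zero p hp) h4

section Natural

variable {B F M E : Type*} [NormedAddCommGroup B] [NormedSpace ℝ B] [FiniteDimensional ℝ B]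
  [NormedAddCommGroup F] [NormedSpace ℝ F] [FiniteDimensional ℝ F]
  [TopologicalSpace M] [ChartedSpace B M] [IsManifold 𝓘(ℝ, B) ∞ M]
  [TopologicalSpace E] [ChartedSpace (B × F) E] [IsManifold 𝓘(ℝ, B × F) ∞ E]
  {π : FibredManifold B F M E} {k : ℕ} {η : Form B M (k + 1)} {L : JetSpace π k → ℝ}

lemma IsNatural.toM_map {Φ : Diffeomorph 𝓘(ℝ, JetModel B F k) 𝓘(ℝ, JetModel B F k)
      (JetSpace π k) (JetSpace π k) ∞} {φ : Diffeomorph 𝓘(ℝ, B) 𝓘(ℝ, B) M M ∞}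
    (h : IsNatural Φ φ) (p : JetSpace π k) : (Φ p).toM = φ p.toM := by
  obtain ⟨G, Ψ, -, hGM, hlift⟩ := h
  exact (congrArg ConfSpace.toM (hlift.toConf_map p (mem_univ p))).trans (hGM p.toConf)

theorem IsNatural.mfderiv_mem_cartanDistribution
    {Φ : Diffeomorph 𝓘(ℝ, JetModel B F k) 𝓘(ℝ, JetModel B F k)
      (JetSpace π k) (JetSpace π k) ∞} {φ : Diffeomorph 𝓘(ℝ, B) 𝓘(ℝ, B) M M ∞}
    (h : IsNatural Φ φ) (hΦ : IsStrongNoether (lagrangianForm η L) (jetOmega π η) Φ)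
    (hη : ∀ x, η x ≠ 0) (hL : ContMDiff 𝓘(ℝ, JetModel B F k) 𝓘(ℝ, ℝ) ∞ L)
    (hreg : IsRegularLagrangian L) (p : JetSpace π k)
    {ξ : TangentSpace 𝓘(ℝ, JetModel B F k) p} (hξ : ξ ∈ cartanDistribution p) :
    mfderiv 𝓘(ℝ, JetModel B F k) 𝓘(ℝ, JetModel B F k) Φ p ξ ∈ cartanDistribution (Φ p) := by
  have hM := h.toM_map
  obtain ⟨G, Ψ, -, hGM, hlift⟩ := h
  have hsymm : IsFibredSymmetry η L Φ Φ.symm univ G G.symm univ φ :=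
    { isDiffeoOn := isDiffeoOn_of_diffeomorph Φ
      isDiffeoOn_conf := isDiffeoOn_of_diffeomorph G
      mapsTo := fun _ _ => mem_univ _
      toConf_map := hlift.toConf_map
      toM_map := fun p _ => hM p
      mdifferentiableAt := fun p _ =>
        (isDiffeoOn_of_diffeomorph φ).mdifferentiableAt (mem_univ _)
      preservesOn := hΦ }
  exact hsymm.mfderiv_mem_cartanDistribution hη hL hreg hlift (mem_univ p) hξ

variable [T2Space M] [T2Space E] {Y : ∀ p : JetSpace π k, TangentSpace 𝓘(ℝ, JetModel B F k) p}
  {Z : ∀ x : M, TangentSpace 𝓘(ℝ, B) x}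

lemma IsInfNatural.projectsOnto (h : IsInfNatural Y Z) : ProjectsOnto JetSpace.toM Y Z := by
  obtain ⟨Y', -, -, -, hZ, -, hYZ, hlocal⟩ := h
  refine projectsOnto_of_locally (fun p => p.mdifferentiableAt_toM) fun p => ?_
  obtain ⟨Fl, Gl, φl, hGt, hφt, hp, hpG, hpφ, hlift⟩ := hlocal p
  refine ⟨Fl, φl, hφt, hp, hpφ p hp, fun t ht => ?_⟩
  exact (congrArg ConfSpace.toM ((hlift t ht).toConf_map p hp)).trans
    (Gl.map_toFun hYZ (ConfSpace.contMDiff_toM.mdifferentiable (by simp)) hZ φl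
      ⟨hGt ▸ ht, hφt ▸ ht⟩ (hpG p hp) (hpφ p hp))

/-- The local flows in the definition of a natural vector field preserve the Cartan distribution;
hence so do all local flows of the field. -/
theorem IsInfNatural.mfderiv_mem_cartanDistribution (h : IsInfNatural Y Z)
    (hY : IsInfStrongNoether (lagrangianForm η L) (jetOmega π η) Y) (hη : ∀ x, η x ≠ 0)
    (hL : ContMDiff 𝓘(ℝ, JetModel B F k) 𝓘(ℝ, ℝ) ∞ L) (hreg : IsRegularLagrangian L)
    (Fl : LocalFlow Y) {t : ℝ} (ht : t ∈ Fl.time) {p : JetSpace π k} (hp : p ∈ Fl.dom)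
    {ξ : TangentSpace 𝓘(ℝ, JetModel B F k) p} (hξ : ξ ∈ cartanDistribution p) :
    mfderiv 𝓘(ℝ, JetModel B F k) 𝓘(ℝ, JetModel B F k) (Fl.toFun t) p ξ ∈
      cartanDistribution (Fl.toFun t p) := by
  have hM := h.projectsOnto
  obtain ⟨Y', -, -, -, hZ, -, -, hlocal⟩ := h
  refine Fl.mfderiv_mem_of_locally hY.1 cartanDistribution (fun p₀ => ?_) ht hp hξ
  obtain ⟨Fl₀, Gl, φl, hGt, hφt, hp₀, hpG, hpφ, hlift⟩ := hlocal p₀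
  refine ⟨Fl₀, hp₀, fun s hs q hq ζ hζ => ?_⟩
  have hsymm : IsFibredSymmetry η L (Fl₀.toFun s) (Fl₀.invFun s) Fl₀.dom
      (Gl.toFun s) (Gl.invFun s) Gl.dom (φl.toFun s) :=
    { isDiffeoOn := Fl₀.isDiffeoOn hs
      isDiffeoOn_conf := Gl.isDiffeoOn (hGt ▸ hs)
      mapsTo := hpG
      toConf_map := (hlift s hs).toConf_map
      toM_map := fun r hr => Fl₀.map_toFun hM
        (JetSpace.contMDiff_toM.mdifferentiable (by simp)) hZ φl ⟨hs, hφt ▸ hs⟩ hr (hpφ r hr)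
      mdifferentiableAt := fun r hr => (φl.isDiffeoOn (hφt ▸ hs)).mdifferentiableAt (hpφ r hr)
      preservesOn := hY.2 Fl₀ s hs }
  exact hsymm.mfderiv_mem_cartanDistribution hη hL hreg (hlift s hs) hq hζ

end Natural

end Multicontact

theorem mainTheorem5
    {B F M E : Type*}
    [NormedAddCommGroup B] [NormedSpace ℝ B] [FiniteDimensional ℝ B]
    [NormedAddCommGroup F] [NormedSpace ℝ F] [FiniteDimensional ℝ F]
    [TopologicalSpace M] [ChartedSpace B M] [IsManifold 𝓘(ℝ, B) ∞ M]
    [T2Space M] [SecondCountableTopology M]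
    [TopologicalSpace E] [ChartedSpace (B × F) E] [IsManifold 𝓘(ℝ, B × F) ∞ E]
    [T2Space E] [SecondCountableTopology E]
    (k : ℕ) (hk : Module.finrank ℝ B = k + 1)
    (π : FibredManifold B F M E)
    (η : Form B M (k + 1)) (hη : SmoothForm η) (hη₀ : ∀ x, η x ≠ 0) :
    -- natural strong Noether symmetries of Lagrangian systems
    (∀ L : JetSpace π k → ℝ, ContMDiff 𝓘(ℝ, JetModel B F k) 𝓘(ℝ, ℝ) ∞ L → IsRegularLagrangian L →
      ∀ (Φ : Diffeomorph 𝓘(ℝ, JetModel B F k) 𝓘(ℝ, JetModel B F k)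
          (JetSpace π k) (JetSpace π k) ∞)
        (φ : Diffeomorph 𝓘(ℝ, B) 𝓘(ℝ, B) M M ∞),
        IsStrongNoether (lagrangianForm η L) (jetOmega π η) Φ → IsNatural Φ φ →
        ∀ (U : Set M) (ψ : M → JetSpace π k),
          IsLagrangianSolution η L U ψ →
          IsLagrangianSolution η L (φ '' U) (Φ ∘ ψ ∘ φ.symm)) ∧
    -- infinitesimal natural strong Noether symmetries of Lagrangian systems
    (∀ L : JetSpace π k → ℝ, ContMDiff 𝓘(ℝ, JetModel B F k) 𝓘(ℝ, ℝ) ∞ L → IsRegularLagrangian L →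
      ∀ (Y : ∀ p : JetSpace π k, TangentSpace 𝓘(ℝ, JetModel B F k) p)
        (Z : ∀ x : M, TangentSpace 𝓘(ℝ, B) x),
        IsInfStrongNoether (lagrangianForm η L) (jetOmega π η) Y → IsInfNatural Y Z →
        ∀ (Fl : LocalFlow Y) (φl : LocalFlow Z), ∀ t ∈ Fl.time ∩ φl.time,
        ∀ (U : Set M) (ψ : M → JetSpace π k), U ⊆ φl.dom → MapsTo ψ U Fl.dom →
          IsLagrangianSolution η L U ψ →
          IsLagrangianSolution η L (φl.toFun t '' U) (Fl.toFun t ∘ ψ ∘ φl.invFun t)) ∧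
    -- restricted strong Noether symmetries of Hamiltonian systems
    (∀ (h : HamiltonianSection π k)
      (Φ : Diffeomorph 𝓘(ℝ, DualJetModel B F k) 𝓘(ℝ, DualJetModel B F k)
          (DualJetSpace π k) (DualJetSpace π k) ∞)
        (φ : Diffeomorph 𝓘(ℝ, B) 𝓘(ℝ, B) M M ∞),
        IsStrongNoether (hamiltonianForm h) (dualJetOmega π η) Φ →
        (∀ p, (Φ p).toM = φ p.toM) →
        ∀ (U : Set M) (ψ : M → DualJetSpace π k),
          IsHamiltonianSolution η h U ψ →
          IsHamiltonianSolution η h (φ '' U) (Φ ∘ ψ ∘ φ.symm)) ∧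
    -- infinitesimal restricted strong Noether symmetries of Hamiltonian systems
    (∀ (h : HamiltonianSection π k)
        (Y : ∀ p : DualJetSpace π k, TangentSpace 𝓘(ℝ, DualJetModel B F k) p)
        (Z : ∀ x : M, TangentSpace 𝓘(ℝ, B) x),
        IsInfStrongNoether (hamiltonianForm h) (dualJetOmega π η) Y →
        SmoothField Z → ProjectsOnto DualJetSpace.toM Y Z →
        ∀ (Fl : LocalFlow Y) (φl : LocalFlow Z), ∀ t ∈ Fl.time ∩ φl.time,
        ∀ (U : Set M) (ψ : M → DualJetSpace π k), U ⊆ φl.dom → MapsTo ψ U Fl.dom →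
          IsHamiltonianSolution η h U ψ →
          IsHamiltonianSolution η h (φl.toFun t '' U) (Fl.toFun t ∘ ψ ∘ φl.invFun t)) := by
  refine ⟨?_, ?_, ?_, ?_⟩
  · intro L hL hreg Φ φ hΦ hnat U ψ hψ
    exact hψ.map (isDiffeoOn_of_diffeomorph Φ) hΦ (isDiffeoOn_of_diffeomorph φ)
      (fun p _ _ => hnat.toM_map p)
      (fun p _ ξ hξ => hnat.mfderiv_mem_cartanDistribution hΦ hη₀ hL hreg p hξ)
      (subset_univ U) (mapsTo_univ ψ U)
  · intro L hL hreg Y Z hY hnat Fl φl t ht U ψ hU hψD hψ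
    have hZ : SmoothField Z := by
      obtain ⟨-, -, -, -, hZ, -⟩ := hnat
      exact hZ
    exact hψ.map (Fl.isDiffeoOn ht.1) (hY.2 Fl t ht.1) (φl.isDiffeoOn ht.2)
      (fun p hp hp' => Fl.map_toFun hnat.projectsOnto
        (JetSpace.contMDiff_toM.mdifferentiable (by simp)) hZ φl ht hp hp')
      (fun p hp ξ hξ => hnat.mfderiv_mem_cartanDistribution hY hη₀ hL hreg Fl ht.1 hp hξ)
      hU hψD
  · intro h Φ φ hΦ hM U ψ hψ
    exact IsSolution.map (isDiffeoOn_of_diffeomorph Φ) hΦ (isDiffeoOn_of_diffeomorph φ)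
      (fun p _ _ => hM p) (subset_univ U) (mapsTo_univ ψ U) hψ
  · intro h Y Z hY hZ hYZ Fl φl t ht U ψ hU hψD hψ
    exact IsSolution.map (Fl.isDiffeoOn ht.1) (hY.2 Fl t ht.1) (φl.isDiffeoOn ht.2)
      (fun p hp hp' => Fl.map_toFun hYZ
        (DualJetSpace.contMDiff_toM.mdifferentiable (by simp)) hZ φl ht hp hp') hU hψD hψ
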